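/- Let $\mu>0$, $\nu,\lambda\in\mathbb C$ with $\operatorname{Re}\nu>0$, let $\mathbb T=\mathbb R^2/\mathbb Z^2$, $A=(i+\mu)\Delta-1$, and let $\mathcal C^{\beta}=B^{\beta}_{\infty,\infty}(\mathbb T)$ be the Besov space of complex distributions with its Littlewood–Paley norm. A driver is a quadruple $\underline Z=(Z,Z^2,|Z|^2,|Z|^2Z)$ (the last three entries are not functions of $Z$) such that, for every $\alpha>0$, $Z\in C([0,\infty);\mathcal C^{-\alpha})$, the other three entries lie in $C((0,\infty);\mathcal C^{-\alpha})$, and $\sup_{0<t\le T}\|\underline Z_t\|_{\mathcal Z_\alpha}<\infty$ for every $T>0$, where $$\|\underline Z_t\|_{\mathcal Z_\alpha}=\max\{\|Z_t\|_{\mathcal C^{-\alpha}},\,t^\alpha\|Z^2_t\|_{\mathcal C^{-\alpha}},\,t^\alpha\||Z|^2_t\|_{\mathcal C^{-\alpha}},\,t^\alpha\||Z|^2Z_t\|_{\mathcal C^{-\alpha}}\}.$$ Put $$\Psi(Y_t,\underline Z_t)=(1+\lambda)(Z_t+Y_t)-\nu\big(|Y_t|^2Y_t+2Z_t|Y_t|^2+\overline{Z_t}\,Y_t^2+2|Z|^2_tY_t+Z^2_t\,\overline{Y_t}+|Z|^2Z_t\big).$$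 For $T>0$ and $Y_0\in\mathcal C^{-\alpha_0}$ with $\alpha_0\in(0,\frac23)$, let $S^T(Y_0,\underline Z)$ be the set of all $Y$ for which there are $\alpha_1>0$ and $\gamma\in(0,\frac13)$ with $Y\in C((0,T];\mathcal C^{\alpha_1})$ and $\sup_{0<t\le T}t^\gamma\|Y_t\|_{\mathcal C^{\alpha_1}}<\infty$, and for which $$Y_t=e^{tA}Y_0+\int_0^te^{(t-s)A}\Psi(Y_s,\underline Z_s)\,ds\qquad(0<t\le T).$$ **Proposition.** Let $p\in[2,p(\mu))$, where $p(\mu)=2(1+\mu^2+\mu\sqrt{1+\mu^2})$. There exist $b\in[1,\infty)$ and $c\in(0,\infty)$ such that for each $\alpha\in(0,\frac12)$ there is a constant $C\in(0,\infty)$ such that for all $\alpha_0\in(0,\frac23)$, all $Y_0\in\mathcal C^{-\alpha_0}$, all drivers $\underline Z$, all $T\in(0,\infty)$ and all $Y\in S^T(Y_0,\underline Z)$ the following holds. First, $Y\in C((0,T];\mathcal C^{\beta})$ for some $\beta>1$, so that $Y_s$ and $\nabla Y_s$ are continuous functions on $\mathbb T$. Secondly, for all $0<t_0\le t\le T$ the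 integrands in time below are integrable on $[t_0,t]$, and $$\|Y_t\|_{L^p}^p-\|Y_{t_0}\|_{L^p}^p+c\int_{t_0}^t\|Y_s\|_{L^{p+2}}^{p+2}\,ds+c\int_{t_0}^t\big\||\nabla Y_s|^2|Y_s|^{p-2}\big\|_{L^1}\,ds\le C\int_{t_0}^t\big(1+\max\{s^{-\alpha}\|\underline Z_s\|_{\mathcal Z_\alpha},\,\|Z_s\|_{\mathcal C^{-\alpha}}\}\big)^b\,ds .$$ (For $s\le1$ the maximum equals $s^{-\alpha}\|\underline Z_s\|_{\mathcal Z_\alpha}$.) -/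

import Mathlib

open Filter Topology MeasureTheory Set
open scoped ENNReal

noncomputable section

/-- The two-dimensional torus `ℝ² / ℤ²`. -/
abbrev Torus2 : Type := UnitAddTorus (Fin 2)

/-- Lebesgue measure on the torus (total mass one). -/
def torusMeasure : Measure Torus2 :=
  Measure.pi fun _ : Fin 2 => (AddCircle.haarAddCircle : Measure UnitAddCircle)

/-- A (complex) distribution on the torus, given by its family of Fourier coefficients
`k ↦ ⟨u, e^{-2πi k·x}⟩`. Families that lie in one of the Besov spaces below grow at most
polynomially, so that they are the Fourier coefficients of a unique distribution. -/
abbrev TorusDist : Type := (Fin 2 → ℤ) → ℂ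

/-- The Euclidean length of a frequency `k ∈ ℤ²`. -/
def freqNorm (k : Fin 2 → ℤ) : ℝ := Real.sqrt (∑ l, (k l : ℝ) ^ 2)

/-- A smooth radial cut-off, as a function of `r = |ξ|`: it is `1` for `r ≤ 3/4` and `0` for
`r ≥ 4/3`. -/
def lpCutoff (r : ℝ) : ℝ := Real.smoothTransition ((16 - 12 * r) / 7)

/-- The dyadic partition of unity. The index `n : ℕ` stands for `j = n - 1 ≥ -1`: `n = 0` is the
low-frequency ball, and for `j = n - 1 ≥ 0` the symbol is `χ(2^{-j} k)`, with `χ` supported in the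
annulus `3/4 ≤ |ξ| ≤ 8/3`. -/
def lpSymbol : ℕ → (Fin 2 → ℤ) → ℝ
  | 0, k => lpCutoff (freqNorm k)
  | n + 1, k => lpCutoff (freqNorm k / 2 ^ (n + 1)) - lpCutoff (freqNorm k / 2 ^ n)

/-- The Littlewood–Paley block `Δ_{n-1} u`, a trigonometric polynomial (the sum has only finitely
many nonzero terms). -/
def lpBlock (n : ℕ) (u : TorusDist) (x : Torus2) : ℂ :=
  ∑' k : Fin 2 → ℤ, (lpSymbol n k : ℂ) * u k * UnitAddTorus.mFourier k x

/-- The norm of `𝒞^β = B^β_{∞,∞}`, namely `sup_{j ≥ -1} 2^{jβ} ‖Δ_j u‖_{L^∞}`; it is `∞` exactly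
when `u ∉ 𝒞^β`. -/
def besovNorm (β : ℝ) (u : TorusDist) : ℝ≥0∞ :=
  ⨆ n : ℕ, ENNReal.ofReal ((2 : ℝ) ^ (((n : ℝ) - 1) * β)) * ⨆ x : Torus2, ‖lpBlock n u x‖ₑ

/-- `Y ∈ C(S; 𝒞^β)` for a set `S` of times. -/
def BesovContinuousOn (β : ℝ) (Y : ℝ → TorusDist) (S : Set ℝ) : Prop :=
  ∀ t ∈ S, besovNorm β (Y t) < ⊤ ∧
    Tendsto (fun s => besovNorm β (Y s - Y t)) (𝓝[S] t) (𝓝 0)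

/-- The complex conjugate of a distribution. -/
def conjDist (u : TorusDist) : TorusDist := fun k => star (u (-k))

/-- The product of two distributions, whose Fourier coefficients are the convolution of those of
the factors. The sum converges absolutely for `u ∈ 𝒞^{-α}`, `v ∈ 𝒞^β` with `α < β` (such `u`, `v`
lie in the dual Sobolev spaces `H^{-s}`, `H^s` for `α < s < β`), and it is then the continuous
extension of the product of smooth functions. -/
def mulDist (u v : TorusDist) : TorusDist := fun k => ∑' j : Fin 2 → ℤ, u j * v (k - j)

/-- The partial derivative `∂_l u` in the sense of distributions. -/
def partialDist (l : Fin 2) (u : TorusDist) : TorusDist :=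
  fun k => 2 * Real.pi * Complex.I * (k l : ℂ) * u k

/-- The semigroup `e^{tA}` of `A = (i + μ)Δ - 1`. -/
def semigroupA (μ t : ℝ) (u : TorusDist) : TorusDist := fun k =>
  Complex.exp (-(t : ℂ) * (1 + (Complex.I + μ) * ((4 * Real.pi ^ 2 * freqNorm k ^ 2 : ℝ) : ℂ)))
    * u k

/-- A driving family `(Z, Z², |Z|², |Z|²Z)`; the last three entries are not functions of `Z`. -/
structure Driver where
  Z : ℝ → TorusDist
  Zsq : ℝ → TorusDist
  absZsq : ℝ → TorusDist
  absZsqZ : ℝ → TorusDist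

/-- `max {‖Z_t‖, t^α ‖Z²_t‖, t^α ‖|Z|²_t‖, t^α ‖|Z|²Z_t‖}` with norms in `𝒞^{-α}`. -/
def driverNorm (α : ℝ) (Z : Driver) (t : ℝ) : ℝ≥0∞ :=
  max (besovNorm (-α) (Z.Z t))
    (max (ENNReal.ofReal (t ^ α) * besovNorm (-α) (Z.Zsq t))
      (max (ENNReal.ofReal (t ^ α) * besovNorm (-α) (Z.absZsq t))
        (ENNReal.ofReal (t ^ α) * besovNorm (-α) (Z.absZsqZ t))))

/-- The set of admissible driving families. -/
def IsAdmissibleDriver (Z : Driver) : Prop :=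
  ∀ α : ℝ, 0 < α →
    BesovContinuousOn (-α) Z.Z (Ici 0) ∧ BesovContinuousOn (-α) Z.Zsq (Ioi 0) ∧
    BesovContinuousOn (-α) Z.absZsq (Ioi 0) ∧ BesovContinuousOn (-α) Z.absZsqZ (Ioi 0) ∧
    ∀ T : ℝ, 0 < T → (⨆ t ∈ Ioc 0 T, driverNorm α Z t) < ⊤

/-- The nonlinearity `Ψ(y, Z_t)`. -/
def nonlinPsi (ν lam : ℂ) (y : TorusDist) (Z : Driver) (t : ℝ) : TorusDist :=
  (1 + lam) • (Z.Z t + y) -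
    ν • (mulDist (mulDist y (conjDist y)) y
      + (2 : ℂ) • mulDist (Z.Z t) (mulDist y (conjDist y))
      + mulDist (conjDist (Z.Z t)) (mulDist y y)
      + (2 : ℂ) • mulDist (Z.absZsq t) y
      + mulDist (Z.Zsq t) (conjDist y)
      + Z.absZsqZ t)

/-- `Y` is a (mild) solution of `∂_t Y = A Y + Ψ(Y, Z)`, `Y(0) = Y₀`, over `[0, T]`. The mild
equation is an identity of distributions and is tested against each exponential. -/
def IsSolution (μ : ℝ) (ν lam : ℂ) (T : ℝ) (Y₀ : TorusDist) (Z : Driver)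
    (Y : ℝ → TorusDist) : Prop :=
  (∃ α₁ γ : ℝ, 0 < α₁ ∧ 0 < γ ∧ γ < 1 / 3 ∧ BesovContinuousOn α₁ Y (Ioc 0 T) ∧
    (⨆ t ∈ Ioc 0 T, ENNReal.ofReal (t ^ γ) * besovNorm α₁ (Y t)) < ⊤) ∧
  ∀ t ∈ Ioc 0 T, ∀ k : Fin 2 → ℤ,
    Y t k = semigroupA μ t Y₀ k
      + ∫ s in (0 : ℝ)..t, semigroupA μ (t - s) (nonlinPsi ν lam (Y s) Z s) k

/-- The continuous function on the torus that a distribution of positive regularity is: its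
Littlewood–Paley series, which converges uniformly if `u ∈ 𝒞^β` for some `β > 0`. -/
def distFun (u : TorusDist) (x : Torus2) : ℂ := ∑' n : ℕ, lpBlock n u x

/-- `‖u‖_{L^q}^q`. -/
def lqNormPow (q : ℝ) (u : TorusDist) : ℝ := ∫ x : Torus2, ‖distFun u x‖ ^ q ∂torusMeasure

/-- `‖ |∇u|² |u|^{p-2} ‖_{L¹}`. -/
def gradEnergy (p : ℝ) (u : TorusDist) : ℝ :=
  ∫ x : Torus2, (∑ l : Fin 2, ‖distFun (partialDist l u) x‖ ^ 2) * ‖distFun u x‖ ^ (p - 2)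
    ∂torusMeasure

end

open UnitAddTorus (mFourier)

/-! Test the equation with the duality map $|Y|^{p-2}\overline Y$ of $L^p$: the time derivative of
$\|Y\|_{L^p}^p$ is $p\,\mathrm{Re}\int \partial_t Y\,|Y|^{p-2}\overline Y$. Write
$V=\|Y\|_{L^{p+2}}^{p+2}$ and $G=\||\nabla Y|^2|Y|^{p-2}\|_{L^1}$.

After integration by parts the operator $(i+\mu)\Delta$ produces, pointwise, a quadratic form in the
real and imaginary parts of $\overline Y\partial_l Y$. It is positive definite exactly when
$(p-2)^2<4\mu^2(p-1)$, which for $p\ge2$ is the condition $p<p(\mu)$ (`exists_ellipticity`,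
`le_re_mul_dualMapDeriv`). This gives $-c_1G$. The cubic term gives $-\mathrm{Re}\,\nu\,V$.

Every other term with a driver entry pairs a distribution $u\in\mathcal C^{-\alpha}$ with a function
$f$ that behaves like a power of $Y$ of degree between $p-1$ and $p+1$. Such a pairing is bounded by
$\|u\|\,(\|f\|_{L^1}+\sqrt{\|f\|_{L^1}\|\nabla f\|_{L^1}})$ because $\alpha<\frac12$
(`exists_pairing_bound`). Here $\|f\|_{L^1}\lesssim 1+\|Y\|_{L^{p+1}}^{p+1}$ and $\|\nabla
f\|_{L^1}\lesssim1+V+G$, so Young's inequality bounds the pairing by $\delta(V+G)+CX^{2(p+2)}$, with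
$X\ge1$ the size of the driver (`exists_absorb`, `exists_forcing_estimate`). This fixes $b=2(p+2)$,
and the good terms absorb the rest.

To make this rigorous for a mild solution, Duhamel's formula and parabolic smoothing bound $Y$ in
$\mathcal C^{5/4}$ away from time zero, interpolation gives continuity in time in $\mathcal
C^{9/8}$, and each Fourier coefficient solves an ordinary differential equation
(`IsSolution.strong`). The computation above is done for smooth low-frequency truncations of $Y$,
which are trigonometric polynomials with a fixed finite spectrum. Truncation does not commute with
the nonlinearity, but the error tends to zero in $\mathcal C^{-1/3}$ (`exists_truncation_error`),
and $\frac13<\frac12$ lets the same pairing estimate remove it in the limit.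

The Besov calculus behind this (multipliers, Bernstein, inverse gradient, products, smoothing) rests
on one estimate, `integral_norm_kernel_le`: an $L^1$ bound for convolution kernels, obtained from
Parseval and a weight. -/

instance : IsProbabilityMeasure torusMeasure := by unfold torusMeasure; infer_instance

instance : Measure.IsAddHaarMeasure torusMeasure := by unfold torusMeasure; infer_instance

/-! ### Trigonometric polynomials. -/

/-- The trigonometric polynomial with the (finitely many nonzero) coefficients `c`. -/
noncomputable def trig (c : TorusDist) (x : Torus2) : ℂ :=
  ∑' k : Fin 2 → ℤ, c k * mFourier k x

/-- A coefficient family with finite support. -/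
def FinSupp (c : TorusDist) : Prop := (Function.support c).Finite

lemma FinSupp.exists_finset {c : TorusDist} (h : FinSupp c) :
    ∃ F : Finset (Fin 2 → ℤ), ∀ k ∉ F, c k = 0 :=
  ⟨Set.Finite.toFinset h, fun k hk => by
    by_contra h0
    exact hk ((Set.Finite.mem_toFinset h).2 h0)⟩

lemma FinSupp.of_finset {c : TorusDist} (F : Finset (Fin 2 → ℤ)) (h : ∀ k ∉ F, c k = 0) :
    FinSupp c :=
  F.finite_toSet.subset fun k hk => by
    by_contra hkF
    exact hk (h k hkF)

lemma FinSupp.mono {c d : TorusDist} (hc : FinSupp c) (h : ∀ k, c k = 0 → d k = 0) :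
    FinSupp d :=
  Set.Finite.subset hc fun k hk hck => hk (h k hck)

lemma FinSupp.add {c d : TorusDist} (hc : FinSupp c) (hd : FinSupp d) : FinSupp (c + d) :=
  (Set.Finite.union hc hd).subset (Function.support_add c d)

lemma FinSupp.sub {c d : TorusDist} (hc : FinSupp c) (hd : FinSupp d) : FinSupp (c - d) :=
  (Set.Finite.union hc hd).subset (Function.support_sub c d)

lemma FinSupp.smul {c : TorusDist} (hc : FinSupp c) (a : ℂ) : FinSupp (a • c) :=
  hc.mono fun k hk => by simp [hk]

lemma FinSupp.mul_left {c : TorusDist} (hc : FinSupp c) (m : TorusDist) :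
    FinSupp fun k => m k * c k :=
  hc.mono fun k hk => by simp [hk]

lemma FinSupp.mul_right {c : TorusDist} (hc : FinSupp c) (m : TorusDist) :
    FinSupp fun k => c k * m k :=
  hc.mono fun k hk => by simp [hk]

lemma FinSupp.sum {ι : Type*} (s : Finset ι) {c : ι → TorusDist} (h : ∀ i ∈ s, FinSupp (c i)) :
    FinSupp fun k => ∑ i ∈ s, c i k :=
  (s.finite_toSet.biUnion (t := fun i => Function.support (c i)) h).subset fun k hk => by
    by_contra hne
    apply hk
    refine Finset.sum_eq_zero fun i hi => ?_
    by_contra h0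
    exact hne (Set.mem_biUnion (Finset.mem_coe.2 hi) h0)

lemma trig_eq_sum {c : TorusDist} {F : Finset (Fin 2 → ℤ)} (h : ∀ k ∉ F, c k = 0)
    (x : Torus2) : trig c x = ∑ k ∈ F, c k * mFourier k x :=
  tsum_eq_sum fun k hk => by simp [h k hk]

lemma summable_trig {c : TorusDist} (hc : FinSupp c) (x : Torus2) :
    Summable fun k => c k * mFourier k x :=
  summable_of_hasFiniteSupport (hc.mul_right fun k => mFourier k x)

lemma trig_add {c d : TorusDist} (hc : FinSupp c) (hd : FinSupp d) (x : Torus2) :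
    trig (c + d) x = trig c x + trig d x := by
  simp only [trig, Pi.add_apply, add_mul]
  exact (summable_trig hc x).tsum_add (summable_trig hd x)

lemma trig_sub {c d : TorusDist} (hc : FinSupp c) (hd : FinSupp d) (x : Torus2) :
    trig (c - d) x = trig c x - trig d x := by
  simp only [trig, Pi.sub_apply, sub_mul]
  exact (summable_trig hc x).tsum_sub (summable_trig hd x)

lemma trig_smul (a : ℂ) (c : TorusDist) (x : Torus2) : trig (a • c) x = a * trig c x := by
  simp only [trig, Pi.smul_apply, smul_eq_mul, mul_assoc, tsum_mul_left]

lemma trig_zero (x : Torus2) : trig 0 x = 0 := by simp [trig]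

lemma trig_sum {ι : Type*} (s : Finset ι) {c : ι → TorusDist} (h : ∀ i ∈ s, FinSupp (c i))
    (x : Torus2) : trig (fun k => ∑ i ∈ s, c i k) x = ∑ i ∈ s, trig (c i) x := by
  simp only [trig, Finset.sum_mul]
  exact Summable.tsum_finsetSum fun i hi => summable_trig (h i hi) x

lemma continuous_trig {c : TorusDist} (hc : FinSupp c) : Continuous (trig c) := by
  obtain ⟨F, hF⟩ := hc.exists_finset
  have : trig c = fun x => ∑ k ∈ F, c k * mFourier k x := funext fun x => trig_eq_sum hF x
  rw [this]
  fun_prop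

lemma norm_mFourier_apply (k : Fin 2 → ℤ) (x : Torus2) : ‖mFourier k x‖ = 1 := by
  simp [mFourier, fourier_apply, Circle.norm_coe]

lemma integrable_torus {E : Type*} [NormedAddCommGroup E] {f : Torus2 → E} (hf : Continuous f) :
    Integrable f torusMeasure := by
  rw [← integrableOn_univ]
  exact hf.continuousOn.integrableOn_compact isCompact_univ

lemma integral_mFourier (k : Fin 2 → ℤ) :
    ∫ x, mFourier k x ∂torusMeasure = if k = 0 then 1 else 0 := by
  split_ifs with h
  · subst h
    simp [UnitAddTorus.mFourier_zero]
  · simp only [mFourier, ContinuousMap.coe_mk, torusMeasure]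
    rw [integral_fintype_prod_eq_prod (𝕜 := ℂ) (fun i (y : UnitAddCircle) => fourier (k i) y)]
    obtain ⟨i, hi⟩ := Function.ne_iff.mp h
    apply Finset.prod_eq_zero (Finset.mem_univ i)
    have := (orthonormal_iff_ite.mp <| orthonormal_fourier (T := 1)) 0 (k i)
    rw [if_neg (fun h => hi (by simp [← h]))] at this
    simpa only [ContinuousMap.inner_toLp, ← fourier_neg, ← fourier_add, neg_zero, zero_add,
      add_zero, fourier_zero, map_one, mul_one, one_mul] using! this

lemma conj_mFourier (k : Fin 2 → ℤ) (x : Torus2) :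
    (starRingEnd ℂ) (mFourier k x) = mFourier (-k) x := UnitAddTorus.mFourier_neg.symm

lemma mFourier_mul (k l : Fin 2 → ℤ) (x : Torus2) :
    mFourier k x * mFourier l x = mFourier (k + l) x := UnitAddTorus.mFourier_add.symm

/-- The Fourier coefficients of a trigonometric polynomial. -/
lemma integral_trig_mul {c : TorusDist} (hc : FinSupp c) (k : Fin 2 → ℤ) :
    ∫ x, trig c x * mFourier (-k) x ∂torusMeasure = c k := by
  classical
  obtain ⟨F, hF⟩ := hc.exists_finset
  have hF' : ∀ l ∉ insert k F, c l = 0 := fun l hl => hF l fun h => hl (Finset.mem_insert_of_mem h)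
  simp only [trig_eq_sum hF', Finset.sum_mul, mul_assoc, mFourier_mul]
  rw [integral_finsetSum _ fun l _ => integrable_torus (by fun_prop)]
  simp only [integral_const_mul, integral_mFourier]
  rw [Finset.sum_eq_single k]
  · simp
  · intro l _ hl
    simp [← sub_eq_add_neg, sub_eq_zero, hl]
  · simp

lemma norm_coeff_le {c : TorusDist} (hc : FinSupp c) {M : ℝ} (h : ∀ x, ‖trig c x‖ ≤ M)
    (k : Fin 2 → ℤ) : ‖c k‖ ≤ M := by
  rw [← integral_trig_mul hc k]
  refine (norm_integral_le_of_norm_le_const (C := M) (.of_forall fun x => ?_)).trans ?_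
  · rw [norm_mul, norm_mFourier_apply, mul_one]
    exact h x
  · simp

/-- Parseval's identity for trigonometric polynomials. -/
lemma integral_norm_trig_sq {c : TorusDist} {F : Finset (Fin 2 → ℤ)} (hF : ∀ k ∉ F, c k = 0) :
    ∫ x, ‖trig c x‖ ^ 2 ∂torusMeasure = ∑ k ∈ F, ‖c k‖ ^ 2 := by
  have hc := FinSupp.of_finset F hF
  have h1 : ∀ x, ((‖trig c x‖ ^ 2 : ℝ) : ℂ)
      = ∑ k ∈ F, (starRingEnd ℂ) (c k) * (trig c x * mFourier (-k) x) := by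
    intro x
    have : ((‖trig c x‖ ^ 2 : ℝ) : ℂ) = trig c x * (starRingEnd ℂ) (trig c x) := by
      rw [Complex.mul_conj, Complex.normSq_eq_norm_sq]
    rw [this]
    conv_lhs => rw [trig_eq_sum hF x, map_sum, ← trig_eq_sum hF x]
    rw [Finset.mul_sum]
    refine Finset.sum_congr rfl fun k _ => ?_
    rw [map_mul, conj_mFourier]
    ring
  have h2 : ((∫ x, ‖trig c x‖ ^ 2 ∂torusMeasure : ℝ) : ℂ) = ((∑ k ∈ F, ‖c k‖ ^ 2 : ℝ) : ℂ) := by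
    rw [← integral_complex_ofReal]
    simp only [h1]
    have hct := continuous_trig hc
    rw [integral_finsetSum _ fun l _ => integrable_torus (by fun_prop)]
    simp only [integral_const_mul, integral_trig_mul hc]
    push_cast
    refine Finset.sum_congr rfl fun k _ => ?_
    rw [Complex.conj_mul']
  exact_mod_cast h2

lemma sum_norm_sq_le {c : TorusDist} {F : Finset (Fin 2 → ℤ)} (hF : ∀ k ∉ F, c k = 0) {M : ℝ}
    (h : ∀ x, ‖trig c x‖ ≤ M) : ∑ k ∈ F, ‖c k‖ ^ 2 ≤ M ^ 2 := by
  rw [← integral_norm_trig_sq hF]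
  have hct := continuous_trig (FinSupp.of_finset F hF)
  calc ∫ x, ‖trig c x‖ ^ 2 ∂torusMeasure ≤ ∫ _x, M ^ 2 ∂torusMeasure :=
        integral_mono (integrable_torus (by fun_prop)) (integrable_const _) fun x =>
          pow_le_pow_left₀ (norm_nonneg _) (h x) 2
    _ = M ^ 2 := by simp

/-- A Fourier multiplier acts by convolution with its kernel. -/
lemma trig_mul_eq_convolution {m c : TorusDist} (hm : FinSupp m) (hc : FinSupp c) (x : Torus2) :
    trig (fun k => m k * c k) x = ∫ y, trig m y * trig c (x - y) ∂torusMeasure := by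
  classical
  obtain ⟨F, hF⟩ := hc.exists_finset
  have hmc : ∀ k ∉ F, m k * c k = 0 := fun k hk => by simp [hF k hk]
  have hshift : ∀ k y, mFourier k (x - y) = mFourier k x * mFourier (-k) y := by
    intro k y
    rw [← conj_mFourier]
    simp only [mFourier, ContinuousMap.coe_mk, Pi.sub_apply, map_prod, ← Finset.prod_mul_distrib]
    refine Finset.prod_congr rfl fun i _ => ?_
    rw [fourier_apply, fourier_apply, fourier_apply, smul_sub, sub_eq_add_neg,
      AddCircle.toCircle_add, AddCircle.toCircle_neg, Circle.coe_mul, Circle.coe_inv_eq_conj]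
  have hmt := continuous_trig hm
  rw [trig_eq_sum hmc]
  simp only [trig_eq_sum hF, Finset.mul_sum, hshift]
  rw [integral_finsetSum _ fun l _ => integrable_torus (by fun_prop)]
  refine Finset.sum_congr rfl fun k _ => ?_
  rw [← integral_trig_mul hm k, ← integral_mul_const, ← integral_mul_const]
  exact integral_congr_ae (.of_forall fun y => by simp only; ring)

/-- Young's convolution inequality: the $L^1$ norm of the kernel bounds the multiplier on the
supremum norm. All multiplier estimates below reduce to bounding that $L^1$ norm. -/
lemma norm_trig_mul_le {m c : TorusDist} (hm : FinSupp m) (hc : FinSupp c) {M : ℝ}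
    (h : ∀ x, ‖trig c x‖ ≤ M) (x : Torus2) :
    ‖trig (fun k => m k * c k) x‖ ≤ (∫ y, ‖trig m y‖ ∂torusMeasure) * M := by
  have hmt := continuous_trig hm
  rw [trig_mul_eq_convolution hm hc, ← integral_mul_const]
  refine norm_integral_le_of_norm_le (integrable_torus (by fun_prop)) (.of_forall fun y => ?_)
  rw [norm_mul]
  exact mul_le_mul_of_nonneg_left (h _) (norm_nonneg _)

lemma trig_shift (m : TorusDist) (a : Fin 2 → ℤ) (x : Torus2) :
    trig (fun k => m (k - a)) x = mFourier a x * trig m x := by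
  simp only [trig]
  rw [← (Equiv.addRight a).tsum_eq, ← tsum_mul_left]
  refine tsum_congr fun k => ?_
  simp only [Equiv.coe_addRight, add_sub_cancel_right, ← mFourier_mul]
  ring

lemma FinSupp.shift {m : TorusDist} (hm : FinSupp m) (a : Fin 2 → ℤ) :
    FinSupp fun k => m (k - a) :=
  Set.Finite.preimage (f := fun k : Fin 2 → ℤ => k - a) (sub_left_injective.injOn) hm

/-! ### $L^1$ bounds for convolution kernels. -/

/-- The weight `∑_l |e^{2πi x_l} - 1|²`. -/
noncomputable def torusWeight (x : Torus2) : ℝ := ∑ l, ‖fourier 1 (x l) - 1‖ ^ 2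

/-- The left end of the chord is the origin of the circle: its length is $2\sin(\pi|x|)$, and
Jordan's inequality $\sin y\ge 2y/\pi$ applies on $[0,\pi/2]$. -/
lemma four_mul_abs_le_norm_fourier_sub_one {x : ℝ} (hx : |x| ≤ 1 / 2) :
    4 * |x| ≤ ‖fourier 1 (x : UnitAddCircle) - 1‖ := by
  have h1 : (fourier 1 (x : UnitAddCircle) : ℂ) = Complex.exp (Complex.I * ((2 * Real.pi * x : ℝ) : ℂ)) := by
    rw [fourier_coe_apply]
    congr 1
    push_cast
    ring
  have hs : |Real.sin (Real.pi * x)| = Real.sin (Real.pi * |x|) := by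
    rw [Real.abs_sin_eq_sin_abs_of_abs_le_pi (by
      rw [abs_mul, abs_of_pos Real.pi_pos]; nlinarith [Real.pi_pos]), abs_mul,
      abs_of_pos Real.pi_pos]
  rw [h1, Complex.norm_exp_I_mul_ofReal_sub_one, norm_mul, Real.norm_eq_abs, Real.norm_eq_abs]
  have h2 : 2 * Real.pi * x / 2 = Real.pi * x := by ring
  rw [h2, hs]
  have h3 := Real.mul_le_sin (x := Real.pi * |x|) (by positivity) (by nlinarith [Real.pi_pos])
  have h4 : 2 / Real.pi * (Real.pi * |x|) = 2 * |x| := by field_simp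
  rw [h4] at h3
  norm_num
  linarith

/-- The chord bound replaces the weight by $(4Rx)^2$ on a fundamental interval around zero, where
the integral is a difference of arctangents, at most $\pi\le4$. -/
lemma integral_inv_circleWeight_le {R : ℝ} (hR : 0 < R) :
    ∫ x : UnitAddCircle, (1 + R ^ 2 * ‖fourier 1 x - 1‖ ^ 2)⁻¹ ∂AddCircle.haarAddCircle ≤ 1 / R := by
  rw [AddCircle.integral_haarAddCircle, inv_one, one_smul,
    ← UnitAddCircle.intervalIntegral_preimage (-1 / 2)]
  have hc : Continuous fun x : ℝ => (1 + R ^ 2 * ‖fourier 1 (x : UnitAddCircle) - 1‖ ^ 2)⁻¹ := by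
    refine Continuous.inv₀ ?_ fun x => by positivity
    have : Continuous fun x : ℝ => (x : UnitAddCircle) := AddCircle.continuous_mk' 1
    fun_prop
  have hd : Continuous fun x : ℝ => (1 + (4 * R * x) ^ 2)⁻¹ :=
    Continuous.inv₀ (by fun_prop) fun x => by positivity
  calc ∫ x in (-1 / 2 : ℝ)..(-1 / 2 + 1), (1 + R ^ 2 * ‖fourier 1 (x : UnitAddCircle) - 1‖ ^ 2)⁻¹
      ≤ ∫ x in (-1 / 2 : ℝ)..(-1 / 2 + 1), (1 + (4 * R * x) ^ 2)⁻¹ := by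
        refine intervalIntegral.integral_mono_on (by norm_num) (hc.intervalIntegrable _ _)
          (hd.intervalIntegrable _ _) fun x hx => ?_
        have h := four_mul_abs_le_norm_fourier_sub_one (x := x)
          (abs_le.2 ⟨by linarith [hx.1], by linarith [hx.2]⟩)
        refine inv_anti₀ (by positivity) ?_
        have h2 := pow_le_pow_left₀ (by positivity) h 2
        have h3 : (4 * R * x) ^ 2 = R ^ 2 * (4 * |x|) ^ 2 := by rw [mul_pow, mul_pow, mul_pow, sq_abs]; ring
        rw [h3]
        gcongr
    _ = (4 * R)⁻¹ * (Real.arctan (4 * R * (-1 / 2 + 1)) - Real.arctan (4 * R * (-1 / 2))) := by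
        have h := intervalIntegral.integral_comp_mul_left (a := (-1 / 2 : ℝ)) (b := -1 / 2 + 1) (fun x : ℝ => (1 + x ^ 2)⁻¹) (c := 4 * R) (by positivity)
        rw [h, integral_inv_one_add_sq, smul_eq_mul]
    _ ≤ (4 * R)⁻¹ * 4 := by
        gcongr
        have h1 := Real.arctan_lt_pi_div_two (4 * R * (-1 / 2 + 1))
        have h2 := Real.neg_pi_div_two_lt_arctan (4 * R * (-1 / 2))
        linarith [Real.pi_le_four]
    _ = 1 / R := by field_simp

lemma continuous_torusWeight : Continuous torusWeight := by unfold torusWeight; fun_prop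

lemma torusWeight_nonneg (x : Torus2) : 0 ≤ torusWeight x := by unfold torusWeight; positivity

/-- From $(1+R^2(a+b))^2\ge(1+R^2a)(1+R^2b)$ the integrand is dominated by a product of functions of
one variable. The square on the left is what makes the two-dimensional integral factor. -/
lemma integral_inv_torusWeight_le {R : ℝ} (hR : 0 < R) :
    ∫ x, ((1 + R ^ 2 * torusWeight x) ^ 2)⁻¹ ∂torusMeasure ≤ (1 / R) ^ 2 := by
  have hw := continuous_torusWeight
  have hpos : ∀ x : Torus2, 0 < 1 + R ^ 2 * torusWeight x := fun x => by
    have := torusWeight_nonneg x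
    positivity
  have hc : Continuous fun x : UnitAddCircle => (1 + R ^ 2 * ‖fourier 1 x - 1‖ ^ 2)⁻¹ :=
    Continuous.inv₀ (by fun_prop) fun x => by positivity
  calc ∫ x, ((1 + R ^ 2 * torusWeight x) ^ 2)⁻¹ ∂torusMeasure
      ≤ ∫ x : Torus2, ∏ l, (1 + R ^ 2 * ‖fourier 1 (x l) - 1‖ ^ 2)⁻¹ ∂torusMeasure := by
        refine integral_mono (integrable_torus ?_) (integrable_torus ?_) fun x => ?_
        · exact Continuous.inv₀ (by fun_prop) fun x => by have := hpos x; positivity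
        · exact continuous_finsetProd _ fun l _ => hc.comp (continuous_apply l)
        · simp only [Fin.prod_univ_two, ← mul_inv, torusWeight, Fin.sum_univ_two]
          refine inv_anti₀ (by positivity) ?_
          rw [sq (1 + _)]
          have h0 := sq_nonneg ‖(fourier 1 (x 0) : ℂ) - 1‖
          have h1 := sq_nonneg ‖(fourier 1 (x 1) : ℂ) - 1‖
          gcongr <;> linarith
    _ = (∫ x : UnitAddCircle, (1 + R ^ 2 * ‖fourier 1 x - 1‖ ^ 2)⁻¹ ∂AddCircle.haarAddCircle) ^ 2 := by
        rw [torusMeasure, integral_fintype_prod_eq_prod (𝕜 := ℝ)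
          (fun _ (y : UnitAddCircle) => (1 + R ^ 2 * ‖fourier 1 y - 1‖ ^ 2)⁻¹), Fin.prod_univ_two, sq (∫ _, _ ∂_)]
    _ ≤ (1 / R) ^ 2 := by
        refine pow_le_pow_left₀ (integral_nonneg fun x => ?_) (integral_inv_circleWeight_le hR) 2
        positivity

/-- The symbol of multiplication by the weight `1 + R² ∑_l |e^{2πi x_l} - 1|²`. -/
noncomputable def weightedSymbol (R : ℝ) (m : TorusDist) : TorusDist := fun k =>
  m k - (R : ℂ) ^ 2 * ∑ l, (m (k - -Pi.single l 1) - 2 * m k + m (k - Pi.single l 1))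

/-- Since $|e^{2\pi ix_l}-1|^2=2-e^{2\pi ix_l}-e^{-2\pi ix_l}$, multiplying by it takes minus the
second difference of the coefficients in direction $l$. -/
lemma trig_weightedSymbol {m : TorusDist} (hm : FinSupp m) (R : ℝ) (x : Torus2) :
    trig (weightedSymbol R m) x = ((1 + R ^ 2 * torusWeight x : ℝ) : ℂ) * trig m x := by
  have hs : ∀ a, FinSupp fun k => m (k - a) := fun a => hm.shift a
  have hl : ∀ l : Fin 2, ((‖fourier 1 (x l) - 1‖ ^ 2 : ℝ) : ℂ) * trig m x =
      trig (fun k => -(m (k - -Pi.single l 1) - 2 * m k + m (k - Pi.single l 1))) x := by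
    intro l
    have h1 : (fun k => -(m (k - -Pi.single l 1) - 2 * m k + m (k - Pi.single l 1)))
        = (2 : ℂ) • m - ((fun k => m (k - -Pi.single l 1)) + fun k => m (k - Pi.single l 1)) := by
      ext k
      simp
      ring
    rw [h1, trig_sub (hm.smul 2) ((hs _).add (hs _)), trig_add (hs _) (hs _), trig_smul,
      trig_shift, trig_shift, ← conj_mFourier, UnitAddTorus.mFourier_single]
    have hn : ‖(fourier 1 (x l) : ℂ)‖ = 1 := by simp [fourier_apply, Circle.norm_coe]
    have h2 : ((‖(fourier 1 (x l) : ℂ) - 1‖ ^ 2 : ℝ) : ℂ)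
        = 2 - (starRingEnd ℂ) (fourier 1 (x l)) - fourier 1 (x l) := by
      rw [← Complex.normSq_eq_norm_sq, Complex.normSq_eq_conj_mul_self, map_sub, map_one]
      have h3 : (starRingEnd ℂ) (fourier 1 (x l) : ℂ) * fourier 1 (x l) = 1 := by
        rw [Complex.conj_mul', hn]
        simp
      linear_combination h3
    rw [h2]
    ring
  have hfs : ∀ l ∈ (Finset.univ : Finset (Fin 2)),
      FinSupp fun k => -(m (k - -Pi.single l 1) - 2 * m k + m (k - Pi.single l 1)) := by
    intro l _
    have := ((hs (-Pi.single l 1)).sub ((hm.smul 2).sub (hs (Pi.single l 1)))).smul (-1)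
    refine this.mono fun k hk => ?_
    simp at hk ⊢
    linear_combination hk
  have h0 : weightedSymbol R m = m + ((R : ℂ) ^ 2) •
      fun k => ∑ l, -(m (k - -Pi.single l 1) - 2 * m k + m (k - Pi.single l 1)) := by
    ext k
    simp only [weightedSymbol, Pi.add_apply, Pi.smul_apply, smul_eq_mul, Finset.sum_neg_distrib]
    ring
  rw [h0, trig_add hm ((FinSupp.sum _ hfs).smul _), trig_smul, trig_sum _ hfs]
  simp only [← hl, ← Finset.sum_mul, torusWeight]
  push_cast
  ring

lemma card_freqBox_le {L : ℝ} (hL : 0 ≤ L) :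
    ∃ F : Finset (Fin 2 → ℤ), (∀ k : Fin 2 → ℤ, (∀ l, |(k l : ℝ)| ≤ L) → k ∈ F) ∧
      (F.card : ℝ) ≤ (2 * L + 1) ^ 2 := by
  refine ⟨Fintype.piFinset fun _ => Finset.Icc (-⌊L⌋) ⌊L⌋, fun k hk => ?_, ?_⟩
  · refine Fintype.mem_piFinset.2 fun l => Finset.mem_Icc.2 ?_
    have h := abs_le.1 (hk l)
    refine ⟨?_, Int.le_floor.2 h.2⟩
    have : -k l ≤ ⌊L⌋ := Int.le_floor.2 (by push_cast; linarith [h.1])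
    linarith
  · have h0 : 0 ≤ ⌊L⌋ := Int.floor_nonneg.2 hL
    have h1 : (((⌊L⌋ + 1 - -⌊L⌋).toNat : ℕ) : ℝ) = 2 * (⌊L⌋ : ℝ) + 1 := by
      have : (((⌊L⌋ + 1 - -⌊L⌋).toNat : ℤ) : ℝ) = 2 * (⌊L⌋ : ℝ) + 1 := by
        rw [Int.toNat_of_nonneg (by linarith)]
        push_cast
        ring
      exact_mod_cast this
    rw [Fintype.card_piFinset]
    simp only [Int.card_Icc, Finset.prod_const, Finset.card_univ, Fintype.card_fin]
    push_cast
    rw [h1]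
    have h2 : (0 : ℝ) ≤ ⌊L⌋ := by exact_mod_cast h0
    have := Int.floor_le L
    gcongr

/-- The kernel of a multiplier that varies on the scale `R` is bounded in `L¹`. -/
theorem integral_norm_kernel_le {ρ R B : ℝ} (hρ : 1 ≤ ρ) (hR : 1 ≤ R) (hB : 0 < B)
    {m : TorusDist} (hsupp : ∀ k, (∃ l, ρ * R < |(k l : ℝ)|) → m k = 0)
    (hbd : ∀ k, ‖m k‖ ≤ B)
    (hdiff : ∀ k (l : Fin 2),
      ‖m (k - -Pi.single l 1) - 2 * m k + m (k - Pi.single l 1)‖ ≤ B / R ^ 2) :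
    ∫ x, ‖trig m x‖ ∂torusMeasure ≤ 15 * ρ * B := by
  have hR0 : 0 < R := by linarith
  have hρR : 1 ≤ ρ * R := by nlinarith
  -- The box is enlarged by one because the second differences shift the support by one. Its
  -- cardinality is at most $(2(\rho R+1)+1)^2\le(5\rho R)^2$, as $\rho R\ge1$.
  obtain ⟨F, hF, hcard⟩ := card_freqBox_le (L := ρ * R + 1) (by positivity)
  have hmF : ∀ k ∉ F, m k = 0 := by
    intro k hk
    refine hsupp k ?_
    by_contra! h
    exact hk (hF k fun l => (h l).trans (by linarith))
  have hm : FinSupp m := .of_finset F hmF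
  have hwF : ∀ k ∉ F, weightedSymbol R m k = 0 := by
    intro k hk
    obtain ⟨l, hl⟩ : ∃ l, ρ * R + 1 < |(k l : ℝ)| := by
      by_contra! h
      exact hk (hF k h)
    have hz : ∀ a : Fin 2 → ℤ, |(a l : ℝ)| ≤ 1 → m (k - a) = 0 := by
      intro a ha
      refine hsupp _ ⟨l, ?_⟩
      have := abs_sub_abs_le_abs_sub (k l : ℝ) (a l)
      simp only [Pi.sub_apply]
      push_cast
      linarith
    have h1 : ∀ l' : Fin 2, |((Pi.single l' (1 : ℤ) : Fin 2 → ℤ) l : ℝ)| ≤ 1 := by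
      intro l'
      by_cases h : l = l'
      · subst h; simp
      · simp [Pi.single_eq_of_ne h]
    have h0 := hz 0 (by simp)
    rw [sub_zero] at h0
    simp only [weightedSymbol]
    simp [h0, hz (Pi.single 0 1) (h1 0), hz (Pi.single 1 1) (h1 1),
      hz (-Pi.single 0 1) (by simpa using h1 0), hz (-Pi.single 1 1) (by simpa using h1 1),
      -sub_neg_eq_add]
  have hwb : ∀ k, ‖weightedSymbol R m k‖ ≤ 3 * B := by
    intro k
    have h1 : ‖∑ l, (m (k - -Pi.single l 1) - 2 * m k + m (k - Pi.single l 1))‖ ≤ 2 * (B / R ^ 2) := by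
      refine (norm_sum_le_of_le _ fun l _ => hdiff k l).trans ?_
      simp
    calc ‖weightedSymbol R m k‖ ≤ B + R ^ 2 * (2 * (B / R ^ 2)) := by
          refine (norm_sub_le _ _).trans (add_le_add (hbd k) ?_)
          rw [norm_mul, norm_pow, Complex.norm_real, Real.norm_of_nonneg hR0.le]
          gcongr
      _ = 3 * B := by field_simp; ring
  have hsum : ∫ x, ‖trig (weightedSymbol R m) x‖ ^ 2 ∂torusMeasure ≤ (15 * ρ * R * B) ^ 2 := by
    rw [integral_norm_trig_sq hwF]
    calc ∑ k ∈ F, ‖weightedSymbol R m k‖ ^ 2 ≤ ∑ _k ∈ F, (3 * B) ^ 2 :=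
          Finset.sum_le_sum fun k _ => pow_le_pow_left₀ (norm_nonneg _) (hwb k) 2
      _ = F.card * (3 * B) ^ 2 := by simp
      _ ≤ (5 * (ρ * R)) ^ 2 * (3 * B) ^ 2 := by
          gcongr
          refine hcard.trans (pow_le_pow_left₀ (by positivity) ?_ 2)
          linarith
      _ = (15 * ρ * R * B) ^ 2 := by ring
  have hmt := continuous_trig hm
  have hwt := continuous_trig (.of_finset F hwF)
  have hw := continuous_torusWeight
  have hpos : ∀ x : Torus2, 0 < 1 + R ^ 2 * torusWeight x := fun x => by
    have := torusWeight_nonneg x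
    positivity
  have hic : Continuous fun x => ((1 + R ^ 2 * torusWeight x) ^ 2)⁻¹ :=
    Continuous.inv₀ (by fun_prop) fun x => by have := hpos x; positivity
  have hD : 0 < 15 * ρ * B := by positivity
  -- Cauchy–Schwarz for $w^{-1}\cdot w|m|$ in its additive form $|m|\le\frac
  -- E2w^{-2}+\frac1{2E}(w|m|)^2$, with $E=15\rho BR^2$ chosen so that both integrals contribute
  -- $\frac{15}2\rho B$.
  calc ∫ x, ‖trig m x‖ ∂torusMeasure
      ≤ ∫ x, ((15 * ρ * B * R ^ 2 / 2) * ((1 + R ^ 2 * torusWeight x) ^ 2)⁻¹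
          + (1 / (2 * (15 * ρ * B * R ^ 2))) * ‖trig (weightedSymbol R m) x‖ ^ 2) ∂torusMeasure := by
        refine integral_mono (integrable_torus (by fun_prop)) (integrable_torus (by fun_prop)) ?_
        intro x
        simp only
        rw [trig_weightedSymbol hm, norm_mul, Complex.norm_real, Real.norm_of_nonneg (hpos x).le]
        set w := 1 + R ^ 2 * torusWeight x
        have hw : 0 < w := hpos x
        set E := 15 * ρ * B * R ^ 2
        have hE : 0 < E := by positivity
        have key : E / 2 * (w ^ 2)⁻¹ + 1 / (2 * E) * (w * ‖trig m x‖) ^ 2 - ‖trig m x‖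
            = (E / w - w * ‖trig m x‖) ^ 2 / (2 * E) := by
          field_simp
          ring
        have : 0 ≤ (E / w - w * ‖trig m x‖) ^ 2 / (2 * E) := by positivity
        linarith
    _ ≤ (15 * ρ * B * R ^ 2 / 2) * (1 / R) ^ 2
          + (1 / (2 * (15 * ρ * B * R ^ 2))) * (15 * ρ * R * B) ^ 2 := by
        rw [integral_add (integrable_torus (by fun_prop)) (integrable_torus (by fun_prop)),
          integral_const_mul, integral_const_mul]
        gcongr
        exact integral_inv_torusWeight_le hR0
    _ = 15 * ρ * B := by field_simp; ring

/-- The second difference is the increment over $[0,\delta]$ of $s\mapsto h(s)-h(s-\delta)$, so the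
mean value inequality is used twice, each time gaining a factor $\delta$. -/
lemma norm_second_difference_le {h h' h'' : ℝ → ℂ} {B δ : ℝ} (hδ : 0 ≤ δ)
    (h1 : ∀ s, HasDerivAt h (h' s) s) (h2 : ∀ s, HasDerivAt h' (h'' s) s) (hB : ∀ s, ‖h'' s‖ ≤ B) :
    ‖h δ - 2 * h 0 + h (-δ)‖ ≤ B * δ ^ 2 := by
  have hd : ∀ s, HasDerivAt (fun s => h s - h (s - δ)) (h' s - h' (s - δ)) s := fun s =>
    (h1 s).sub ((h1 (s - δ)).comp_sub_const s δ)
  have hb : ∀ s, ‖h' s - h' (s - δ)‖ ≤ B * δ := by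
    intro s
    have := convex_univ.norm_image_sub_le_of_norm_hasDerivWithin_le (x := s - δ) (y := s)
      (fun x _ => (h2 x).hasDerivWithinAt) (fun x _ => hB x) (mem_univ _) (mem_univ _)
    simpa [abs_of_nonneg hδ] using this
  have := convex_univ.norm_image_sub_le_of_norm_hasDerivWithin_le (x := (0 : ℝ)) (y := δ)
      (fun x _ => (hd x).hasDerivWithinAt) (fun x _ => hb x) (mem_univ _) (mem_univ _)
  simp only [sub_self, sub_zero, zero_sub, Real.norm_eq_abs, abs_of_nonneg hδ] at this
  calc ‖h δ - 2 * h 0 + h (-δ)‖ = ‖h δ - h 0 - (h 0 - h (-δ))‖ := by congr 1; ring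
    _ ≤ B * δ * δ := this
    _ = B * δ ^ 2 := by ring

/-! ### Fourier multipliers with smooth, compactly supported symbols. -/

/-- Bounds for a symbol, its support and its pure second derivatives. -/
structure SymbolBound (g : (Fin 2 → ℝ) → ℂ) (ρ B : ℝ) : Prop where
  supp : ∀ ξ, (∃ l, ρ < |ξ l|) → g ξ = 0
  bound : ∀ ξ, ‖g ξ‖ ≤ B
  deriv : ∀ l : Fin 2, ∃ g₁ g₂ : (Fin 2 → ℝ) → ℂ,
    (∀ ξ, HasDerivAt (fun s : ℝ => g (ξ + s • Pi.single l 1)) (g₁ ξ) 0) ∧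
    (∀ ξ, HasDerivAt (fun s : ℝ => g₁ (ξ + s • Pi.single l 1)) (g₂ ξ) 0) ∧ ∀ ξ, ‖g₂ ξ‖ ≤ B

lemma hasDerivAt_line {g g₁ : (Fin 2 → ℝ) → ℂ} {v : Fin 2 → ℝ}
    (h : ∀ ξ, HasDerivAt (fun s : ℝ => g (ξ + s • v)) (g₁ ξ) 0) (ξ : Fin 2 → ℝ) (s : ℝ) :
    HasDerivAt (fun s : ℝ => g (ξ + s • v)) (g₁ (ξ + s • v)) s := by
  have h0 : HasDerivAt (fun s' : ℝ => g (ξ + s • v + s' • v)) (g₁ (ξ + s • v)) (s - s) := by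
    simpa using h (ξ + s • v)
  have := h0.comp_sub_const s s
  refine this.congr_of_eventuallyEq (.of_forall fun s' => ?_)
  simp only
  congr 1
  module

/-- Multipliers `g(k/R)` with `R ≥ 1` are bounded in the supremum norm. -/
theorem SymbolBound.norm_trig_le {g : (Fin 2 → ℝ) → ℂ} {ρ B : ℝ} (h : SymbolBound g ρ B)
    (hρ : 1 ≤ ρ) (hB : 0 < B) {R : ℝ} (hR : 1 ≤ R) {c : TorusDist} (hc : FinSupp c) {M : ℝ}
    (hM : ∀ x, ‖trig c x‖ ≤ M) (x : Torus2) :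
    ‖trig (fun k => g (fun l => (k l : ℝ) / R) * c k) x‖ ≤ 15 * ρ * B * M := by
  have hR0 : 0 < R := by linarith
  have hM0 : 0 ≤ M := (norm_nonneg _).trans (hM x)
  set m : TorusDist := fun k => g (fun l => (k l : ℝ) / R)
  have hsupp : ∀ k, (∃ l, ρ * R < |(k l : ℝ)|) → m k = 0 := by
    rintro k ⟨l, hl⟩
    refine h.supp _ ⟨l, ?_⟩
    rw [abs_div, abs_of_pos hR0]
    exact (lt_div_iff₀ hR0).2 hl
  have hm : FinSupp m := by
    obtain ⟨F, hF, -⟩ := card_freqBox_le (L := ρ * R) (by positivity)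
    refine .of_finset F fun k hk => hsupp k ?_
    by_contra! h'
    exact hk (hF k h')
  refine (norm_trig_mul_le hm hc hM x).trans (mul_le_mul_of_nonneg_right ?_ hM0)
  refine integral_norm_kernel_le hρ hR hB hsupp (fun k => h.bound _) fun k l => ?_
  obtain ⟨g₁, g₂, h1, h2, h3⟩ := h.deriv l
  set ξ : Fin 2 → ℝ := fun l => (k l : ℝ) / R
  -- Neighbouring frequencies are at distance $1/R$ after rescaling, whence the factor $R^{-2}$ that
  -- the kernel estimate asks for.
  have key := norm_second_difference_le (δ := 1 / R) (by positivity)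
    (hasDerivAt_line h1 ξ) (hasDerivAt_line h2 ξ) (fun s => h3 _)
  have e1 : (fun l' => ((k - -Pi.single l 1 : Fin 2 → ℤ) l' : ℝ) / R) = ξ + (1 / R) • Pi.single l 1 := by
    ext l'
    by_cases hl : l' = l
    · subst hl; simp [ξ]; ring
    · simp [ξ, hl]
  have e2 : (fun l' => ((k - Pi.single l 1 : Fin 2 → ℤ) l' : ℝ) / R) = ξ + (-(1 / R)) • Pi.single l 1 := by
    ext l'
    by_cases hl : l' = l
    · subst hl; simp [ξ]; ring
    · simp [ξ, hl]
  have e0 : ξ = ξ + (0 : ℝ) • Pi.single l 1 := by simp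
  simp only [m]
  rw [e1, e2]
  change ‖g _ - 2 * g ξ + _‖ ≤ _
  rw [e0]
  simp only [zero_smul, add_zero] at key ⊢
  refine key.trans (le_of_eq ?_)
  field_simp

lemma hasDerivAt_line_of_contDiff {g : (Fin 2 → ℝ) → ℂ} (hg : Differentiable ℝ g)
    (v ξ : Fin 2 → ℝ) : HasDerivAt (fun s : ℝ => g (ξ + s • v)) (fderiv ℝ g ξ v) 0 := by
  have h1 : HasDerivAt (fun s : ℝ => ξ + s • v) v 0 := by
    simpa using ((hasDerivAt_id (0 : ℝ)).smul_const v).const_add ξ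
  have h2 : HasFDerivAt g (fderiv ℝ g ξ) (ξ + (0 : ℝ) • v) := by
    simpa using (hg ξ).hasFDerivAt
  exact h2.comp_hasDerivAt (0 : ℝ) h1

lemma exists_box_of_hasCompactSupport {g : (Fin 2 → ℝ) → ℂ} (hs : HasCompactSupport g) :
    ∃ ρ : ℝ, 1 ≤ ρ ∧ ∀ ξ, (∃ l, ρ < |ξ l|) → g ξ = 0 := by
  obtain ⟨r, hr⟩ := hs.isCompact.isBounded.subset_closedBall 0
  refine ⟨max r 1, le_max_right _ _, fun ξ ⟨l, hl⟩ => ?_⟩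
  by_contra h
  have h1 := hr (subset_tsupport g h)
  have h2 : ‖ξ‖ ≤ r := by simpa using h1
  have h3 := norm_le_pi_norm ξ l
  rw [Real.norm_eq_abs] at h3
  linarith [le_max_left r 1]

lemma contDiff_fderiv_apply {g : (Fin 2 → ℝ) → ℂ} (hg : ContDiff ℝ (⊤ : ℕ∞) g) (v : Fin 2 → ℝ) :
    ContDiff ℝ (⊤ : ℕ∞) fun ξ => fderiv ℝ g ξ v :=
  (hg.fderiv_right (m := (⊤ : ℕ∞)) (by norm_cast)).clm_apply contDiff_const

lemma hasCompactSupport_fderiv_apply {g : (Fin 2 → ℝ) → ℂ} (hs : HasCompactSupport g)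
    (v : Fin 2 → ℝ) : HasCompactSupport fun ξ => fderiv ℝ g ξ v :=
  (hs.fderiv ℝ).comp_left (g := fun L : (Fin 2 → ℝ) →L[ℝ] ℂ => L v) (by simp)

/-- The pure second derivative in direction `l`. -/
noncomputable def secondPartial (g : (Fin 2 → ℝ) → ℂ) (l : Fin 2) (ξ : Fin 2 → ℝ) : ℂ :=
  fderiv ℝ (fun η => fderiv ℝ g η (Pi.single l 1)) ξ (Pi.single l 1)

lemma exists_symbolBound {g : (Fin 2 → ℝ) → ℂ} (hg : ContDiff ℝ (⊤ : ℕ∞) g) (hs : HasCompactSupport g) :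
    ∃ ρ B : ℝ, 1 ≤ ρ ∧ 0 < B ∧ SymbolBound g ρ B := by
  obtain ⟨ρ, hρ, hsupp⟩ := exists_box_of_hasCompactSupport hs
  obtain ⟨B₀, hB₀⟩ := hg.continuous.bounded_above_of_compact_support hs
  have h2 : ∀ l, ∃ B : ℝ, ∀ ξ, ‖secondPartial g l ξ‖ ≤ B := fun l =>
    (contDiff_fderiv_apply (contDiff_fderiv_apply hg _) _).continuous.bounded_above_of_compact_support
      (hasCompactSupport_fderiv_apply (hasCompactSupport_fderiv_apply hs _) _)
  choose B₂ hB₂ using h2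
  refine ⟨ρ, max (max B₀ 1) (max (B₂ 0) (B₂ 1)), hρ, by positivity, hsupp, fun ξ => ?_, fun l => ?_⟩
  · exact (hB₀ ξ).trans ((le_max_left _ _).trans (le_max_left _ _))
  · refine ⟨_, _, hasDerivAt_line_of_contDiff (hg.differentiable (by simp)) _,
      hasDerivAt_line_of_contDiff ((contDiff_fderiv_apply hg _).differentiable (by simp)) _,
      fun ξ => (hB₂ l ξ).trans ?_⟩
    fin_cases l
    · exact (le_max_left _ _).trans (le_max_right _ _)
    · exact (le_max_right _ _).trans (le_max_right _ _)

/-! Radial cut-offs. -/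

lemma lpCutoff_of_le {r : ℝ} (h : r ≤ 3 / 4) : lpCutoff r = 1 :=
  Real.smoothTransition.one_of_one_le (by linarith)

lemma lpCutoff_of_ge {r : ℝ} (h : 4 / 3 ≤ r) : lpCutoff r = 0 :=
  Real.smoothTransition.zero_of_nonpos (by linarith)

lemma lpCutoff_nonneg (r : ℝ) : 0 ≤ lpCutoff r := Real.smoothTransition.nonneg _

lemma lpCutoff_antitone : Antitone lpCutoff := fun a b h =>
  Real.smoothTransition.monotone (by linarith)

/-- The low-frequency cut-off as a function of `|ξ|²`. -/
noncomputable def sqCutoff (v : ℝ) : ℝ := lpCutoff (Real.sqrt v)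

lemma sqCutoff_of_le {v : ℝ} (h : v ≤ 9 / 16) : sqCutoff v = 1 :=
  lpCutoff_of_le (Real.sqrt_le_iff.2 ⟨by norm_num, by linarith⟩)

lemma sqCutoff_of_ge {v : ℝ} (h : 16 / 9 ≤ v) : sqCutoff v = 0 :=
  lpCutoff_of_ge (Real.le_sqrt_of_sq_le (by linarith))

/-- The cut-off equals one for $v<9/16$, which hides the singularity of the square root at zero.
Working with $|\xi|^2$ in place of $|\xi|$ then gives smooth symbols on the whole plane. -/
lemma contDiff_sqCutoff : ContDiff ℝ (⊤ : ℕ∞) sqCutoff := by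
  refine contDiff_iff_contDiffAt.2 fun v => ?_
  rcases lt_or_ge v (9 / 16) with hv | hv
  · refine contDiffAt_const (c := (1 : ℝ)) |>.congr_of_eventuallyEq ?_
    filter_upwards [Iio_mem_nhds hv] with w hw using sqCutoff_of_le (le_of_lt hw)
  · have : ContDiff ℝ (⊤ : ℕ∞) lpCutoff :=
      Real.smoothTransition.contDiff.comp (by fun_prop : ContDiff ℝ (⊤ : ℕ∞) fun r : ℝ => (16 - 12 * r) / 7)
    exact this.contDiffAt.comp v (Real.contDiffAt_sqrt (by linarith))

/-- The square of the Euclidean length. -/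
def sqLen (ξ : Fin 2 → ℝ) : ℝ := ∑ l, ξ l ^ 2

lemma contDiff_sqLen : ContDiff ℝ (⊤ : ℕ∞) sqLen := by unfold sqLen; fun_prop

lemma hasCompactSupport_of_sqLen {E : Type*} [Zero E] {g : (Fin 2 → ℝ) → E} {a : ℝ}
    (h : ∀ ξ, a ≤ sqLen ξ → g ξ = 0) : HasCompactSupport g := by
  refine HasCompactSupport.intro (isCompact_closedBall 0 (|a| + 1)) fun ξ hξ => h ξ ?_
  by_contra! hlt
  refine hξ (mem_closedBall_zero_iff.2 ((pi_norm_le_iff_of_nonneg (by positivity)).2 fun l => ?_))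
  have h1 : ξ l ^ 2 ≤ sqLen ξ := Finset.single_le_sum (f := fun l => ξ l ^ 2)
    (fun _ _ => sq_nonneg _) (Finset.mem_univ l)
  rw [Real.norm_eq_abs]
  have h2 : |ξ l| ^ 2 < |a| := by rw [sq_abs]; exact (h1.trans_lt hlt).trans_le (le_abs_self a)
  nlinarith [abs_nonneg (ξ l), abs_nonneg a]

lemma sqLen_div (k : Fin 2 → ℤ) (R : ℝ) :
    sqLen (fun l => (k l : ℝ) / R) = freqNorm k ^ 2 / R ^ 2 := by
  rw [freqNorm, Real.sq_sqrt (by positivity), sqLen, Finset.sum_div]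
  simp only [div_pow]

lemma freqNorm_nonneg (k : Fin 2 → ℤ) : 0 ≤ freqNorm k := Real.sqrt_nonneg _

lemma sqCutoff_sq {r : ℝ} (h : 0 ≤ r) : sqCutoff (r ^ 2) = lpCutoff r := by
  rw [sqCutoff, Real.sqrt_sq h]

/-- The multiplier norms of the low-frequency cut-offs are bounded. -/
theorem exists_lowPass_bound : ∃ C : ℝ, 1 ≤ C ∧ ∀ (R : ℝ), 1 ≤ R → ∀ (c : TorusDist), FinSupp c →
    ∀ M : ℝ, (∀ x, ‖trig c x‖ ≤ M) → ∀ x,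
      ‖trig (fun k => (lpCutoff (freqNorm k / R) : ℂ) * c k) x‖ ≤ C * M := by
  have hg : ContDiff ℝ (⊤ : ℕ∞) fun ξ : Fin 2 → ℝ => (sqCutoff (sqLen ξ) : ℂ) :=
    Complex.ofRealCLM.contDiff.comp (contDiff_sqCutoff.comp contDiff_sqLen)
  have hs : HasCompactSupport fun ξ : Fin 2 → ℝ => (sqCutoff (sqLen ξ) : ℂ) :=
    hasCompactSupport_of_sqLen (a := 16 / 9) fun ξ h => by simp [sqCutoff_of_ge h]
  obtain ⟨ρ, B, hρ, hB, h⟩ := exists_symbolBound hg hs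
  refine ⟨max (15 * ρ * B) 1, le_max_right _ _, fun R hR c hc M hM x => ?_⟩
  have hM0 : 0 ≤ M := (norm_nonneg _).trans (hM x)
  have := h.norm_trig_le hρ hB hR hc hM x
  simp only [sqLen_div, ← div_pow, sqCutoff_sq (div_nonneg (freqNorm_nonneg _) (by linarith : 0 ≤ R))]
    at this
  exact this.trans (mul_le_mul_of_nonneg_right (le_max_left _ _) hM0)

/-- Bernstein's inequality. -/
theorem exists_bernstein : ∃ C : ℝ, 0 < C ∧ ∀ (R : ℝ), 1 ≤ R → ∀ (c : TorusDist), FinSupp c →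
    (∀ k, c k ≠ 0 → freqNorm k ≤ 4 / 3 * R) → ∀ M : ℝ, (∀ x, ‖trig c x‖ ≤ M) → ∀ l x,
      ‖trig (partialDist l c) x‖ ≤ C * R * M := by
  have hg : ∀ l : Fin 2, ContDiff ℝ (⊤ : ℕ∞) fun ξ : Fin 2 → ℝ =>
      2 * Real.pi * Complex.I * (ξ l : ℂ) * (sqCutoff (sqLen ξ / 4) : ℂ) := fun l =>
    (contDiff_const.mul (Complex.ofRealCLM.contDiff.comp (contDiff_apply ℝ ℝ l))).mul
      (Complex.ofRealCLM.contDiff.comp (contDiff_sqCutoff.comp (contDiff_sqLen.div_const 4)))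
  have hs : ∀ l : Fin 2, HasCompactSupport fun ξ : Fin 2 → ℝ =>
      2 * Real.pi * Complex.I * (ξ l : ℂ) * (sqCutoff (sqLen ξ / 4) : ℂ) := fun l =>
    hasCompactSupport_of_sqLen (a := 64 / 9) fun ξ h => by
      rw [sqCutoff_of_ge (by linarith)]; simp
  choose ρ B hρ hB h using fun l => exists_symbolBound (hg l) (hs l)
  refine ⟨max (15 * ρ 0 * B 0) (15 * ρ 1 * B 1), lt_max_of_lt_left
    (by have := hB 0; have := hρ 0; positivity), fun R hR c hc hsupp M hM l x => ?_⟩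
  have hM0 : 0 ≤ M := (norm_nonneg _).trans (hM x)
  have hR0 : 0 < R := by linarith
  have key := (h l).norm_trig_le (hρ l) (hB l) hR hc hM x
  -- On the spectrum of `c` the rescaled frequency has $|\xi|^2/4\le\frac49\le\frac9{16}$, where the
  -- cut-off is one; inserting it changes nothing and makes the symbol $2\pi i\xi_l$ compactly
  -- supported.
  have he : partialDist l c = (R : ℂ) • fun k => (2 * Real.pi * Complex.I * (((k l : ℝ) / R : ℝ) : ℂ)
      * (sqCutoff (sqLen (fun l => (k l : ℝ) / R) / 4) : ℂ)) * c k := by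
    ext k
    by_cases hk : c k = 0
    · simp [partialDist, hk]
    · have h1 := hsupp k hk
      have h2 : freqNorm k ^ 2 ≤ (4 / 3 * R) ^ 2 := pow_le_pow_left₀ (freqNorm_nonneg k) h1 2
      have h3 : sqLen (fun l => (k l : ℝ) / R) / 4 ≤ 9 / 16 := by
        rw [sqLen_div, div_div, div_le_iff₀ (by positivity)]
        nlinarith
      have hRc : (R : ℂ) ≠ 0 := by exact_mod_cast hR0.ne'
      simp only [partialDist, Pi.smul_apply, smul_eq_mul, sqCutoff_of_le h3]
      push_cast
      field_simp
  have hmax : 15 * ρ l * B l ≤ max (15 * ρ 0 * B 0) (15 * ρ 1 * B 1) := by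
    fin_cases l
    · exact le_max_left _ _
    · exact le_max_right _ _
  rw [he, trig_smul, norm_mul, Complex.norm_real, Real.norm_of_nonneg hR0.le]
  calc R * _ ≤ R * (15 * ρ l * B l * M) := by gcongr
    _ ≤ R * (max (15 * ρ 0 * B 0) (15 * ρ 1 * B 1) * M) := by gcongr
    _ = _ := by ring

/-- A cut-off to an annulus, as a function of `|ξ|²`. -/
noncomputable def annulusCutoff (v : ℝ) : ℝ := sqCutoff (v / 4) - sqCutoff (16 * v)

lemma contDiff_annulusCutoff : ContDiff ℝ (⊤ : ℕ∞) annulusCutoff :=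
  (contDiff_sqCutoff.comp (by fun_prop : ContDiff ℝ (⊤ : ℕ∞) fun v : ℝ => v / 4)).sub
    (contDiff_sqCutoff.comp (by fun_prop : ContDiff ℝ (⊤ : ℕ∞) fun v : ℝ => 16 * v))

lemma annulusCutoff_of_le {v : ℝ} (h : v ≤ 9 / 256) : annulusCutoff v = 0 := by
  rw [annulusCutoff, sqCutoff_of_le (by linarith), sqCutoff_of_le (by linarith), sub_self]

lemma annulusCutoff_of_ge {v : ℝ} (h : 64 / 9 ≤ v) : annulusCutoff v = 0 := by
  rw [annulusCutoff, sqCutoff_of_ge (by linarith), sqCutoff_of_ge (by linarith), sub_self]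

/-- The bounds are $(3/8)^2$ and $(4/3)^2$: this covers the spectrum of the Littlewood–Paley block
of index $n\ge1$ rescaled by $R=2^n$. -/
lemma annulusCutoff_of_mem {v : ℝ} (h : 9 / 64 ≤ v) (h' : v ≤ 16 / 9) : annulusCutoff v = 1 := by
  rw [annulusCutoff, sqCutoff_of_le (by linarith), sqCutoff_of_ge (by linarith), sub_zero]

/-- The cut-off vanishes near the origin and so removes the pole. -/
lemma contDiff_annulusCutoff_div : ContDiff ℝ (⊤ : ℕ∞) fun v => annulusCutoff v / v := by
  refine contDiff_iff_contDiffAt.2 fun v => ?_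
  rcases lt_or_ge v (9 / 256) with hv | hv
  · refine contDiffAt_const (c := (0 : ℝ)) |>.congr_of_eventuallyEq ?_
    filter_upwards [Iio_mem_nhds hv] with w hw
    rw [annulusCutoff_of_le (le_of_lt hw), zero_div]
  · exact contDiff_annulusCutoff.contDiffAt.div contDiffAt_id (by change v ≠ 0; linarith)

/-- Trigonometric polynomials with frequencies in an annulus of size `R` are divergences of
vector fields that are smaller by a factor `R`. -/
theorem exists_inverse_gradient : ∃ C : ℝ, 0 < C ∧ ∀ (R : ℝ), 1 ≤ R → ∀ (c : TorusDist), FinSupp c →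
    (∀ k, c k ≠ 0 → 3 / 8 * R ≤ freqNorm k ∧ freqNorm k ≤ 4 / 3 * R) →
    ∀ M : ℝ, (∀ x, ‖trig c x‖ ≤ M) →
      ∃ d : Fin 2 → TorusDist, (∀ l, FinSupp (d l)) ∧ (∀ l x, ‖trig (d l) x‖ ≤ C / R * M) ∧
        c = ∑ l, partialDist l (d l) := by
  have hg : ∀ l : Fin 2, ContDiff ℝ (⊤ : ℕ∞) fun ξ : Fin 2 → ℝ =>
      (2 * Real.pi * Complex.I)⁻¹ * (ξ l : ℂ) * ((annulusCutoff (sqLen ξ) / sqLen ξ : ℝ) : ℂ) :=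
    fun l => (contDiff_const.mul (Complex.ofRealCLM.contDiff.comp (contDiff_apply ℝ ℝ l))).mul
      (Complex.ofRealCLM.contDiff.comp (contDiff_annulusCutoff_div.comp contDiff_sqLen))
  have hs : ∀ l : Fin 2, HasCompactSupport fun ξ : Fin 2 → ℝ =>
      (2 * Real.pi * Complex.I)⁻¹ * (ξ l : ℂ) * ((annulusCutoff (sqLen ξ) / sqLen ξ : ℝ) : ℂ) :=
    fun l => hasCompactSupport_of_sqLen (a := 64 / 9) fun ξ h => by
      rw [annulusCutoff_of_ge h]; simp
  choose ρ B hρ hB h using fun l => exists_symbolBound (hg l) (hs l)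
  refine ⟨max (15 * ρ 0 * B 0) (15 * ρ 1 * B 1), lt_max_of_lt_left
    (by have := hB 0; have := hρ 0; positivity), fun R hR c hc hsupp M hM => ?_⟩
  have hM0 : 0 ≤ M := (norm_nonneg _).trans (hM 0)
  have hR0 : 0 < R := by linarith
  have hmax : ∀ l, 15 * ρ l * B l ≤ max (15 * ρ 0 * B 0) (15 * ρ 1 * B 1) := by
    intro l
    fin_cases l
    · exact le_max_left _ _
    · exact le_max_right _ _
  -- The fields are $\Delta^{-1}\partial_lc$, with symbol $k_l/(2\pi i|k|^2)$, and $\sum_l2\pi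
  -- ik_l\cdot k_l/(2\pi i|k|^2)=1$. The symbol is homogeneous of degree $-1$, which yields the
  -- factor $1/R$.
  refine ⟨fun l => ((R : ℂ)⁻¹) • fun k => ((2 * Real.pi * Complex.I)⁻¹ * (((k l : ℝ) / R : ℝ) : ℂ) *
    ((annulusCutoff (sqLen fun l => (k l : ℝ) / R) / sqLen (fun l => (k l : ℝ) / R) : ℝ) : ℂ)) * c k,
    fun l => (hc.mul_left _).smul _, fun l x => ?_, ?_⟩
  · rw [trig_smul, norm_mul, norm_inv, Complex.norm_real, Real.norm_of_nonneg hR0.le]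
    calc R⁻¹ * _ ≤ R⁻¹ * (15 * ρ l * B l * M) := by
          gcongr
          exact (h l).norm_trig_le (hρ l) (hB l) hR hc hM x
      _ ≤ R⁻¹ * (max (15 * ρ 0 * B 0) (15 * ρ 1 * B 1) * M) := by gcongr; exact hmax l
      _ = _ := by ring
  · ext k
    by_cases hk : c k = 0
    · simp [partialDist, hk]
    · obtain ⟨h1, h1'⟩ := hsupp k hk
      have h2 : freqNorm k ^ 2 ≤ (4 / 3 * R) ^ 2 := pow_le_pow_left₀ (freqNorm_nonneg k) h1' 2
      have h2' : (3 / 8 * R) ^ 2 ≤ freqNorm k ^ 2 := pow_le_pow_left₀ (by positivity) h1 2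
      have h3 : annulusCutoff (sqLen fun l => (k l : ℝ) / R) = 1 := by
        rw [sqLen_div]
        refine annulusCutoff_of_mem ?_ ?_
        · rw [le_div_iff₀ (by positivity)]; nlinarith
        · rw [div_le_iff₀ (by positivity)]; nlinarith
      have hpos : 0 < freqNorm k ^ 2 := lt_of_lt_of_le (by positivity) h2'
      have hq : ((freqNorm k ^ 2 : ℝ) : ℂ) = (k 0 : ℂ) ^ 2 + (k 1 : ℂ) ^ 2 := by
        rw [freqNorm, Real.sq_sqrt (by positivity), Fin.sum_univ_two]
        push_cast
        ring
      have hq0 : (k 0 : ℂ) ^ 2 + (k 1 : ℂ) ^ 2 ≠ 0 := by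
        rw [← hq]; exact_mod_cast hpos.ne'
      have hRc : (R : ℂ) ≠ 0 := by exact_mod_cast hR0.ne'
      have hpi : (Real.pi : ℂ) ≠ 0 := by exact_mod_cast Real.pi_ne_zero
      have hI := Complex.I_ne_zero
      simp only [partialDist, Pi.smul_apply, smul_eq_mul, h3, Finset.sum_apply,
        Fin.sum_univ_two]
      simp only [sqLen_div, Complex.ofReal_div, Complex.ofReal_one, Complex.ofReal_pow]
      rw [show ((freqNorm k : ℂ)) ^ 2 = (k 0 : ℂ) ^ 2 + (k 1 : ℂ) ^ 2 by rw [← hq]; push_cast; ring]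
      push_cast
      field_simp

/-! ### The semigroup on a single frequency block. -/

/-- With $\kappa=\min(1,c/3)$, $e^{c\tau/3}\ge1+c\tau/3\ge\kappa(1+\tau)$, and the cube of this is
used. Two derivatives of $e^{-\tau w|\xi|^2}$ cost a factor $\tau^2$; the exponential decay pays for
it and still leaves $1/(1+\tau)$. -/
lemma exp_mul_sq_le {c τ : ℝ} (hc : 0 < c) (hτ : 0 ≤ τ) :
    Real.exp (-(c * τ)) * (1 + τ) ^ 2 ≤ (1 / min 1 (c / 3)) ^ 3 / (1 + τ) := by
  set κ := min 1 (c / 3)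
  have hκ : 0 < κ := lt_min one_pos (by positivity)
  have h1 : κ * (1 + τ) ≤ Real.exp (c * τ / 3) := by
    have := Real.add_one_le_exp (c * τ / 3)
    have h2 : κ ≤ 1 := min_le_left _ _
    have h3 : κ * τ ≤ c / 3 * τ := mul_le_mul_of_nonneg_right (min_le_right _ _) hτ
    linarith
  have h2 : (κ * (1 + τ)) ^ 3 ≤ Real.exp (c * τ) := by
    refine (pow_le_pow_left₀ (by positivity) h1 3).trans (le_of_eq ?_)
    rw [← Real.exp_nat_mul]
    congr 1
    push_cast
    ring
  rw [Real.exp_neg, le_div_iff₀ (by positivity), mul_assoc, inv_mul_le_iff₀ (Real.exp_pos _),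
    one_div, inv_pow, ← div_eq_mul_inv, le_div_iff₀ (by positivity)]
  calc (1 + τ) ^ 2 * (1 + τ) * κ ^ 3 = (κ * (1 + τ)) ^ 3 := by ring
    _ ≤ _ := h2

/-- The annulus cut-off as a complex symbol. -/
noncomputable def annulusSymbol (ξ : Fin 2 → ℝ) : ℂ := (annulusCutoff (sqLen ξ) : ℂ)

lemma contDiff_annulusSymbol : ContDiff ℝ (⊤ : ℕ∞) annulusSymbol :=
  Complex.ofRealCLM.contDiff.comp (contDiff_annulusCutoff.comp contDiff_sqLen)

lemma hasCompactSupport_annulusSymbol : HasCompactSupport annulusSymbol :=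
  hasCompactSupport_of_sqLen (a := 64 / 9) fun ξ h => by
    rw [annulusSymbol, annulusCutoff_of_ge h, Complex.ofReal_zero]

lemma annulusSymbol_eventually_zero {ξ : Fin 2 → ℝ} (h : sqLen ξ < 9 / 256) :
    annulusSymbol =ᶠ[𝓝 ξ] fun _ => 0 := by
  filter_upwards [contDiff_sqLen.continuous.continuousAt.preimage_mem_nhds (Iio_mem_nhds h)] with η hη
  rw [annulusSymbol, annulusCutoff_of_le (le_of_lt hη), Complex.ofReal_zero]

lemma hasDerivAt_sqLen_line (ξ : Fin 2 → ℝ) (l : Fin 2) :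
    HasDerivAt (fun s : ℝ => sqLen (ξ + s • Pi.single l 1)) (2 * ξ l) 0 := by
  have h1 : ∀ i : Fin 2, HasDerivAt (fun s : ℝ => (ξ + s • (Pi.single l 1 : Fin 2 → ℝ)) i)
      ((Pi.single l 1 : Fin 2 → ℝ) i) 0 := fun i => by
    simpa using ((hasDerivAt_id (0 : ℝ)).mul_const ((Pi.single l 1 : Fin 2 → ℝ) i)).const_add (ξ i)
  have h2 := HasDerivAt.fun_sum (u := Finset.univ) fun i _ => (h1 i).fun_pow 2
  refine h2.congr_deriv ?_
  fin_cases l <;> simp [Fin.sum_univ_two]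

/-- The symbol of the semigroup, localized to an annulus. -/
lemma exists_symbolBound_semigroup {w : ℂ} (hw : 0 < w.re) :
    ∃ ρ C : ℝ, 1 ≤ ρ ∧ 0 < C ∧ ∀ τ : ℝ, 0 ≤ τ →
      SymbolBound (fun ξ => Complex.exp (-(τ : ℂ) * w * (sqLen ξ : ℂ)) * annulusSymbol ξ) ρ
        (C / (1 + τ)) := by
  obtain ⟨ρ, hρ, hsupp⟩ := exists_box_of_hasCompactSupport hasCompactSupport_annulusSymbol
  have hχ := contDiff_annulusSymbol
  have hχs := hasCompactSupport_annulusSymbol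
  set χ := annulusSymbol
  let χ₁ : Fin 2 → (Fin 2 → ℝ) → ℂ := fun l ξ => fderiv ℝ χ ξ (Pi.single l 1)
  have hχ₁ : ∀ l, ContDiff ℝ (⊤ : ℕ∞) (χ₁ l) := fun l => contDiff_fderiv_apply hχ _
  have hχ₁s : ∀ l, HasCompactSupport (χ₁ l) := fun l => hasCompactSupport_fderiv_apply hχs _
  have hχ₂ : ∀ l, ContDiff ℝ (⊤ : ℕ∞) (secondPartial χ l) := fun l => contDiff_fderiv_apply (hχ₁ l) _
  have hχ₂s : ∀ l, HasCompactSupport (secondPartial χ l) := fun l =>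
    hasCompactSupport_fderiv_apply (hχ₁s l) _
  have hcoord : ∀ l : Fin 2, Continuous fun ξ : Fin 2 → ℝ => (ξ l : ℂ) := fun l =>
    Complex.continuous_ofReal.comp (continuous_apply l)
  -- Near the origin the exponential does not decay in $\tau$, but there the symbol and its
  -- derivatives vanish; so only $|\xi|^2\ge9/256$ has to be estimated.
  have hz : ∀ ξ, sqLen ξ < 9 / 256 → χ ξ = 0 ∧ ∀ l, χ₁ l ξ = 0 ∧ secondPartial χ l ξ = 0 := by
    intro ξ h
    have h0 := annulusSymbol_eventually_zero h
    refine ⟨h0.self_of_nhds, fun l => ?_⟩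
    have h1 : χ₁ l =ᶠ[𝓝 ξ] fun _ => 0 := by
      filter_upwards [h0.eventually_nhds] with η hη
      have hη' : χ =ᶠ[𝓝 η] fun _ => 0 := hη
      have : fderiv ℝ χ η = 0 := by rw [hη'.fderiv_eq]; simp
      simp [χ₁, this]
    refine ⟨h1.self_of_nhds, ?_⟩
    have : fderiv ℝ (χ₁ l) ξ = 0 := by rw [h1.fderiv_eq]; simp
    simp [secondPartial, χ₁] at this ⊢
    rw [this]
    simp
  have hK : ∃ K : ℝ, 0 < K ∧ ∀ ξ l, ‖χ ξ‖ ≤ K ∧ ‖(ξ l : ℂ) * χ₁ l ξ‖ ≤ K ∧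
      ‖(ξ l : ℂ) ^ 2 * χ ξ‖ ≤ K ∧ ‖secondPartial χ l ξ‖ ≤ K := by
    obtain ⟨K₀, h₀⟩ := hχ.continuous.bounded_above_of_compact_support hχs
    choose K₁ h₁ using fun l => ((hcoord l).mul (hχ₁ l).continuous).bounded_above_of_compact_support
      ((hχ₁s l).mul_left)
    choose K₂ h₂ using fun l => (((hcoord l).pow 2).mul hχ.continuous).bounded_above_of_compact_support
      (hχs.mul_left)
    choose K₃ h₃ using fun l => (hχ₂ l).continuous.bounded_above_of_compact_support (hχ₂s l)
    refine ⟨1 + |K₀| + ∑ l, (|K₁ l| + |K₂ l| + |K₃ l|), by positivity, fun ξ l => ?_⟩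
    have hs : |K₁ l| + |K₂ l| + |K₃ l| ≤ ∑ l, (|K₁ l| + |K₂ l| + |K₃ l|) :=
      Finset.single_le_sum (f := fun l => |K₁ l| + |K₂ l| + |K₃ l|) (fun _ _ => by positivity)
        (Finset.mem_univ l)
    have hs0 : 0 ≤ ∑ l, (|K₁ l| + |K₂ l| + |K₃ l|) := by positivity
    have a0 := abs_nonneg K₀
    have a1 := abs_nonneg (K₁ l)
    have a2 := abs_nonneg (K₂ l)
    have a3 := abs_nonneg (K₃ l)
    refine ⟨?_, ?_, ?_, ?_⟩
    · linarith [h₀ ξ, le_abs_self K₀]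
    · have h : ‖(ξ l : ℂ) * χ₁ l ξ‖ ≤ K₁ l := h₁ l ξ
      linarith [le_abs_self (K₁ l)]
    · have h : ‖(ξ l : ℂ) ^ 2 * χ ξ‖ ≤ K₂ l := h₂ l ξ
      linarith [le_abs_self (K₂ l)]
    · linarith [h₃ l ξ, le_abs_self (K₃ l)]
  obtain ⟨K, hKpos, hK⟩ := hK
  set c := w.re * (9 / 256)
  have hc : 0 < c := by positivity
  set D := (1 / min 1 (c / 3)) ^ 3
  have hD : 0 < D := by
    have : 0 < min 1 (c / 3) := lt_min one_pos (by positivity)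
    positivity
  refine ⟨ρ, K * (1 + 3 * ‖w‖) ^ 2 * D, hρ, by positivity, fun τ hτ => ?_⟩
  set e : (Fin 2 → ℝ) → ℂ := fun ξ => Complex.exp (-(τ : ℂ) * w * (sqLen ξ : ℂ))
  have he : ∀ ξ, 9 / 256 ≤ sqLen ξ → ‖e ξ‖ ≤ Real.exp (-(c * τ)) := by
    intro ξ h
    simp only [e, Complex.norm_exp]
    refine Real.exp_le_exp.2 ?_
    have : (-(τ : ℂ) * w * (sqLen ξ : ℂ)).re = -(τ * w.re * sqLen ξ) := by
      simp [Complex.mul_re]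
    rw [this]
    simp only [c]
    have : w.re * (9 / 256) * τ ≤ w.re * sqLen ξ * τ := by gcongr
    linarith
  have hED : Real.exp (-(c * τ)) * (1 + τ) ^ 2 ≤ D / (1 + τ) := exp_mul_sq_le hc hτ
  -- The polynomial on the left collects the coefficients $1$, $2\tau w$, $4\tau w$ and $4\tau^2w^2$
  -- of the second derivative of the symbol.
  have h3w : 1 + 6 * τ * ‖w‖ + 4 * τ ^ 2 * ‖w‖ ^ 2 ≤ (1 + 3 * ‖w‖) ^ 2 * (1 + τ) ^ 2 := by
    have h0 : 0 ≤ τ * ‖w‖ := by positivity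
    have h1 : 1 + 3 * (τ * ‖w‖) ≤ (1 + 3 * ‖w‖) * (1 + τ) := by nlinarith [norm_nonneg w]
    have := pow_le_pow_left₀ (by positivity) h1 2
    nlinarith
  have hfin : Real.exp (-(c * τ)) * (K * (1 + 6 * τ * ‖w‖ + 4 * τ ^ 2 * ‖w‖ ^ 2))
      ≤ K * (1 + 3 * ‖w‖) ^ 2 * D / (1 + τ) := by
    calc _ ≤ Real.exp (-(c * τ)) * (K * ((1 + 3 * ‖w‖) ^ 2 * (1 + τ) ^ 2)) := by gcongr
      _ = K * (1 + 3 * ‖w‖) ^ 2 * (Real.exp (-(c * τ)) * (1 + τ) ^ 2) := by ring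
      _ ≤ K * (1 + 3 * ‖w‖) ^ 2 * (D / (1 + τ)) := by gcongr
      _ = _ := by ring
  refine ⟨fun ξ h => by rw [hsupp ξ h, mul_zero], fun ξ => ?_, fun l => ?_⟩
  · rcases lt_or_ge (sqLen ξ) (9 / 256) with h | h
    · rw [(hz ξ h).1, mul_zero, norm_zero]
      positivity
    · refine le_trans ?_ hfin
      rw [norm_mul]
      refine mul_le_mul (he ξ h) ((hK ξ 0).1.trans ?_) (norm_nonneg _) (Real.exp_pos _).le
      have : 0 ≤ 6 * τ * ‖w‖ + 4 * τ ^ 2 * ‖w‖ ^ 2 := by positivity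
      nlinarith
  · have hel : ∀ ξ, HasDerivAt (fun s : ℝ => e (ξ + s • Pi.single l 1))
        (e ξ * (-(τ : ℂ) * w * (2 * ξ l : ℝ))) 0 := by
      intro ξ
      have := ((hasDerivAt_sqLen_line ξ l).ofReal_comp.const_mul (-(τ : ℂ) * w)).cexp
      simpa [e] using this
    have hcl : ∀ ξ : Fin 2 → ℝ, HasDerivAt (fun s : ℝ => (((ξ + s • (Pi.single l 1 : Fin 2 → ℝ)) l : ℝ) : ℂ))
        1 0 := by
      intro ξ
      have : HasDerivAt (fun s : ℝ => (ξ + s • (Pi.single l 1 : Fin 2 → ℝ)) l) 1 0 := by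
        simpa using (hasDerivAt_id (0 : ℝ)).const_add (ξ l)
      simpa using this.ofReal_comp
    have hd0 := hasDerivAt_line_of_contDiff (hχ.differentiable (by simp)) (Pi.single l 1)
    have hd1 := hasDerivAt_line_of_contDiff ((hχ₁ l).differentiable (by simp)) (Pi.single l 1)
    refine ⟨fun ξ => e ξ * (χ₁ l ξ - 2 * τ * w * (ξ l * χ ξ)),
      fun ξ => e ξ * (secondPartial χ l ξ - 2 * τ * w * χ ξ - 4 * τ * w * (ξ l * χ₁ l ξ)
        + 4 * τ ^ 2 * w ^ 2 * (ξ l ^ 2 * χ ξ)), fun ξ => ?_, fun ξ => ?_, fun ξ => ?_⟩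
    · refine ((hel ξ).mul (hd0 ξ)).congr_deriv ?_
      simp only [zero_smul, add_zero, χ₁]
      push_cast
      ring
    · refine ((hel ξ).mul ((hd1 ξ).sub (((hcl ξ).mul (hd0 ξ)).const_mul (2 * τ * w)))).congr_deriv ?_
      simp only [zero_smul, add_zero, χ₁, secondPartial, Pi.sub_apply, Pi.mul_apply]
      push_cast
      ring
    · beta_reduce
      rcases lt_or_ge (sqLen ξ) (9 / 256) with h | h
      · obtain ⟨z0, z⟩ := hz ξ h
        rw [z0, (z l).1, (z l).2]
        simp only [mul_zero, sub_zero, add_zero, norm_zero]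
        positivity
      · refine le_trans ?_ hfin
        obtain ⟨k0, k1, k2, k3⟩ := hK ξ l
        rw [norm_mul]
        refine mul_le_mul (he ξ h) ?_ (norm_nonneg _) (Real.exp_pos _).le
        have n1 : ‖2 * (τ : ℂ) * w * χ ξ‖ ≤ 2 * τ * ‖w‖ * K := by
          rw [norm_mul, norm_mul, norm_mul, Complex.norm_real, Real.norm_of_nonneg hτ]
          simp only [Complex.norm_ofNat]
          gcongr
        have n2 : ‖4 * (τ : ℂ) * w * (ξ l * χ₁ l ξ)‖ ≤ 4 * τ * ‖w‖ * K := by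
          rw [norm_mul, norm_mul, norm_mul, Complex.norm_real, Real.norm_of_nonneg hτ]
          simp only [Complex.norm_ofNat]
          gcongr
        have n3 : ‖4 * (τ : ℂ) ^ 2 * w ^ 2 * (ξ l ^ 2 * χ ξ)‖ ≤ 4 * τ ^ 2 * ‖w‖ ^ 2 * K := by
          rw [norm_mul, norm_mul, norm_mul, norm_pow, norm_pow, Complex.norm_real,
            Real.norm_of_nonneg hτ]
          simp only [Complex.norm_ofNat]
          gcongr
        refine (norm_add_le_of_le (norm_sub_le_of_le (norm_sub_le_of_le k3 n1) n2) n3).trans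
          (le_of_eq ?_)
        ring

/-- Smoothing by the semigroup on frequencies in an annulus of size `R`. -/
theorem exists_semigroup_bound {μ : ℝ} (hμ : 0 < μ) : ∃ C : ℝ, 0 < C ∧ ∀ (R : ℝ), 1 ≤ R →
    ∀ (c : TorusDist), FinSupp c →
    (∀ k, c k ≠ 0 → 3 / 8 * R ≤ freqNorm k ∧ freqNorm k ≤ 4 / 3 * R) →
    ∀ M : ℝ, (∀ x, ‖trig c x‖ ≤ M) → ∀ t : ℝ, 0 ≤ t → ∀ x,
      ‖trig (semigroupA μ t c) x‖ ≤ C / (1 + t * R ^ 2) * M := by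
  have hw : 0 < ((Complex.I + μ) * ((4 * Real.pi ^ 2 : ℝ) : ℂ)).re := by
    rw [Complex.re_mul_ofReal]
    simp
    positivity
  obtain ⟨ρ, C, hρ, hC, h⟩ := exists_symbolBound_semigroup hw
  refine ⟨15 * ρ * C, by positivity, fun R hR c hc hsupp M hM t ht x => ?_⟩
  have hM0 : 0 ≤ M := (norm_nonneg _).trans (hM 0)
  have hR0 : 0 < R := by linarith
  have key := (h (t * R ^ 2) (by positivity)).norm_trig_le hρ (by positivity) hR hc hM x
  -- By scaling, the heat symbol at time $t$ and frequency $k$ is the one at time $tR^2$ and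
  -- frequency $k/R$. The factor $e^{-t}$ comes from the $-1$ in $A$ and is bounded by one.
  have he : semigroupA μ t c = ((Real.exp (-t) : ℝ) : ℂ) • fun k =>
      Complex.exp (-((t * R ^ 2 : ℝ) : ℂ) * ((Complex.I + μ) * ((4 * Real.pi ^ 2 : ℝ) : ℂ))
        * (sqLen (fun l => (k l : ℝ) / R) : ℂ)) * annulusSymbol (fun l => (k l : ℝ) / R) * c k := by
    ext k
    by_cases hk : c k = 0
    · simp [semigroupA, hk]
    · obtain ⟨h1, h1'⟩ := hsupp k hk
      have h2 : freqNorm k ^ 2 ≤ (4 / 3 * R) ^ 2 := pow_le_pow_left₀ (freqNorm_nonneg k) h1' 2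
      have h2' : (3 / 8 * R) ^ 2 ≤ freqNorm k ^ 2 := pow_le_pow_left₀ (by positivity) h1 2
      have h3 : annulusSymbol (fun l => (k l : ℝ) / R) = 1 := by
        rw [annulusSymbol, sqLen_div, annulusCutoff_of_mem, Complex.ofReal_one]
        · rw [le_div_iff₀ (by positivity)]; nlinarith
        · rw [div_le_iff₀ (by positivity)]; nlinarith
      simp only [semigroupA, Pi.smul_apply, smul_eq_mul, h3, mul_one, Complex.ofReal_exp]
      rw [← mul_assoc, ← Complex.exp_add]
      congr 2
      have hRc : (R : ℂ) ≠ 0 := by exact_mod_cast hR0.ne'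
      rw [sqLen_div]
      push_cast
      field_simp
      ring
  rw [he, trig_smul, norm_mul, Complex.norm_real, Real.norm_of_nonneg (Real.exp_pos _).le]
  have h1 : Real.exp (-t) ≤ 1 := Real.exp_le_one_iff.2 (by linarith)
  calc Real.exp (-t) * _ ≤ 1 * (15 * ρ * (C / (1 + t * R ^ 2)) * M) := by gcongr
    _ = _ := by ring

/-- The semigroup on low frequencies. -/
lemma norm_trig_semigroup_low_le {μ : ℝ} (hμ : 0 < μ) {c : TorusDist}
    (hsupp : ∀ k, c k ≠ 0 → freqNorm k ≤ 4 / 3) {M : ℝ} (hM : ∀ x, ‖trig c x‖ ≤ M) {t : ℝ}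
    (ht : 0 ≤ t) (x : Torus2) : ‖trig (semigroupA μ t c) x‖ ≤ 16 * M := by
  have hM0 : 0 ≤ M := (norm_nonneg _).trans (hM 0)
  -- At most $(2\cdot\frac43+1)^2\le16$ frequencies occur, so bounding each coefficient separately
  -- is enough.
  obtain ⟨F, hF, hcard⟩ := card_freqBox_le (L := 4 / 3) (by norm_num)
  have hcF : ∀ k ∉ F, c k = 0 := by
    intro k hk
    by_contra h0
    refine hk (hF k fun l => le_trans ?_ (hsupp k h0))
    rw [freqNorm]
    exact Real.abs_le_sqrt (Finset.single_le_sum (f := fun l => (k l : ℝ) ^ 2)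
      (fun _ _ => sq_nonneg _) (Finset.mem_univ l))
  have hsF : ∀ k ∉ F, semigroupA μ t c k = 0 := fun k hk => by simp [semigroupA, hcF k hk]
  rw [trig_eq_sum hsF]
  calc ‖∑ k ∈ F, semigroupA μ t c k * mFourier k x‖ ≤ ∑ _k ∈ F, M := by
        refine norm_sum_le_of_le _ fun k _ => ?_
        rw [norm_mul, norm_mFourier_apply, mul_one, semigroupA, norm_mul, Complex.norm_exp]
        have h1 := norm_coeff_le (.of_finset F hcF) hM k
        refine (mul_le_mul_of_nonneg_right ?_ (norm_nonneg _)).trans ((one_mul _).le.trans h1)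
        refine Real.exp_le_one_iff.2 ?_
        have : (-(t : ℂ) * (1 + (Complex.I + μ) * ((4 * Real.pi ^ 2 * freqNorm k ^ 2 : ℝ) : ℂ))).re
            = -(t * (1 + μ * (4 * Real.pi ^ 2 * freqNorm k ^ 2))) := by
          rw [← Complex.ofReal_neg, Complex.re_ofReal_mul, Complex.add_re, Complex.re_mul_ofReal]
          simp
        rw [this]
        have : 0 ≤ t * (1 + μ * (4 * Real.pi ^ 2 * freqNorm k ^ 2)) := by positivity
        linarith
    _ = F.card * M := by simp
    _ ≤ 16 * M := by
        gcongr
        refine hcard.trans (by norm_num)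

/-! Littlewood–Paley symbols. -/

lemma lpSymbol_nonneg (n : ℕ) (k : Fin 2 → ℤ) : 0 ≤ lpSymbol n k := by
  cases n with
  | zero => exact lpCutoff_nonneg _
  | succ n =>
    simp only [lpSymbol, sub_nonneg]
    refine lpCutoff_antitone (div_le_div_of_nonneg_left (freqNorm_nonneg k) (by positivity) ?_)
    exact pow_le_pow_right₀ (by norm_num) (by omega)

lemma sum_lpSymbol (N : ℕ) (k : Fin 2 → ℤ) :
    ∑ n ∈ Finset.range (N + 1), lpSymbol n k = lpCutoff (freqNorm k / 2 ^ N) := by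
  induction N with
  | zero => simp [lpSymbol]
  | succ N ih => rw [Finset.sum_range_succ, ih, lpSymbol]; ring

lemma freqNorm_le_of_lpSymbol_ne {n : ℕ} {k : Fin 2 → ℤ} (h : lpSymbol n k ≠ 0) :
    freqNorm k ≤ 4 / 3 * 2 ^ n := by
  by_contra! hlt
  have h0 : ∀ m ≤ n, lpCutoff (freqNorm k / 2 ^ m) = 0 := fun m hm => lpCutoff_of_ge (by
    rw [le_div_iff₀ (by positivity)]
    refine le_trans ?_ hlt.le
    gcongr
    norm_num)
  apply h
  cases n with
  | zero => simpa [lpSymbol] using h0 0 le_rfl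
  | succ n => rw [lpSymbol, h0 _ le_rfl, h0 _ (Nat.le_succ n), sub_zero]

lemma le_freqNorm_of_lpSymbol_ne {n : ℕ} (hn : 1 ≤ n) {k : Fin 2 → ℤ} (h : lpSymbol n k ≠ 0) :
    3 / 8 * 2 ^ n ≤ freqNorm k := by
  obtain ⟨n, rfl⟩ := Nat.exists_eq_add_of_le' hn
  by_contra! hlt
  have h0 : ∀ m, n ≤ m → lpCutoff (freqNorm k / 2 ^ m) = 1 := fun m hm => lpCutoff_of_le (by
    rw [div_le_iff₀ (by positivity)]
    have : (2 : ℝ) ^ n ≤ 2 ^ m := pow_le_pow_right₀ (by norm_num) hm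
    rw [pow_succ] at hlt
    linarith)
  apply h
  rw [lpSymbol, h0 _ (Nat.le_succ n), h0 _ le_rfl, sub_self]

lemma abs_coord_le_freqNorm (k : Fin 2 → ℤ) (l : Fin 2) : |(k l : ℝ)| ≤ freqNorm k := by
  rw [freqNorm]
  exact Real.abs_le_sqrt (Finset.single_le_sum (f := fun l => (k l : ℝ) ^ 2)
    (fun _ _ => sq_nonneg _) (Finset.mem_univ l))

lemma FinSupp.of_freqNorm {c : TorusDist} {L : ℝ} (hL : 0 ≤ L)
    (h : ∀ k, c k ≠ 0 → freqNorm k ≤ L) : FinSupp c := by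
  obtain ⟨F, hF, -⟩ := card_freqBox_le hL
  refine .of_finset F fun k hk => ?_
  by_contra h0
  exact hk (hF k fun l => (abs_coord_le_freqNorm k l).trans (h k h0))

/-- The coefficients of the Littlewood–Paley block. -/
noncomputable def blk (n : ℕ) (u : TorusDist) : TorusDist := fun k => (lpSymbol n k : ℂ) * u k

lemma lpBlock_eq_trig (n : ℕ) (u : TorusDist) : lpBlock n u = trig (blk n u) := rfl

lemma lpSymbol_ne_of_blk_ne {n : ℕ} {u : TorusDist} {k : Fin 2 → ℤ} (h : blk n u k ≠ 0) :
    lpSymbol n k ≠ 0 := fun h0 => h (by simp [blk, h0])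

lemma finSupp_blk (n : ℕ) (u : TorusDist) : FinSupp (blk n u) :=
  .of_freqNorm (L := 4 / 3 * 2 ^ n) (by positivity) fun _ hk =>
    freqNorm_le_of_lpSymbol_ne (lpSymbol_ne_of_blk_ne hk)

/-- The low-frequency truncation. -/
noncomputable def lowPass (N : ℕ) (u : TorusDist) : TorusDist := fun k =>
  (lpCutoff (freqNorm k / 2 ^ N) : ℂ) * u k

lemma lowPass_eq_sum (N : ℕ) (u : TorusDist) :
    lowPass N u = fun k => ∑ n ∈ Finset.range (N + 1), blk n u k := by
  ext k
  simp only [lowPass, blk, ← Finset.sum_mul, ← sum_lpSymbol]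
  push_cast
  rfl

lemma finSupp_lowPass (N : ℕ) (u : TorusDist) : FinSupp (lowPass N u) := by
  rw [lowPass_eq_sum]
  exact .sum _ fun n _ => finSupp_blk n u

lemma trig_lowPass (N : ℕ) (u : TorusDist) (x : Torus2) :
    trig (lowPass N u) x = ∑ n ∈ Finset.range (N + 1), lpBlock n u x := by
  rw [lowPass_eq_sum, trig_sum _ fun n _ => finSupp_blk n u]
  rfl

lemma exists_lpCutoff_eq_one (k : Fin 2 → ℤ) :
    ∃ N : ℕ, ∀ n, N ≤ n → lpCutoff (freqNorm k / 2 ^ n) = 1 := by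
  obtain ⟨N, hN⟩ := pow_unbounded_of_one_lt (4 / 3 * freqNorm k) (by norm_num : (1 : ℝ) < 2)
  refine ⟨N, fun n hn => lpCutoff_of_le ?_⟩
  rw [div_le_iff₀ (by positivity)]
  have : (2 : ℝ) ^ N ≤ 2 ^ n := pow_le_pow_right₀ (by norm_num) hn
  linarith

lemma hasSum_lpSymbol (k : Fin 2 → ℤ) : HasSum (fun n => lpSymbol n k) 1 := by
  obtain ⟨N, hN⟩ := exists_lpCutoff_eq_one k
  rw [hasSum_iff_tendsto_nat_of_nonneg fun n => lpSymbol_nonneg n k]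
  refine tendsto_const_nhds.congr' ?_
  filter_upwards [eventually_ge_atTop (N + 1)] with n hn
  obtain ⟨m, rfl⟩ := Nat.exists_eq_add_of_le' (show 1 ≤ n by omega)
  rw [sum_lpSymbol, hN m (by omega)]

/-! Dyadic weights. -/

/-- The weight `2^{jβ}` with `j = n - 1`. -/
noncomputable def dyad (β : ℝ) (n : ℕ) : ℝ := (2 : ℝ) ^ (((n : ℝ) - 1) * β)

lemma dyad_pos (β : ℝ) (n : ℕ) : 0 < dyad β n := Real.rpow_pos_of_pos (by norm_num) _

lemma dyad_add (β β' : ℝ) (n : ℕ) : dyad (β + β') n = dyad β n * dyad β' n := by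
  rw [dyad, mul_add, Real.rpow_add (by norm_num)]
  rfl

lemma dyad_zero (n : ℕ) : dyad 0 n = 1 := by simp [dyad]

lemma dyad_mul_neg (β : ℝ) (n : ℕ) : dyad β n * dyad (-β) n = 1 := by
  rw [← dyad_add, add_neg_cancel, dyad_zero]

lemma dyad_index_add (β : ℝ) (n m : ℕ) : dyad β (n + m) = dyad β n * ((2 : ℝ) ^ β) ^ m := by
  rw [dyad, dyad, ← Real.rpow_natCast, ← Real.rpow_mul (by norm_num),
    ← Real.rpow_add (by norm_num)]
  congr 1
  push_cast
  ring

lemma dyad_eq (β : ℝ) (n : ℕ) : dyad β n = (2 : ℝ) ^ (-β) * ((2 : ℝ) ^ β) ^ n := by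
  rw [← Nat.zero_add n, dyad_index_add]
  simp [dyad]

lemma dyad_one (n : ℕ) : dyad 1 n = 2 ^ n / 2 := by
  rw [dyad_eq, Real.rpow_neg (by norm_num), Real.rpow_one]
  ring

lemma two_rpow_neg_lt_one {β : ℝ} (hβ : 0 < β) : (2 : ℝ) ^ (-β) < 1 :=
  Real.rpow_lt_one_of_one_lt_of_neg (by norm_num) (by linarith)

lemma hasSum_dyad_neg {β : ℝ} (hβ : 0 < β) (N : ℕ) :
    HasSum (fun n => dyad (-β) (n + N)) (dyad (-β) N * (1 - (2 : ℝ) ^ (-β))⁻¹) := by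
  have h := (hasSum_geometric_of_lt_one (by positivity) (two_rpow_neg_lt_one hβ)).mul_left
    (dyad (-β) N)
  simpa only [add_comm _ N, dyad_index_add] using h

lemma summable_dyad_neg {β : ℝ} (hβ : 0 < β) : Summable fun n => dyad (-β) n := by
  simpa using (hasSum_dyad_neg hβ 0).summable

/-- The index $n=0$ stands for $j=-1$, where the weight decreases with the exponent; this one block
is responsible for the factor $2^{\beta-\beta'}$. -/
lemma dyad_mono {β β' : ℝ} (h : β' ≤ β) (n : ℕ) : dyad β' n ≤ (2 : ℝ) ^ (β - β') * dyad β n := by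
  have h1 : dyad β n = dyad β' n * dyad (β - β') n := by rw [← dyad_add]; congr 1; ring
  have h2 : (2 : ℝ) ^ (-(β - β')) ≤ dyad (β - β') n := by
    rw [dyad_eq]
    refine le_mul_of_one_le_right (by positivity) (one_le_pow₀ ?_)
    exact Real.one_le_rpow (by norm_num) (by linarith)
  rw [Real.rpow_neg (by norm_num)] at h2
  rw [h1]
  have h3 := mul_le_mul_of_nonneg_left h2 (dyad_pos β' n).le
  have hp : 0 < (2 : ℝ) ^ (β - β') := by positivity
  calc dyad β' n = 2 ^ (β - β') * (dyad β' n * (2 ^ (β - β'))⁻¹) := by field_simp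
    _ ≤ _ := by gcongr

lemma dyad_le_dyad {β : ℝ} (h : 0 ≤ β) {n m : ℕ} (hnm : n ≤ m) : dyad β n ≤ dyad β m := by
  obtain ⟨k, rfl⟩ := Nat.exists_eq_add_of_le hnm
  rw [dyad_index_add]
  exact le_mul_of_one_le_right (dyad_pos _ _).le
    (one_le_pow₀ (Real.one_le_rpow (by norm_num) h))

/-! Besov norms with real bounds. -/

/-- `‖u‖_{𝒞^β} ≤ M`. -/
def BesovLE (β : ℝ) (u : TorusDist) (M : ℝ) : Prop :=
  ∀ n x, dyad β n * ‖lpBlock n u x‖ ≤ M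

lemma BesovLE.nonneg {β : ℝ} {u : TorusDist} {M : ℝ} (h : BesovLE β u M) : 0 ≤ M :=
  (mul_nonneg (dyad_pos β 0).le (norm_nonneg _)).trans (h 0 0)

lemma besovNorm_le_iff {β : ℝ} {u : TorusDist} {M : ℝ} (hM : 0 ≤ M) :
    besovNorm β u ≤ ENNReal.ofReal M ↔ BesovLE β u M := by
  simp only [besovNorm, iSup_le_iff, BesovLE]
  refine forall_congr' fun n => ?_
  rw [ENNReal.mul_iSup, iSup_le_iff]
  refine forall_congr' fun x => ?_
  rw [← ofReal_norm, ← ENNReal.ofReal_mul (Real.rpow_nonneg (by norm_num) _),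
    ENNReal.ofReal_le_ofReal_iff hM]
  rfl

lemma besovLE_toReal {β : ℝ} {u : TorusDist} (h : besovNorm β u < ⊤) :
    BesovLE β u (besovNorm β u).toReal := by
  rw [← besovNorm_le_iff ENNReal.toReal_nonneg, ENNReal.ofReal_toReal h.ne]

lemma BesovLE.lt_top {β : ℝ} {u : TorusDist} {M : ℝ} (h : BesovLE β u M) : besovNorm β u < ⊤ :=
  ((besovNorm_le_iff h.nonneg).2 h).trans_lt ENNReal.ofReal_lt_top

lemma BesovLE.toReal_le {β : ℝ} {u : TorusDist} {M : ℝ} (h : BesovLE β u M) :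
    (besovNorm β u).toReal ≤ M :=
  ENNReal.toReal_le_of_le_ofReal h.nonneg ((besovNorm_le_iff h.nonneg).2 h)

lemma BesovLE.mono {β : ℝ} {u : TorusDist} {M M' : ℝ} (h : BesovLE β u M) (hM : M ≤ M') :
    BesovLE β u M' := fun n x => (h n x).trans hM

lemma BesovLE.norm_le {β : ℝ} {u : TorusDist} {M : ℝ} (h : BesovLE β u M) (n : ℕ) (x : Torus2) :
    ‖lpBlock n u x‖ ≤ M * dyad (-β) n := by
  have h1 := mul_le_mul_of_nonneg_right (h n x) (dyad_pos (-β) n).le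
  calc ‖lpBlock n u x‖ = dyad β n * dyad (-β) n * ‖lpBlock n u x‖ := by rw [dyad_mul_neg, one_mul]
    _ = dyad β n * ‖lpBlock n u x‖ * dyad (-β) n := by ring
    _ ≤ _ := h1

lemma BesovLE.of_norm_le {β : ℝ} {u : TorusDist} {M : ℝ}
    (h : ∀ n x, ‖lpBlock n u x‖ ≤ M * dyad (-β) n) : BesovLE β u M := fun n x => by
  have h1 := mul_le_mul_of_nonneg_left (h n x) (dyad_pos β n).le
  calc _ ≤ dyad β n * (M * dyad (-β) n) := h1
    _ = M * (dyad β n * dyad (-β) n) := by ring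
    _ = M := by rw [dyad_mul_neg, mul_one]

lemma blk_add (n : ℕ) (u v : TorusDist) : blk n (u + v) = blk n u + blk n v := by
  ext k; simp [blk, mul_add]

lemma blk_sub (n : ℕ) (u v : TorusDist) : blk n (u - v) = blk n u - blk n v := by
  ext k; simp [blk, mul_sub]

lemma blk_smul (n : ℕ) (a : ℂ) (u : TorusDist) : blk n (a • u) = a • blk n u := by
  ext k; simp [blk]; ring

lemma lpBlock_add (n : ℕ) (u v : TorusDist) (x : Torus2) :
    lpBlock n (u + v) x = lpBlock n u x + lpBlock n v x := by
  rw [lpBlock_eq_trig, blk_add, trig_add (finSupp_blk _ _) (finSupp_blk _ _)]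
  rfl

lemma lpBlock_sub (n : ℕ) (u v : TorusDist) (x : Torus2) :
    lpBlock n (u - v) x = lpBlock n u x - lpBlock n v x := by
  rw [lpBlock_eq_trig, blk_sub, trig_sub (finSupp_blk _ _) (finSupp_blk _ _)]
  rfl

lemma lpBlock_smul (n : ℕ) (a : ℂ) (u : TorusDist) (x : Torus2) :
    lpBlock n (a • u) x = a * lpBlock n u x := by
  rw [lpBlock_eq_trig, blk_smul, trig_smul]
  rfl

lemma BesovLE.add {β : ℝ} {u v : TorusDist} {M M' : ℝ} (hu : BesovLE β u M)
    (hv : BesovLE β v M') : BesovLE β (u + v) (M + M') := fun n x => by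
  rw [lpBlock_add]
  calc _ ≤ dyad β n * (‖lpBlock n u x‖ + ‖lpBlock n v x‖) :=
        mul_le_mul_of_nonneg_left (norm_add_le _ _) (dyad_pos _ _).le
    _ ≤ M + M' := by rw [mul_add]; exact add_le_add (hu n x) (hv n x)

lemma BesovLE.sub {β : ℝ} {u v : TorusDist} {M M' : ℝ} (hu : BesovLE β u M)
    (hv : BesovLE β v M') : BesovLE β (u - v) (M + M') := fun n x => by
  rw [lpBlock_sub]
  calc _ ≤ dyad β n * (‖lpBlock n u x‖ + ‖lpBlock n v x‖) :=
        mul_le_mul_of_nonneg_left (norm_sub_le _ _) (dyad_pos _ _).le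
    _ ≤ M + M' := by rw [mul_add]; exact add_le_add (hu n x) (hv n x)

lemma BesovLE.smul {β : ℝ} {u : TorusDist} {M : ℝ} (hu : BesovLE β u M) (a : ℂ) :
    BesovLE β (a • u) (‖a‖ * M) := fun n x => by
  rw [lpBlock_smul, norm_mul]
  calc _ = ‖a‖ * (dyad β n * ‖lpBlock n u x‖) := by ring
    _ ≤ _ := mul_le_mul_of_nonneg_left (hu n x) (norm_nonneg _)

lemma BesovLE.exponent_mono {β β' : ℝ} {u : TorusDist} {M : ℝ} (h : BesovLE β u M) (hβ : β' ≤ β) :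
    BesovLE β' u ((2 : ℝ) ^ (β - β') * M) := fun n x => by
  calc _ ≤ (2 : ℝ) ^ (β - β') * dyad β n * ‖lpBlock n u x‖ :=
        mul_le_mul_of_nonneg_right (dyad_mono hβ n) (norm_nonneg _)
    _ = (2 : ℝ) ^ (β - β') * (dyad β n * ‖lpBlock n u x‖) := by ring
    _ ≤ _ := mul_le_mul_of_nonneg_left (h n x) (by positivity)

lemma freqNorm_neg (k : Fin 2 → ℤ) : freqNorm (-k) = freqNorm k := by simp [freqNorm]

lemma lpSymbol_neg (n : ℕ) (k : Fin 2 → ℤ) : lpSymbol n (-k) = lpSymbol n k := by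
  cases n <;> simp [lpSymbol, freqNorm_neg]

lemma trig_conjDist (c : TorusDist) (x : Torus2) :
    trig (conjDist c) x = (starRingEnd ℂ) (trig c x) := by
  simp only [trig]
  rw [Complex.conj_tsum, ← (Equiv.neg (Fin 2 → ℤ)).tsum_eq]
  refine tsum_congr fun k => ?_
  simp only [conjDist, Equiv.neg_apply, neg_neg, map_mul, conj_mFourier]
  rfl

lemma blk_conjDist (n : ℕ) (u : TorusDist) : blk n (conjDist u) = conjDist (blk n u) := by
  ext k
  simp [blk, conjDist, lpSymbol_neg]

lemma lowPass_conjDist (n : ℕ) (u : TorusDist) : lowPass n (conjDist u) = conjDist (lowPass n u) := by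
  ext k
  simp [lowPass, conjDist, freqNorm_neg]

lemma BesovLE.conj {β : ℝ} {u : TorusDist} {M : ℝ} (h : BesovLE β u M) :
    BesovLE β (conjDist u) M := fun n x => by
  rw [lpBlock_eq_trig, blk_conjDist, trig_conjDist, RCLike.norm_conj]
  exact h n x

/-- Each Fourier coefficient is bounded by the norm. -/
lemma exists_coeff_bound (β : ℝ) (k : Fin 2 → ℤ) : ∃ C : ℝ, 0 ≤ C ∧
    ∀ (u : TorusDist) (M : ℝ), BesovLE β u M → ‖u k‖ ≤ C * M := by
  obtain ⟨N, hN⟩ := exists_lpCutoff_eq_one k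
  refine ⟨∑ n ∈ Finset.range (N + 1), dyad (-β) n,
    Finset.sum_nonneg fun n _ => (dyad_pos _ _).le, fun u M h => ?_⟩
  have h1 : u k = ∑ n ∈ Finset.range (N + 1), blk n u k := by
    rw [← congrFun (lowPass_eq_sum N u) k, lowPass, hN N le_rfl]
    simp
  rw [h1, Finset.sum_mul]
  refine norm_sum_le_of_le _ fun n _ => ?_
  rw [mul_comm]
  exact norm_coeff_le (finSupp_blk n u) (fun x => h.norm_le n x) k

/-- Interpolation between two regularities. -/
lemma BesovLE.interpolate {β₁ β₂ θ : ℝ} (h0 : 0 ≤ θ) (h1 : θ ≤ 1) {u : TorusDist} {M₁ M₂ : ℝ}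
    (hu₁ : BesovLE β₁ u M₁) (hu₂ : BesovLE β₂ u M₂) :
    BesovLE ((1 - θ) * β₁ + θ * β₂) u (M₁ ^ (1 - θ) * M₂ ^ θ) := fun n x => by
  have e : ∀ a β : ℝ, dyad (a * β) n = dyad β n ^ a := fun a β => by
    rw [dyad, dyad, ← Real.rpow_mul (by norm_num)]
    congr 1
    ring
  have h2 : ‖lpBlock n u x‖ = ‖lpBlock n u x‖ ^ (1 - θ) * ‖lpBlock n u x‖ ^ θ := by
    rcases (norm_nonneg (lpBlock n u x)).eq_or_lt with h | h
    · rw [← h]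
      rcases h0.eq_or_lt with h' | h'
      · simp [← h']
      · simp [Real.zero_rpow h'.ne']
    · rw [← Real.rpow_add h]
      simp
  have p1 := (dyad_pos β₁ n).le
  have p2 := (dyad_pos β₂ n).le
  rw [dyad_add, e, e]
  calc _ = (dyad β₁ n ^ (1 - θ) * ‖lpBlock n u x‖ ^ (1 - θ))
        * (dyad β₂ n ^ θ * ‖lpBlock n u x‖ ^ θ) := by
        conv_lhs => rw [h2]
        ring
    _ = (dyad β₁ n * ‖lpBlock n u x‖) ^ (1 - θ) * (dyad β₂ n * ‖lpBlock n u x‖) ^ θ := by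
        rw [Real.mul_rpow p1 (norm_nonneg _), Real.mul_rpow p2 (norm_nonneg _)]
    _ ≤ _ := mul_le_mul
        (Real.rpow_le_rpow (mul_nonneg p1 (norm_nonneg _)) (hu₁ n x) (by linarith))
        (Real.rpow_le_rpow (mul_nonneg p2 (norm_nonneg _)) (hu₂ n x) h0)
        (Real.rpow_nonneg (mul_nonneg p2 (norm_nonneg _)) _) (Real.rpow_nonneg hu₁.nonneg _)

lemma one_le_two_pow' (n : ℕ) : (1 : ℝ) ≤ 2 ^ n := one_le_pow₀ (by norm_num)

/-- Truncations are bounded, and approximate with a rate in spaces of lower regularity. -/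
theorem exists_lowPass_besov : ∃ C : ℝ, 1 ≤ C ∧ ∀ (β : ℝ) (u : TorusDist) (M : ℝ), BesovLE β u M →
    ∀ N, BesovLE β (lowPass N u) (C * M) ∧
      ∀ β' ≤ β, BesovLE β' (lowPass N u - u) (C * dyad (-(β - β')) N * M) := by
  obtain ⟨C, hC, h⟩ := exists_lowPass_bound
  refine ⟨C + 1, by linarith, fun β u M hu N => ?_⟩
  have hM := hu.nonneg
  have hb : ∀ n x, ‖lpBlock n (lowPass N u) x‖ ≤ C * (M * dyad (-β) n) := by
    intro n x
    have e : blk n (lowPass N u) = fun k => (lpCutoff (freqNorm k / 2 ^ N) : ℂ) * blk n u k := by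
      ext k; simp only [blk, lowPass]; ring
    rw [lpBlock_eq_trig, e]
    exact h _ (one_le_two_pow' N) _ (finSupp_blk n u) _ (fun x => hu.norm_le n x) x
  refine ⟨.of_norm_le fun n x => (hb n x).trans ?_, fun β' hβ' => .of_norm_le fun n x => ?_⟩
  · have := mul_nonneg hM (dyad_pos (-β) n).le
    nlinarith
  -- For $n<N$ the block lies at frequencies up to $\frac43 2^n\le\frac23 2^N$, where the cut-off at
  -- $2^N$ is one, so truncation does not change it. For $n\ge N$ the drop in regularity is
  -- converted into the decaying weight.
  · rcases lt_or_ge n N with hn | hn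
    · have : blk n (lowPass N u - u) = 0 := by
        ext k
        simp only [blk, lowPass, Pi.sub_apply, Pi.zero_apply]
        by_cases hk : lpSymbol n k = 0
        · simp [hk]
        · have h1 := freqNorm_le_of_lpSymbol_ne hk
          have h2 : lpCutoff (freqNorm k / 2 ^ N) = 1 := lpCutoff_of_le (by
            rw [div_le_iff₀ (by positivity)]
            have : (2 : ℝ) ^ (n + 1) ≤ 2 ^ N := pow_le_pow_right₀ (by norm_num) hn
            rw [pow_succ] at this
            have h0 : (0 : ℝ) < 2 ^ n := by positivity
            linarith)
          simp [h2]
      rw [lpBlock_eq_trig, this, trig_zero, norm_zero]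
      have := dyad_pos (-(β - β')) N
      have := dyad_pos (-β') n
      positivity
    · rw [lpBlock_sub]
      refine (norm_sub_le_of_le (hb n x) (hu.norm_le n x)).trans ?_
      have e : dyad (-β) n = dyad (-(β - β')) n * dyad (-β') n := by
        rw [← dyad_add]; congr 1; ring
      have h1 : dyad (-(β - β')) n ≤ dyad (-(β - β')) N := by
        obtain ⟨m, rfl⟩ := Nat.exists_eq_add_of_le hn
        rw [dyad_index_add]
        refine mul_le_of_le_one_right (dyad_pos _ _).le (pow_le_one₀ (by positivity) ?_)
        exact Real.rpow_le_one_of_one_le_of_nonpos (by norm_num) (by linarith)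
      calc C * (M * dyad (-β) n) + M * dyad (-β) n
          = (C + 1) * M * dyad (-β') n * dyad (-(β - β')) n := by rw [e]; ring
        _ ≤ (C + 1) * M * dyad (-β') n * dyad (-(β - β')) N := by
            have := dyad_pos (-β') n
            gcongr
        _ = _ := by ring

/-- Differentiation loses one derivative. -/
theorem exists_partial_besov : ∃ C : ℝ, 0 < C ∧ ∀ (β : ℝ) (u : TorusDist) (M : ℝ), BesovLE β u M →
    ∀ l, BesovLE (β - 1) (partialDist l u) (C * M) := by
  obtain ⟨C, hC, h⟩ := exists_bernstein
  refine ⟨2 * C, by positivity, fun β u M hu l => .of_norm_le fun n x => ?_⟩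
  have e : blk n (partialDist l u) = partialDist l (blk n u) := by
    ext k; simp only [blk, partialDist]; ring
  rw [lpBlock_eq_trig, e]
  refine (h _ (one_le_two_pow' n) _ (finSupp_blk n u)
    (fun k hk => freqNorm_le_of_lpSymbol_ne (lpSymbol_ne_of_blk_ne hk)) _
    (fun x => hu.norm_le n x) l x).trans (le_of_eq ?_)
  have : dyad (-(β - 1)) n = dyad 1 n * dyad (-β) n := by rw [← dyad_add]; congr 1; ring
  rw [this, dyad_one]
  ring

lemma BesovLE.summable_lpBlock {β : ℝ} (hβ : 0 < β) {u : TorusDist} {M : ℝ} (h : BesovLE β u M)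
    (x : Torus2) : Summable fun n => lpBlock n u x :=
  .of_norm_bounded ((summable_dyad_neg hβ).mul_left M) fun n => h.norm_le n x

/-- The sum of the dyadic weights `2^{-jβ}`. -/
noncomputable def dyadSum (β : ℝ) : ℝ := (2 : ℝ) ^ β * (1 - (2 : ℝ) ^ (-β))⁻¹

lemma dyadSum_pos {β : ℝ} (hβ : 0 < β) : 0 < dyadSum β := by
  have := two_rpow_neg_lt_one hβ
  have h : 0 < 1 - (2 : ℝ) ^ (-β) := by linarith
  rw [dyadSum]
  positivity

lemma tsum_dyad_neg {β : ℝ} (hβ : 0 < β) : ∑' n, dyad (-β) n = dyadSum β := by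
  have := (hasSum_dyad_neg hβ 0).tsum_eq
  simp only [add_zero] at this
  rw [this, dyadSum, dyad_eq]
  simp

lemma BesovLE.norm_distFun_le {β : ℝ} (hβ : 0 < β) {u : TorusDist} {M : ℝ} (h : BesovLE β u M)
    (x : Torus2) : ‖distFun u x‖ ≤ dyadSum β * M := by
  have := tsum_of_norm_bounded ((summable_dyad_neg hβ).hasSum.mul_left M) fun n => h.norm_le n x
  rw [tsum_dyad_neg hβ] at this
  rw [mul_comm]
  exact this

lemma BesovLE.norm_trig_lowPass_le {β : ℝ} (hβ : 0 < β) {u : TorusDist} {M : ℝ} (h : BesovLE β u M)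
    (N : ℕ) (x : Torus2) : ‖trig (lowPass N u) x‖ ≤ dyadSum β * M := by
  rw [trig_lowPass, ← tsum_dyad_neg hβ, mul_comm, ← tsum_mul_left]
  refine (norm_sum_le_of_le _ fun n _ => h.norm_le n x).trans ?_
  exact ((summable_dyad_neg hβ).mul_left M).sum_le_tsum _ fun n _ =>
    mul_nonneg h.nonneg (dyad_pos _ _).le

lemma tendsto_dyad_neg {β : ℝ} (hβ : 0 < β) : Tendsto (dyad (-β)) atTop (𝓝 0) :=
  (summable_dyad_neg hβ).tendsto_atTop_zero

lemma BesovLE.tendsto_trig_lowPass {β : ℝ} (hβ : 0 < β) {u : TorusDist} {M : ℝ}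
    (h : BesovLE β u M) (x : Torus2) :
    Tendsto (fun N => trig (lowPass N u) x) atTop (𝓝 (distFun u x)) := by
  have := (h.summable_lpBlock hβ x).hasSum.tendsto_sum_nat.comp (tendsto_add_atTop_nat 1)
  refine this.congr fun N => ?_
  simp [trig_lowPass]

lemma distFun_sub {β : ℝ} (hβ : 0 < β) {u v : TorusDist} {M M' : ℝ} (hu : BesovLE β u M)
    (hv : BesovLE β v M') (x : Torus2) : distFun (u - v) x = distFun u x - distFun v x := by
  simp only [distFun, lpBlock_sub]
  exact (hu.summable_lpBlock hβ x).tsum_sub (hv.summable_lpBlock hβ x)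

lemma BesovLE.continuous_distFun {β : ℝ} (hβ : 0 < β) {u : TorusDist} {M : ℝ} (h : BesovLE β u M) :
    Continuous (distFun u) :=
  continuous_tsum (fun n => continuous_trig (finSupp_blk n u)) ((summable_dyad_neg hβ).mul_left M)
    fun n x => h.norm_le n x

/-! Products. -/

lemma mulDist_eq_sum {c : TorusDist} {F : Finset (Fin 2 → ℤ)} (hF : ∀ k ∉ F, c k = 0)
    (d : TorusDist) : mulDist c d = fun k => ∑ l ∈ F, (c l • fun k => d (k - l)) k := by
  ext k
  simp only [mulDist, Pi.smul_apply, smul_eq_mul]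
  exact tsum_eq_sum fun l hl => by simp [hF l hl]

lemma FinSupp.mulDist {c d : TorusDist} (hc : FinSupp c) (hd : FinSupp d) :
    FinSupp (mulDist c d) := by
  obtain ⟨F, hF⟩ := hc.exists_finset
  rw [mulDist_eq_sum hF]
  exact .sum _ fun l _ => (hd.shift l).smul _

lemma trig_mulDist {c d : TorusDist} (hc : FinSupp c) (hd : FinSupp d) (x : Torus2) :
    trig (mulDist c d) x = trig c x * trig d x := by
  obtain ⟨F, hF⟩ := hc.exists_finset
  rw [mulDist_eq_sum hF, trig_sum _ fun l _ => (hd.shift l).smul _, trig_eq_sum hF, Finset.sum_mul]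
  refine Finset.sum_congr rfl fun l _ => ?_
  rw [trig_smul, trig_shift]
  ring

lemma FinSupp.sum_norm_sq_le {c : TorusDist} (hc : FinSupp c) {A : ℝ} (hA : ∀ x, ‖trig c x‖ ≤ A)
    (F : Finset (Fin 2 → ℤ)) : ∑ k ∈ F, ‖c k‖ ^ 2 ≤ A ^ 2 := by
  classical
  obtain ⟨G, hG⟩ := hc.exists_finset
  refine (Finset.sum_le_sum_of_subset_of_nonneg (Finset.subset_union_left (s₂ := G))
    fun _ _ _ => by positivity).trans (_root_.sum_norm_sq_le (fun k hk => hG k fun h => hk ?_) hA)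
  exact Finset.mem_union_right _ h

/-- Cauchy–Schwarz and Parseval. The bound is uniform in the output frequency and in the finite set,
so the convolution of two blocks is absolutely summable with the product of the sup-norm bounds. -/
lemma sum_norm_mul_norm_le {c d : TorusDist} (hc : FinSupp c) (hd : FinSupp d) {A B : ℝ}
    (hA : ∀ x, ‖trig c x‖ ≤ A) (hB : ∀ x, ‖trig d x‖ ≤ B) (k : Fin 2 → ℤ)
    (F : Finset (Fin 2 → ℤ)) : ∑ l ∈ F, ‖c l‖ * ‖d (k - l)‖ ≤ A * B := by
  classical
  have hA0 : 0 ≤ A := (norm_nonneg _).trans (hA 0)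
  have hB0 : 0 ≤ B := (norm_nonneg _).trans (hB 0)
  refine abs_le_of_sq_le_sq' ?_ (by positivity) |>.2
  refine (Finset.sum_mul_sq_le_sq_mul_sq _ _ _).trans ?_
  rw [mul_pow]
  refine mul_le_mul (hc.sum_norm_sq_le hA F) ?_ (by positivity) (by positivity)
  rw [← Finset.sum_image (f := fun m => ‖d m‖ ^ 2) (g := fun l => k - l)
    (fun a _ b _ h => by simpa using h)]
  exact hd.sum_norm_sq_le hB _

lemma freqNorm_add_le (k l : Fin 2 → ℤ) : freqNorm (k + l) ≤ freqNorm k + freqNorm l := by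
  have h : ∀ k : Fin 2 → ℤ, freqNorm k = ‖WithLp.toLp 2 (fun i => (k i : ℝ))‖ := fun k => by
    simp [freqNorm, EuclideanSpace.norm_eq]
  rw [h, h, h]
  refine le_trans (le_of_eq ?_) (norm_add_le _ _)
  congr 1
  ext i
  simp

/-- If $i\ge n+3$ and $i\ge j+3$, the right side is at most $\frac43\cdot2\cdot2^i/8=\frac13 2^i$,
less than $\frac38 2^i$. Of three frequencies in a triangle, the largest is comparable with one of
the other two. -/
lemma dyadic_triangle {p q r : ℝ} {i n j : ℕ} (h : p ≤ q + r) (hp : 1 ≤ i → 3 / 8 * 2 ^ i ≤ p)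
    (hq : q ≤ 4 / 3 * 2 ^ n) (hr : r ≤ 4 / 3 * 2 ^ j) : i ≤ n + 2 ∨ i ≤ j + 2 := by
  by_contra! hlt
  have h1 := hp (by omega)
  have h2 : (2 : ℝ) ^ (n + 3) ≤ 2 ^ i := pow_le_pow_right₀ (by norm_num) (by omega)
  have h3 : (2 : ℝ) ^ (j + 3) ≤ 2 ^ i := pow_le_pow_right₀ (by norm_num) (by omega)
  rw [pow_add] at h2 h3
  have : (0 : ℝ) < 2 ^ i := by positivity
  linarith

lemma high_index_le {i j n : ℕ} {k l : Fin 2 → ℤ} (hk : freqNorm k ≤ 4 / 3 * 2 ^ n)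
    (hi : lpSymbol i l ≠ 0) (hj : lpSymbol j (k - l) ≠ 0) : i ≤ n + 2 ∨ i ≤ j + 2 := by
  refine dyadic_triangle (p := freqNorm l) (q := freqNorm k) (r := freqNorm (k - l)) ?_
    (fun h => le_freqNorm_of_lpSymbol_ne h hi) hk (freqNorm_le_of_lpSymbol_ne hj)
  rw [← freqNorm_neg (k - l)]
  refine le_trans (le_of_eq ?_) (freqNorm_add_le _ _)
  congr 1
  abel

lemma output_index_le {i j n : ℕ} {k l : Fin 2 → ℤ} (hn : lpSymbol n k ≠ 0)
    (hi : lpSymbol i l ≠ 0) (hj : lpSymbol j (k - l) ≠ 0) : n ≤ i + 2 ∨ n ≤ j + 2 := by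
  refine dyadic_triangle (p := freqNorm k) (q := freqNorm l) (r := freqNorm (k - l)) ?_
    (fun h => le_freqNorm_of_lpSymbol_ne h hn) (freqNorm_le_of_lpSymbol_ne hi)
    (freqNorm_le_of_lpSymbol_ne hj)
  refine le_trans (le_of_eq ?_) (freqNorm_add_le _ _)
  congr 1
  abel

lemma exists_freqNorm_le (k : Fin 2 → ℤ) : ∃ n : ℕ, freqNorm k ≤ 4 / 3 * 2 ^ n := by
  obtain ⟨N, hN⟩ := pow_unbounded_of_one_lt (freqNorm k) (by norm_num : (1 : ℝ) < 2)
  exact ⟨N, by linarith [freqNorm_nonneg k]⟩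

theorem exists_lpBlock_bound : ∃ C : ℝ, 0 < C ∧ ∀ (c : TorusDist), FinSupp c →
    ∀ M : ℝ, (∀ x, ‖trig c x‖ ≤ M) → ∀ n x, ‖lpBlock n c x‖ ≤ C * M := by
  obtain ⟨C, hC, h⟩ := exists_lowPass_bound
  refine ⟨2 * C, by linarith, fun c hc M hM n x => ?_⟩
  have hM0 : 0 ≤ M := (norm_nonneg _).trans (hM 0)
  cases n with
  | zero =>
    have := h 1 le_rfl c hc M hM x
    simp only [div_one] at this
    refine le_trans this ?_
    nlinarith
  | succ n =>
    have h1 := h _ (one_le_two_pow' (n + 1)) c hc M hM x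
    have h2 := h _ (one_le_two_pow' n) c hc M hM x
    have e : blk (n + 1) c = (fun k => (lpCutoff (freqNorm k / 2 ^ (n + 1)) : ℂ) * c k)
        - fun k => (lpCutoff (freqNorm k / 2 ^ n) : ℂ) * c k := by
      ext k
      simp only [blk, lpSymbol, Pi.sub_apply]
      push_cast
      ring
    rw [lpBlock_eq_trig, e, trig_sub (hc.mul_left _) (hc.mul_left _)]
    refine (norm_sub_le_of_le h1 h2).trans (le_of_eq (by ring))

/-- Pairs of blocks that can interact with frequencies of size at most `2^n`. -/
def LowOutput (n : ℕ) (p : ℕ × ℕ) : Prop := p.1 ≤ n + 2 ∨ p.1 ≤ p.2 + 2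

/-- Pairs of blocks whose product has a component in the `n`-th block. -/
def BlockOutput (n : ℕ) (p : ℕ × ℕ) : Prop := LowOutput n p ∧ (n ≤ p.1 + 2 ∨ n ≤ p.2 + 2)

open Classical in
/-- Products of distributions are controlled by double sums over blocks. -/
theorem exists_product_bound : ∃ C : ℝ, 0 < C ∧ ∀ (u v : TorusDist) (A B : ℕ → ℝ),
    (∀ i x, ‖lpBlock i u x‖ ≤ A i) → (∀ j x, ‖lpBlock j v x‖ ≤ B j) →
    (∀ n, ∑' p : ℕ × ℕ, (if LowOutput n p then ENNReal.ofReal (A p.1 * B p.2) else 0) ≠ ⊤) →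
    (∀ k, Summable fun l => u l * v (k - l)) ∧
    ∀ n x, ‖lpBlock n (mulDist u v) x‖ₑ ≤ ENNReal.ofReal C *
      ∑' p : ℕ × ℕ, if BlockOutput n p then ENNReal.ofReal (A p.1 * B p.2) else 0 := by
  obtain ⟨C, hC, hblk⟩ := exists_lpBlock_bound
  refine ⟨C, hC, fun u v A B hA hB hfin => ?_⟩
  let f : (Fin 2 → ℤ) → (Fin 2 → ℤ) × (ℕ × ℕ) → ℂ := fun k q =>
    blk q.2.1 u q.1 * blk q.2.2 v (k - q.1)
  have hstep : ∀ k n, freqNorm k ≤ 4 / 3 * 2 ^ n → ∀ p : ℕ × ℕ,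
      ∑' l, ‖f k (l, p)‖ₑ ≤ if LowOutput n p then ENNReal.ofReal (A p.1 * B p.2) else 0 := by
    intro k n hk p
    split_ifs with hp
    · rw [ENNReal.tsum_eq_iSup_sum]
      refine iSup_le fun F => ?_
      simp only [← ofReal_norm]
      rw [← ENNReal.ofReal_sum_of_nonneg fun _ _ => norm_nonneg _]
      refine ENNReal.ofReal_le_ofReal ?_
      simp only [f, norm_mul]
      exact sum_norm_mul_norm_le (finSupp_blk _ _) (finSupp_blk _ _) (hA _) (hB _) k F
    · rw [nonpos_iff_eq_zero, ENNReal.tsum_eq_zero]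
      intro l
      rw [enorm_eq_zero]
      by_contra h0
      have h1 := mul_ne_zero_iff.1 h0
      exact hp (high_index_le hk (lpSymbol_ne_of_blk_ne h1.1) (lpSymbol_ne_of_blk_ne h1.2))
  -- Absolute summability over the frequency and both block indices permits two orders of summation:
  -- over the blocks first it gives the terms of `mulDist u v k`, over the frequency first the
  -- products of blocks.
  have hsum : ∀ k, Summable (f k) := by
    intro k
    obtain ⟨n, hn⟩ := exists_freqNorm_le k
    refine Summable.of_norm (tsum_enorm_ne_top_iff_summable_norm.1 ?_)
    rw [ENNReal.tsum_prod', ENNReal.tsum_comm]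
    exact ne_top_of_le_ne_top (hfin n) (ENNReal.tsum_le_tsum (hstep k n hn))
  have hfib : ∀ k l, HasSum (fun p => f k (l, p)) (u l * v (k - l)) := by
    intro k l
    have h1 : ∀ (w : TorusDist) (m : Fin 2 → ℤ), HasSum (fun i => blk i w m) (w m) := by
      intro w m
      have := (Complex.hasSum_ofReal.2 (hasSum_lpSymbol m)).mul_right (w m)
      simpa [blk] using this
    have h2 : Summable fun p : ℕ × ℕ => blk p.1 u l * blk p.2 v (k - l) := (hsum k).prod_factor l
    exact HasSum.mul (f := fun i => blk i u l) (g := fun j => blk j v (k - l)) (h1 u l)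
      (h1 v (k - l)) h2
  have htot : ∀ k, HasSum (fun l => u l * v (k - l)) (∑' q, f k q) := fun k =>
    (hsum k).hasSum.prod_fiberwise (hfib k)
  have hprod : ∀ k, HasSum (fun p : ℕ × ℕ => mulDist (blk p.1 u) (blk p.2 v) k)
      (mulDist u v k) := by
    intro k
    have h1 : mulDist u v k = ∑' q, f k q := (htot k).tsum_eq
    rw [h1]
    have h2 : HasSum (fun q : (ℕ × ℕ) × (Fin 2 → ℤ) => f k (q.2, q.1)) (∑' q, f k q) :=
      ((Equiv.prodComm (ℕ × ℕ) (Fin 2 → ℤ)).hasSum_iff (f := f k)).2 (hsum k).hasSum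
    have h3 : ∀ p : ℕ × ℕ, HasSum (fun l => f k (l, p)) (mulDist (blk p.1 u) (blk p.2 v) k) := by
      intro p
      have h4 : Summable fun l => f k (l, p) := h2.summable.prod_factor p
      exact h4.hasSum
    exact h2.prod_fiberwise h3
  refine ⟨fun k => (htot k).summable, fun n x => ?_⟩
  obtain ⟨F, hF, -⟩ := card_freqBox_le (L := 4 / 3 * 2 ^ n) (by positivity)
  have hF' : ∀ w : TorusDist, ∀ k ∉ F, blk n w k = 0 := by
    intro w k hk
    by_contra h0
    exact hk (hF k fun l => (abs_coord_le_freqNorm k l).trans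
      (freqNorm_le_of_lpSymbol_ne (lpSymbol_ne_of_blk_ne h0)))
  have hblock : HasSum (fun p : ℕ × ℕ => lpBlock n (mulDist (blk p.1 u) (blk p.2 v)) x)
      (lpBlock n (mulDist u v) x) := by
    simp only [lpBlock_eq_trig, trig_eq_sum (hF' _)]
    refine hasSum_sum fun k _ => ?_
    exact ((hprod k).mul_left _).mul_right _
  rw [← hblock.tsum_eq, ← ENNReal.tsum_mul_left]
  refine enorm_tsum_le_tsum_enorm.trans (ENNReal.tsum_le_tsum fun p => ?_)
  split_ifs with hp
  · rw [← ofReal_norm, ← ENNReal.ofReal_mul hC.le]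
    refine ENNReal.ofReal_le_ofReal (hblk _ ((finSupp_blk _ _).mulDist (finSupp_blk _ _)) _ ?_ n x)
    intro y
    rw [trig_mulDist (finSupp_blk _ _) (finSupp_blk _ _), norm_mul]
    exact mul_le_mul (hA _ _) (hB _ _) (norm_nonneg _) ((norm_nonneg _).trans (hA _ y))
  · have : blk n (mulDist (blk p.1 u) (blk p.2 v)) = 0 := by
      ext k
      by_cases hk : lpSymbol n k = 0
      · simp [blk, hk]
      · have h0 : mulDist (blk p.1 u) (blk p.2 v) k = 0 := by
          rw [mulDist]
          refine (tsum_congr fun l => ?_).trans tsum_zero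
          by_contra h0
          have h1 := mul_ne_zero_iff.1 h0
          have h2 := lpSymbol_ne_of_blk_ne h1.1
          have h3 := lpSymbol_ne_of_blk_ne h1.2
          exact hp ⟨high_index_le (freqNorm_le_of_lpSymbol_ne hk) h2 h3, output_index_le hk h2 h3⟩
        simp [blk, h0]
    rw [lpBlock_eq_trig, this, trig_zero]
    simp

lemma sum_range_dyad_le {α : ℝ} (hα : 0 < α) (m : ℕ) :
    ∑ i ∈ Finset.range (m + 1), dyad α i ≤ (1 - (2 : ℝ) ^ (-α))⁻¹ * dyad α m := by
  have hq := two_rpow_neg_lt_one hα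
  have hq0 : (0 : ℝ) < 2 ^ (-α) := by positivity
  have hG : 0 < 1 - (2 : ℝ) ^ (-α) := by linarith
  induction m with
  | zero =>
    simp only [zero_add, Finset.sum_range_one]
    exact le_mul_of_one_le_left (dyad_pos _ _).le ((one_le_inv₀ hG).2 (by linarith))
  | succ m ih =>
    have e : dyad α m = dyad α (m + 1) * 2 ^ (-α) := by
      rw [dyad_index_add, pow_one, mul_assoc, ← Real.rpow_add (by norm_num)]
      simp
    rw [Finset.sum_range_succ]
    calc _ ≤ (1 - (2 : ℝ) ^ (-α))⁻¹ * dyad α m + dyad α (m + 1) := by gcongr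
      _ = (1 - (2 : ℝ) ^ (-α))⁻¹ * dyad α (m + 1) := by
          rw [e]
          field_simp
          ring

-- For fixed $j$ the indices $i\le\max(n,j)+2$ form a geometric sum of size $2^{\alpha n}+2^{\alpha
-- j}$. Against the weight $2^{-aj}$ both parts are summable in $j$, the second one because
-- $\alpha<a$.
open Classical in
lemma tsum_lowOutput_le {α a M M' : ℝ} (hα : 0 < α) (ha : α < a) (hM : 0 ≤ M) (hM' : 0 ≤ M')
    (n : ℕ) :
    ∑' p : ℕ × ℕ, (if LowOutput n p then
      ENNReal.ofReal (M * dyad α p.1 * (M' * dyad (-a) p.2)) else 0)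
    ≤ ENNReal.ofReal ((1 - (2 : ℝ) ^ (-α))⁻¹ * ((2 : ℝ) ^ α) ^ 2 *
        (dyadSum a + 2 ^ α * dyadSum (a - α)) * (M * M') * dyad α n) := by
  have hG : 0 < 1 - (2 : ℝ) ^ (-α) := by linarith [two_rpow_neg_lt_one hα]
  set G := (1 - (2 : ℝ) ^ (-α))⁻¹ * ((2 : ℝ) ^ α) ^ 2
  have hG0 : 0 < G := by positivity
  have hp := dyad_pos
  have hrow : ∀ j, ∑' i, (if LowOutput n (i, j) then
      ENNReal.ofReal (M * dyad α i * (M' * dyad (-a) j)) else 0)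
      ≤ ENNReal.ofReal (G * (M * M') * (dyad α n * dyad (-a) j + dyad (-(a - α)) j)) := by
    intro j
    rw [tsum_eq_sum (s := Finset.range (max n j + 2 + 1))]
    · calc _ ≤ ∑ i ∈ Finset.range (max n j + 2 + 1),
            ENNReal.ofReal (M * dyad α i * (M' * dyad (-a) j)) := by
            refine Finset.sum_le_sum fun i _ => ?_
            split_ifs <;> simp
        _ = ENNReal.ofReal (∑ i ∈ Finset.range (max n j + 2 + 1),
            M * dyad α i * (M' * dyad (-a) j)) := by
            rw [ENNReal.ofReal_sum_of_nonneg]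
            intro i _
            have := hp α i
            have := hp (-a) j
            positivity
        _ ≤ _ := by
            refine ENNReal.ofReal_le_ofReal ?_
            rw [← Finset.sum_mul, ← Finset.mul_sum]
            have h1 := sum_range_dyad_le hα (max n j + 2)
            rw [dyad_index_add, mul_comm (dyad α _), ← mul_assoc] at h1
            have h2 : dyad α (max n j) ≤ dyad α n + dyad α j := by
              rcases max_choice n j with h | h <;> rw [h] <;> linarith [hp α n, hp α j]
            have h3 : dyad (-(a - α)) j = dyad α j * dyad (-a) j := by
              rw [← dyad_add]; congr 1; ring
            have := hp (-a) j
            calc _ ≤ M * (G * (dyad α n + dyad α j)) * (M' * dyad (-a) j) := by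
                  gcongr
                  exact h1.trans (by gcongr)
              _ = _ := by rw [h3]; ring
    · intro i hi
      rw [if_neg]
      rw [Finset.mem_range] at hi
      simp only [LowOutput, not_or]
      omega
  rw [ENNReal.tsum_prod', ENNReal.tsum_comm]
  refine (ENNReal.tsum_le_tsum hrow).trans ?_
  have hs1 := (summable_dyad_neg (hα.trans ha)).mul_left (dyad α n)
  have hs2 := summable_dyad_neg (sub_pos.2 ha)
  rw [← ENNReal.ofReal_tsum_of_nonneg (fun j => ?_) ((hs1.add hs2).mul_left _)]
  · refine ENNReal.ofReal_le_ofReal ?_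
    rw [tsum_mul_left, hs1.tsum_add hs2, tsum_mul_left, tsum_dyad_neg (hα.trans ha),
      tsum_dyad_neg (sub_pos.2 ha)]
    have h1 : 1 ≤ 2 ^ α * dyad α n := by
      have := dyad_mono hα.le n
      simpa [dyad_zero] using this
    have h2 := dyadSum_pos (sub_pos.2 ha)
    calc _ ≤ G * (M * M') * (dyad α n * dyadSum a + dyadSum (a - α) * (2 ^ α * dyad α n)) := by
          gcongr
          exact le_mul_of_one_le_right h2.le h1
      _ = _ := by ring
  · have := hp (-a) j
    have := hp α n
    have := hp (-(a - α)) j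
    positivity

/-- Multiplication `𝒞^{-α} × 𝒞^a → 𝒞^{-α}` for `0 < α < a`. -/
theorem exists_mulDist_neg {α a : ℝ} (hα : 0 < α) (ha : α < a) : ∃ C : ℝ, 0 < C ∧
    ∀ (u v : TorusDist) (M M' : ℝ), BesovLE (-α) u M → BesovLE a v M' →
      (∀ k, Summable fun l => u l * v (k - l)) ∧ BesovLE (-α) (mulDist u v) (C * (M * M')) := by
  classical
  obtain ⟨C, hC, h⟩ := exists_product_bound
  have hG : 0 < 1 - (2 : ℝ) ^ (-α) := by linarith [two_rpow_neg_lt_one hα]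
  have d1 := dyadSum_pos (hα.trans ha)
  have d2 := dyadSum_pos (sub_pos.2 ha)
  refine ⟨C * ((1 - (2 : ℝ) ^ (-α))⁻¹ * ((2 : ℝ) ^ α) ^ 2 *
    (dyadSum a + 2 ^ α * dyadSum (a - α))), by positivity, fun u v M M' hu hv => ?_⟩
  have hM := hu.nonneg
  have hM' := hv.nonneg
  have hu' := hu.norm_le
  rw [neg_neg] at hu'
  have hle := tsum_lowOutput_le hα ha hM hM'
  obtain ⟨h1, h2⟩ := h u v _ _ hu' hv.norm_le fun n =>
    ne_top_of_le_ne_top ENNReal.ofReal_ne_top (hle n)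
  refine ⟨h1, .of_norm_le fun n x => ?_⟩
  rw [neg_neg]
  have h3 : ‖lpBlock n (mulDist u v) x‖ₑ ≤ ENNReal.ofReal C * ENNReal.ofReal _ :=
    (h2 n x).trans (mul_le_mul_right ((ENNReal.tsum_le_tsum fun p => ?_).trans (hle n)) _)
  · rw [← ENNReal.ofReal_mul hC.le, ← ofReal_norm, ENNReal.ofReal_le_ofReal_iff] at h3
    · refine h3.trans (le_of_eq (by ring))
    · have := dyad_pos α n
      positivity
  · by_cases hp : BlockOutput n p
    · rw [if_pos hp, if_pos hp.1]
    · rw [if_neg hp]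
      exact zero_le

/-- Multiplication `𝒞^{2b} × 𝒞^{2b} → 𝒞^b` for `b > 0`. -/
theorem exists_mulDist_pos {b : ℝ} (hb : 0 < b) : ∃ C : ℝ, 0 < C ∧
    ∀ (u v : TorusDist) (M M' : ℝ), BesovLE (2 * b) u M → BesovLE (2 * b) v M' →
      (∀ k, Summable fun l => u l * v (k - l)) ∧ BesovLE b (mulDist u v) (C * (M * M')) := by
  classical
  obtain ⟨C, hC, h⟩ := exists_product_bound
  have hS := dyadSum_pos hb
  have hp := dyad_pos (-b)
  set K := (2 : ℝ) ^ b * ((2 : ℝ) ^ b) ^ 2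
  have hK : 0 < K := by positivity
  refine ⟨C * (K * dyadSum b ^ 2), by positivity, fun u v M M' hu hv => ?_⟩
  have hM := hu.nonneg
  have hM' := hv.nonneg
  have hsq : ∀ i, dyad (-(2 * b)) i = dyad (-b) i * dyad (-b) i := fun i => by
    rw [← dyad_add]; congr 1; ring
  have hmax : ∀ i, dyad (-b) i ≤ 2 ^ b := by
    intro i
    have := dyad_mono (β := 0) (β' := -b) (by linarith) i
    simpa [dyad_zero] using this
  have hlow : ∀ i n, n ≤ i + 2 → dyad (-b) i ≤ ((2 : ℝ) ^ b) ^ 2 * dyad (-b) n := by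
    intro i n hn
    have h1 : dyad (-b) (i + 2) ≤ dyad (-b) n := by
      have h2 := dyad_le_dyad hb.le hn
      have e := dyad_mul_neg b n
      have e' := dyad_mul_neg b (i + 2)
      have p1 := dyad_pos b n
      have p2 := dyad_pos b (i + 2)
      rw [eq_inv_of_mul_eq_one_right e, eq_inv_of_mul_eq_one_right e']
      exact inv_anti₀ p1 h2
    rw [dyad_index_add, Real.rpow_neg (by norm_num)] at h1
    calc dyad (-b) i = ((2 : ℝ) ^ b) ^ 2 * (dyad (-b) i * ((2 ^ b)⁻¹) ^ 2) := by field_simp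
      _ ≤ _ := by gcongr
  have hsum : ∀ c : ℝ, 0 ≤ c → ∑' p : ℕ × ℕ, ENNReal.ofReal (c * (dyad (-b) p.1 * dyad (-b) p.2))
      = ENNReal.ofReal (c * dyadSum b ^ 2) := by
    intro c hc
    have hs := summable_dyad_neg hb
    have hs2 : Summable fun p : ℕ × ℕ => dyad (-b) p.1 * dyad (-b) p.2 :=
      hs.mul_of_nonneg hs (fun i => (hp i).le) fun i => (hp i).le
    rw [← ENNReal.ofReal_tsum_of_nonneg (fun p => ?_) (hs2.mul_left c), tsum_mul_left,
      ← hs.tsum_mul_tsum hs hs2, tsum_dyad_neg hb, sq]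
    have := hp p.1
    have := hp p.2
    positivity
  -- Each weight $2^{-2bj}$ is split in half. One half is summed over both indices; the other gives
  -- the decay in $n$, because one index of an interacting pair is at least $n-2$.
  have hpt : ∀ p : ℕ × ℕ, M * dyad (-(2 * b)) p.1 * (M' * dyad (-(2 * b)) p.2)
      = M * M' * (dyad (-b) p.1 * dyad (-b) p.2) * (dyad (-b) p.1 * dyad (-b) p.2) := by
    intro p
    rw [hsq, hsq]
    ring
  obtain ⟨h1, h2⟩ := h u v _ _ hu.norm_le hv.norm_le fun n => by
    refine ne_top_of_le_ne_top (b := ENNReal.ofReal (M * M' * (2 ^ b * 2 ^ b) * dyadSum b ^ 2))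
      ENNReal.ofReal_ne_top ?_
    rw [← hsum _ (by positivity)]
    refine ENNReal.tsum_le_tsum fun p => ?_
    split_ifs
    · refine ENNReal.ofReal_le_ofReal ?_
      rw [hpt]
      have p1 := hp p.1
      have p2 := hp p.2
      have := hmax p.1
      have := hmax p.2
      gcongr
    · exact zero_le
  refine ⟨h1, .of_norm_le fun n x => ?_⟩
  have h3 : ‖lpBlock n (mulDist u v) x‖ₑ ≤
      ENNReal.ofReal C * ENNReal.ofReal (K * (M * M') * dyad (-b) n * dyadSum b ^ 2) := by
    refine (h2 n x).trans (mul_le_mul_right ?_ _)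
    have hn := hp n
    rw [← hsum _ (by positivity)]
    refine ENNReal.tsum_le_tsum fun p => ?_
    split_ifs with hB
    · refine ENNReal.ofReal_le_ofReal ?_
      rw [hpt]
      have p1 := hp p.1
      have p2 := hp p.2
      have m1 := hmax p.1
      have m2 := hmax p.2
      have key : dyad (-b) p.1 * dyad (-b) p.2 ≤ K * dyad (-b) n := by
        rcases hB.2 with h | h
        · calc _ ≤ (((2 : ℝ) ^ b) ^ 2 * dyad (-b) n) * 2 ^ b := by
                have := hlow _ _ h
                gcongr
            _ = _ := by ring
        · calc _ ≤ 2 ^ b * (((2 : ℝ) ^ b) ^ 2 * dyad (-b) n) := by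
                have := hlow _ _ h
                gcongr
            _ = _ := by ring
      calc _ ≤ M * M' * (K * dyad (-b) n) * (dyad (-b) p.1 * dyad (-b) p.2) := by gcongr
        _ = _ := by ring
    · exact zero_le
  rw [← ENNReal.ofReal_mul hC.le, ← ofReal_norm, ENNReal.ofReal_le_ofReal_iff] at h3
  · refine h3.trans (le_of_eq (by ring))
  · have := hp n
    positivity

lemma mulDist_sub_left {u u' v : TorusDist} (h : ∀ k, Summable fun l => u l * v (k - l))
    (h' : ∀ k, Summable fun l => u' l * v (k - l)) :
    mulDist (u - u') v = mulDist u v - mulDist u' v := by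
  ext k
  simp only [mulDist, Pi.sub_apply, sub_mul]
  exact (h k).tsum_sub (h' k)

lemma mulDist_sub_right {u v v' : TorusDist} (h : ∀ k, Summable fun l => u l * v (k - l))
    (h' : ∀ k, Summable fun l => u l * v' (k - l)) :
    mulDist u (v - v') = mulDist u v - mulDist u v' := by
  ext k
  simp only [mulDist, Pi.sub_apply, mul_sub]
  exact (h k).tsum_sub (h' k)

/-! ### Bounds and Lipschitz estimates for the nonlinearity. -/

/-- Two distributions of norm at most `K` whose difference has norm at most `K * ε`. -/
structure BesovClose (β : ℝ) (u u' : TorusDist) (K ε : ℝ) : Prop where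
  left : BesovLE β u K
  right : BesovLE β u' K
  diff : BesovLE β (u - u') (K * ε)

lemma BesovClose.nonneg {β : ℝ} {u u' : TorusDist} {K ε : ℝ} (h : BesovClose β u u' K ε) : 0 ≤ K :=
  h.left.nonneg

lemma BesovClose.add {β : ℝ} {u u' v v' : TorusDist} {K L ε : ℝ} (h : BesovClose β u u' K ε)
    (h' : BesovClose β v v' L ε) : BesovClose β (u + v) (u' + v') (K + L) ε := by
  refine ⟨h.left.add h'.left, h.right.add h'.right, ?_⟩
  rw [add_sub_add_comm, add_mul]
  exact h.diff.add h'.diff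

lemma BesovClose.sub {β : ℝ} {u u' v v' : TorusDist} {K L ε : ℝ} (h : BesovClose β u u' K ε)
    (h' : BesovClose β v v' L ε) : BesovClose β (u - v) (u' - v') (K + L) ε := by
  refine ⟨h.left.sub h'.left, h.right.sub h'.right, ?_⟩
  rw [sub_sub_sub_comm, add_mul]
  exact h.diff.sub h'.diff

lemma BesovClose.smul {β : ℝ} {u u' : TorusDist} {K ε : ℝ} (h : BesovClose β u u' K ε) (a : ℂ) :
    BesovClose β (a • u) (a • u') (‖a‖ * K) ε := by
  refine ⟨h.left.smul a, h.right.smul a, ?_⟩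
  rw [← smul_sub, mul_assoc]
  exact h.diff.smul a

lemma conjDist_sub (u v : TorusDist) : conjDist (u - v) = conjDist u - conjDist v := by
  ext k
  simp [conjDist]

lemma BesovClose.conj {β : ℝ} {u u' : TorusDist} {K ε : ℝ} (h : BesovClose β u u' K ε) :
    BesovClose β (conjDist u) (conjDist u') K ε := by
  refine ⟨h.left.conj, h.right.conj, ?_⟩
  rw [← conjDist_sub]
  exact h.diff.conj

lemma BesovClose.exponent_mono {β β' : ℝ} {u u' : TorusDist} {K ε : ℝ}
    (h : BesovClose β u u' K ε) (hβ : β' ≤ β) :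
    BesovClose β' u u' ((2 : ℝ) ^ (β - β') * K) ε := by
  refine ⟨h.left.exponent_mono hβ, h.right.exponent_mono hβ, ?_⟩
  rw [mul_assoc]
  exact h.diff.exponent_mono hβ

lemma BesovClose.mono {β : ℝ} {u u' : TorusDist} {K K' ε : ℝ} (h : BesovClose β u u' K ε)
    (hK : K ≤ K') (hε : 0 ≤ ε) : BesovClose β u u' K' ε :=
  ⟨h.left.mono hK, h.right.mono hK, h.diff.mono (mul_le_mul_of_nonneg_right hK hε)⟩

lemma BesovLE.zero (β : ℝ) {M : ℝ} (hM : 0 ≤ M) : BesovLE β 0 M := fun n x => by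
  have : blk n 0 = 0 := by ext k; simp [blk]
  rw [lpBlock_eq_trig, this, trig_zero]
  simpa using hM

lemma BesovLE.close {β : ℝ} {u : TorusDist} {K : ℝ} (h : BesovLE β u K) : BesovClose β u u K 0 :=
  ⟨h, h, by rw [sub_self, mul_zero]; exact .zero β le_rfl⟩

/-- From $uv-u'v'=(u-u')v+u'(v-v')$: errors measured relative to the size add up, so the same
$\varepsilon$ serves for the product. With $u=u'$, $v=v'$ and $\varepsilon=0$ this is the plain
product bound, so boundedness and Lipschitz continuity of polynomial expressions are proved
together. -/
theorem exists_mulDist_close_neg {α a : ℝ} (hα : 0 < α) (ha : α < a) : ∃ C : ℝ, 0 < C ∧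
    ∀ (u u' v v' : TorusDist) (K L ε : ℝ), BesovClose (-α) u u' K ε → BesovClose a v v' L ε →
      BesovClose (-α) (mulDist u v) (mulDist u' v') (C * (K * L)) ε := by
  obtain ⟨C, hC, h⟩ := exists_mulDist_neg hα ha
  refine ⟨2 * C, by positivity, fun u u' v v' K L ε hu hv => ?_⟩
  have hKL := mul_nonneg hu.nonneg hv.nonneg
  obtain ⟨s1, b1⟩ := h _ _ _ _ hu.left hv.left
  obtain ⟨s2, b2⟩ := h _ _ _ _ hu.right hv.right
  obtain ⟨s3, -⟩ := h _ _ _ _ hu.right hv.left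
  obtain ⟨-, b4⟩ := h _ _ _ _ hu.diff hv.left
  obtain ⟨-, b5⟩ := h _ _ _ _ hu.right hv.diff
  refine ⟨b1.mono (by nlinarith), b2.mono (by nlinarith), ?_⟩
  have : mulDist u v - mulDist u' v' = mulDist (u - u') v + mulDist u' (v - v') := by
    rw [mulDist_sub_left s1 s3, mulDist_sub_right s3 s2]
    abel
  rw [this]
  exact (b4.add b5).mono (le_of_eq (by ring))

theorem exists_mulDist_close_pos {b : ℝ} (hb : 0 < b) : ∃ C : ℝ, 0 < C ∧
    ∀ (u u' v v' : TorusDist) (K L ε : ℝ), BesovClose (2 * b) u u' K ε →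
      BesovClose (2 * b) v v' L ε → BesovClose b (mulDist u v) (mulDist u' v') (C * (K * L)) ε := by
  obtain ⟨C, hC, h⟩ := exists_mulDist_pos hb
  refine ⟨2 * C, by positivity, fun u u' v v' K L ε hu hv => ?_⟩
  have hKL := mul_nonneg hu.nonneg hv.nonneg
  obtain ⟨s1, b1⟩ := h _ _ _ _ hu.left hv.left
  obtain ⟨s2, b2⟩ := h _ _ _ _ hu.right hv.right
  obtain ⟨s3, -⟩ := h _ _ _ _ hu.right hv.left
  obtain ⟨-, b4⟩ := h _ _ _ _ hu.diff hv.left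
  obtain ⟨-, b5⟩ := h _ _ _ _ hu.right hv.diff
  refine ⟨b1.mono (by nlinarith), b2.mono (by nlinarith), ?_⟩
  have : mulDist u v - mulDist u' v' = mulDist (u - u') v + mulDist u' (v - v') := by
    rw [mulDist_sub_left s1 s3, mulDist_sub_right s3 s2]
    abel
  rw [this]
  exact (b4.add b5).mono (le_of_eq (by ring))

/-- The nonlinearity as a function of the five distributions that enter it. -/
noncomputable def psi (ν lam : ℂ) (y z q s w : TorusDist) : TorusDist :=
  (1 + lam) • (z + y) -
    ν • (mulDist (mulDist y (conjDist y)) y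
      + (2 : ℂ) • mulDist z (mulDist y (conjDist y))
      + mulDist (conjDist z) (mulDist y y)
      + (2 : ℂ) • mulDist s y
      + mulDist q (conjDist y)
      + w)

lemma nonlinPsi_eq (ν lam : ℂ) (y : TorusDist) (Z : Driver) (t : ℝ) :
    nonlinPsi ν lam y Z t = psi ν lam y (Z.Z t) (Z.Zsq t) (Z.absZsq t) (Z.absZsqZ t) := rfl

/-- Bookkeeping of the constants in the nonlinearity: everything is nonnegative, and each summand on
the left is a multiple of one of the seven monomials on the right. -/
lemma psi_constant_le {A B C₁ C₂ D D' D'' Ny Nz Nq Ns Nw : ℝ} (hA : 0 ≤ A) (hB : 0 ≤ B)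
    (hC₁ : 0 ≤ C₁) (hC₂ : 0 ≤ C₂) (hD : 0 ≤ D) (hD' : 0 ≤ D') (hD'' : 0 ≤ D'') (hy : 0 ≤ Ny)
    (hz : 0 ≤ Nz) (hq : 0 ≤ Nq) (hs : 0 ≤ Ns) (hw : 0 ≤ Nw) :
    A * (Nz + D' * Ny) + B * (C₁ * (D'' * (C₂ * (Ny * Ny)) * (D * Ny))
      + 2 * (C₁ * (Nz * (C₂ * (Ny * Ny)))) + C₁ * (Nz * (C₂ * (Ny * Ny))) + 2 * (C₁ * (Ns * (D * Ny)))
      + C₁ * (Nq * (D * Ny)) + Nw)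
    ≤ (A * (1 + D') + B * (C₁ * D'' * C₂ * D + 3 * (C₁ * C₂) + 2 * (C₁ * D) + 1))
      * (Nz + Ny + Ny ^ 3 + Nz * Ny ^ 2 + Ns * Ny + Nq * Ny + Nw) := by
  set a := Ny ^ 3
  set b := Nz * Ny ^ 2
  set c := Ns * Ny
  set d := Nq * Ny
  have ha : 0 ≤ a := by positivity
  have hb : 0 ≤ b := by positivity
  have hc : 0 ≤ c := by positivity
  have hd : 0 ≤ d := by positivity
  set e₁ := C₁ * D'' * C₂ * D
  set e₂ := C₁ * C₂
  set e₃ := C₁ * D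
  have he₁ : 0 ≤ e₁ := by positivity
  have he₂ : 0 ≤ e₂ := by positivity
  have he₃ : 0 ≤ e₃ := by positivity
  have k1 : Nz + D' * Ny ≤ (1 + D') * (Nz + Ny + a + b + c + d + Nw) := by
    have h0 : 0 ≤ D' * Nz + Ny + (1 + D') * (a + b + c + d + Nw) := by positivity
    linarith
  have k2 : e₁ * a + 3 * e₂ * b + 2 * e₃ * c + e₃ * d + Nw
      ≤ (e₁ + 3 * e₂ + 2 * e₃ + 1) * (Nz + Ny + a + b + c + d + Nw) := by
    have h0 : 0 ≤ e₁ * (Nz + Ny + b + c + d + Nw) + 3 * e₂ * (Nz + Ny + a + c + d + Nw)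
        + 2 * e₃ * (Nz + Ny + a + b + Nw) + e₃ * d + 2 * e₃ * 0
        + (Nz + Ny + a + b + c + d) := by positivity
    linarith
  have l : C₁ * (D'' * (C₂ * (Ny * Ny)) * (D * Ny)) + 2 * (C₁ * (Nz * (C₂ * (Ny * Ny))))
      + C₁ * (Nz * (C₂ * (Ny * Ny))) + 2 * (C₁ * (Ns * (D * Ny))) + C₁ * (Nq * (D * Ny)) + Nw
      = e₁ * a + 3 * e₂ * b + 2 * e₃ * c + e₃ * d + Nw := by
    simp only [e₁, e₂, e₃, a, b, c, d]
    ring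
  rw [l, add_mul, mul_assoc A, mul_assoc B]
  gcongr

/-- Boundedness and local Lipschitz continuity of the nonlinearity. -/
theorem exists_psi_close {α a : ℝ} (hα : 0 < α) (ha : α < a) (ν lam : ℂ) : ∃ C : ℝ, 0 ≤ C ∧
    ∀ (y y' z z' q q' s s' w w' : TorusDist) (Ny Nz Nq Ns Nw ε : ℝ), 0 ≤ ε →
      BesovClose (2 * a) y y' Ny ε → BesovClose (-α) z z' Nz ε → BesovClose (-α) q q' Nq ε →
      BesovClose (-α) s s' Ns ε → BesovClose (-α) w w' Nw ε →
      BesovClose (-α) (psi ν lam y z q s w) (psi ν lam y' z' q' s' w')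
        (C * (Nz + Ny + Ny ^ 3 + Nz * Ny ^ 2 + Ns * Ny + Nq * Ny + Nw)) ε := by
  have ha0 : 0 < a := hα.trans ha
  obtain ⟨C₁, hC₁, h₁⟩ := exists_mulDist_close_neg hα ha
  obtain ⟨C₂, hC₂, h₂⟩ := exists_mulDist_close_pos ha0
  refine ⟨‖1 + lam‖ * (1 + (2 : ℝ) ^ (2 * a - -α)) + ‖ν‖ * (C₁ * (2 : ℝ) ^ (a - -α) * C₂ *
    (2 : ℝ) ^ (2 * a - a) + 3 * (C₁ * C₂) + 2 * (C₁ * (2 : ℝ) ^ (2 * a - a)) + 1),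
    by positivity, ?_⟩
  intro y y' z z' q q' s s' w w' Ny Nz Nq Ns Nw ε hε hy hz hq hs hw
  have hya := hy.exponent_mono (show a ≤ 2 * a by linarith)
  have hyα := hy.exponent_mono (show -α ≤ 2 * a by linarith)
  -- Quadratic expressions in $y\in\mathcal C^{2a}$ lie in $\mathcal C^a$. Since $a>\alpha$, this is
  -- still enough to multiply them by elements of $\mathcal C^{-\alpha}$; the cubic term is treated
  -- in the same way after lowering $|y|^2$ to $\mathcal C^{-\alpha}$.
  have hyy := h₂ _ _ _ _ _ _ _ hy hy
  have hyyc := h₂ _ _ _ _ _ _ _ hy hy.conj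
  have t0 := (hz.add hyα).smul (1 + lam)
  have t1 := h₁ _ _ _ _ _ _ _ (hyyc.exponent_mono (show -α ≤ a by linarith)) hya
  have t2 := (h₁ _ _ _ _ _ _ _ hz hyyc).smul 2
  have t3 := h₁ _ _ _ _ _ _ _ hz.conj hyy
  have t4 := (h₁ _ _ _ _ _ _ _ hs hya).smul 2
  have t5 := h₁ _ _ _ _ _ _ _ hq hya.conj
  refine (t0.sub ((((((t1.add t2).add t3).add t4).add t5).add hw).smul ν)).mono ?_ hε
  simp only [Complex.norm_ofNat]
  exact psi_constant_le (norm_nonneg _) (norm_nonneg _) hC₁.le hC₂.le (by positivity)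
    (by positivity) (by positivity) hy.nonneg hz.nonneg hq.nonneg hs.nonneg hw.nonneg

/-! Continuity in time. -/

lemma besovContinuousOn_iff {β : ℝ} {U : ℝ → TorusDist} {S : Set ℝ} :
    BesovContinuousOn β U S ↔ ∀ t ∈ S, besovNorm β (U t) < ⊤ ∧
      ∀ ε : ℝ, 0 < ε → ∀ᶠ s in 𝓝[S] t, BesovLE β (U s - U t) ε := by
  refine forall₂_congr fun t _ => and_congr_right fun _ => ?_
  rw [ENNReal.tendsto_nhds_zero]
  constructor
  · intro h ε hε
    filter_upwards [h (ENNReal.ofReal ε) (ENNReal.ofReal_pos.2 hε)] with s hs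
    exact (besovNorm_le_iff hε.le).1 hs
  · intro h ε hε
    rcases eq_or_ne ε ⊤ with rfl | hne
    · exact .of_forall fun _ => le_top
    · filter_upwards [h ε.toReal (ENNReal.toReal_pos hε.ne' hne)] with s hs
      have := (besovNorm_le_iff ENNReal.toReal_nonneg).2 hs
      rwa [ENNReal.ofReal_toReal hne] at this

lemma BesovContinuousOn.mono {β : ℝ} {U : ℝ → TorusDist} {S S' : Set ℝ}
    (h : BesovContinuousOn β U S) (hS : S' ⊆ S) : BesovContinuousOn β U S' := fun t ht =>
  ⟨(h t (hS ht)).1, (h t (hS ht)).2.mono_left (nhdsWithin_mono t hS)⟩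

lemma BesovContinuousOn.exponent_mono {β β' : ℝ} {U : ℝ → TorusDist} {S : Set ℝ}
    (h : BesovContinuousOn β U S) (hβ : β' ≤ β) : BesovContinuousOn β' U S := by
  rw [besovContinuousOn_iff] at h ⊢
  refine fun t ht => ⟨((besovLE_toReal (h t ht).1).exponent_mono hβ).lt_top, fun ε hε => ?_⟩
  have hp : (0 : ℝ) < 2 ^ (β - β') := by positivity
  filter_upwards [(h t ht).2 (ε / 2 ^ (β - β')) (by positivity)] with s hs
  have := hs.exponent_mono hβ
  rwa [mul_div_cancel₀ _ hp.ne'] at this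

/-- The size $K$ is chosen before $\varepsilon$; this order is what allows Lipschitz bounds to be
turned into continuity in time. -/
lemma BesovContinuousOn.eventually_close {β : ℝ} {U : ℝ → TorusDist} {S : Set ℝ}
    (h : BesovContinuousOn β U S) {t : ℝ} (ht : t ∈ S) : ∃ K : ℝ, ∀ ε : ℝ, 0 < ε → ε ≤ 1 →
      ∀ᶠ s in 𝓝[S] t, BesovClose β (U s) (U t) K ε := by
  rw [besovContinuousOn_iff] at h
  obtain ⟨h1, h2⟩ := h t ht
  have h3 := besovLE_toReal h1
  have h0 := h3.nonneg
  refine ⟨(besovNorm β (U t)).toReal + 1, fun ε hε hε1 => ?_⟩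
  filter_upwards [h2 ε hε] with s hs
  refine ⟨?_, h3.mono (by linarith), hs.mono (by nlinarith)⟩
  have := (hs.add h3).mono (show ε + (besovNorm β (U t)).toReal ≤ (besovNorm β (U t)).toReal + 1 by
    linarith)
  simpa using this

lemma BesovContinuousOn.continuousOn_coeff {β : ℝ} {U : ℝ → TorusDist} {S : Set ℝ}
    (h : BesovContinuousOn β U S) (k : Fin 2 → ℤ) : ContinuousOn (fun s => U s k) S := by
  rw [besovContinuousOn_iff] at h
  intro t ht
  obtain ⟨C, hC, hk⟩ := exists_coeff_bound β k
  refine Metric.tendsto_nhds.2 fun ε hε => ?_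
  filter_upwards [(h t ht).2 (ε / (C + 1)) (by positivity)] with s hs
  rw [dist_eq_norm]
  have h1 := hk _ _ hs
  refine lt_of_le_of_lt h1 ?_
  rw [mul_div_assoc', div_lt_iff₀ (by positivity)]
  nlinarith

/-- Composition with a locally Lipschitz nonlinearity preserves continuity in time. -/
lemma BesovContinuousOn.nonlinPsi {α a : ℝ} (hα : 0 < α) (ha : α < a) (ν lam : ℂ) {Z : Driver}
    (hZ : IsAdmissibleDriver Z) {Y : ℝ → TorusDist} {T : ℝ}
    (hY : BesovContinuousOn (2 * a) Y (Ioc 0 T)) :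
    BesovContinuousOn (-α) (fun s => nonlinPsi ν lam (Y s) Z s) (Ioc 0 T) := by
  obtain ⟨C, hC, h⟩ := exists_psi_close hα ha ν lam
  obtain ⟨z1, z2, z3, z4, -⟩ := hZ α hα
  have s1 : Ioc 0 T ⊆ Ici 0 := fun x hx => hx.1.le
  have s2 : Ioc 0 T ⊆ Ioi 0 := fun x hx => hx.1
  rw [besovContinuousOn_iff]
  intro t ht
  obtain ⟨K0, h0⟩ := hY.eventually_close ht
  obtain ⟨K1, h1⟩ := (z1.mono s1).eventually_close ht
  obtain ⟨K2, h2⟩ := (z2.mono s2).eventually_close ht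
  obtain ⟨K3, h3⟩ := (z3.mono s2).eventually_close ht
  obtain ⟨K4, h4⟩ := (z4.mono s2).eventually_close ht
  set K := C * (K1 + K0 + K0 ^ 3 + K1 * K0 ^ 2 + K3 * K0 + K2 * K0 + K4)
  have key : ∀ ε : ℝ, 0 < ε → ε ≤ 1 → ∀ᶠ s in 𝓝[Ioc 0 T] t,
      BesovClose (-α) (_root_.nonlinPsi ν lam (Y s) Z s) (_root_.nonlinPsi ν lam (Y t) Z t) K ε := by
    intro ε hε hε1
    filter_upwards [h0 ε hε hε1, h1 ε hε hε1, h2 ε hε hε1, h3 ε hε hε1, h4 ε hε hε1]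
      with s a0 a1 a2 a3 a4
    exact h _ _ _ _ _ _ _ _ _ _ _ _ _ _ _ _ hε.le a0 a1 a2 a3 a4
  have hself : BesovClose (-α) (_root_.nonlinPsi ν lam (Y t) Z t) (_root_.nonlinPsi ν lam (Y t) Z t) K 1 :=
    (key 1 one_pos le_rfl).self_of_nhdsWithin ht
  have hK := hself.nonneg
  refine ⟨hself.left.lt_top, fun ε hε => ?_⟩
  filter_upwards [key (min 1 (ε / (K + 1))) (lt_min one_pos (by positivity)) (min_le_left _ _)]
    with s hs
  refine hs.diff.mono ?_
  calc K * min 1 (ε / (K + 1)) ≤ K * (ε / (K + 1)) := by gcongr; exact min_le_right _ _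
    _ ≤ ε := by rw [mul_div_assoc', div_le_iff₀ (by positivity)]; nlinarith

/-! Smoothing. -/

lemma blk_semigroupA (μ t : ℝ) (n : ℕ) (u : TorusDist) :
    blk n (semigroupA μ t u) = semigroupA μ t (blk n u) := by
  ext k; simp only [blk, semigroupA]; ring

lemma one_div_one_add_le {X θ : ℝ} (hX : 0 < X) (h0 : 0 ≤ θ) (h1 : θ ≤ 1) :
    1 / (1 + X) ≤ X ^ (-θ) := by
  rw [Real.rpow_neg hX.le, ← one_div]
  refine one_div_le_one_div_of_le (by positivity) ?_
  rcases le_total X 1 with h | h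
  · linarith [Real.rpow_le_one hX.le h h0]
  · have := Real.rpow_le_rpow_of_exponent_le h h1
    rw [Real.rpow_one] at this
    linarith

/-- Parabolic smoothing in Besov spaces. -/
theorem exists_semigroup_smoothing {μ : ℝ} (hμ : 0 < μ) {α β T : ℝ} (h0 : 0 ≤ β + α)
    (h2 : β + α ≤ 2) (hT : 0 < T) : ∃ C : ℝ, 0 < C ∧ ∀ (u : TorusDist) (M : ℝ), BesovLE (-α) u M →
      ∀ t ∈ Ioc 0 T, BesovLE β (semigroupA μ t u) (C * t ^ (-((β + α) / 2)) * M) := by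
  obtain ⟨C, hC, h⟩ := exists_semigroup_bound hμ
  set θ := (β + α) / 2
  have hθ0 : 0 ≤ θ := by positivity
  have hθ1 : θ ≤ 1 := by simp only [θ]; linarith
  refine ⟨C + 16 * T ^ θ, by positivity, fun u M hu t ht => .of_norm_le fun n x => ?_⟩
  have hM := hu.nonneg
  have ht0 : 0 < t := ht.1
  have hle := hu.norm_le n
  rw [neg_neg] at hle
  have hd : dyad α n = dyad (-β) n * dyad (β + α) n := by rw [← dyad_add]; congr 1; ring
  rw [lpBlock_eq_trig, blk_semigroupA]
  have hp := dyad_pos (-β) n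
  have hpa := dyad_pos α n
  -- The lowest block is not smoothed; on a bounded time interval it is covered by $1\le T^\theta
  -- t^{-\theta}$. For the other blocks $1/(1+X)\le X^{-\theta}$ with $X=t4^n$ trades time for
  -- derivatives.
  rcases Nat.eq_zero_or_pos n with rfl | hn
  · have h1 := norm_trig_semigroup_low_le hμ (c := blk 0 u) (fun k hk => by
      simpa using freqNorm_le_of_lpSymbol_ne (lpSymbol_ne_of_blk_ne hk)) hle ht0.le x
    have e : dyad (β + α) 0 ≤ 1 := by
      rw [dyad_eq, pow_zero, mul_one]
      exact Real.rpow_le_one_of_one_le_of_nonpos (by norm_num) (by linarith)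
    have e1 : 1 ≤ T ^ θ * t ^ (-θ) := by
      rw [Real.rpow_neg ht0.le, ← div_eq_mul_inv, one_le_div (by positivity)]
      exact Real.rpow_le_rpow ht0.le ht.2 hθ0
    calc _ ≤ 16 * (M * dyad α 0) := h1
      _ = 16 * M * dyad (-β) 0 * dyad (β + α) 0 * 1 := by rw [hd]; ring
      _ ≤ 16 * M * dyad (-β) 0 * 1 * (T ^ θ * t ^ (-θ)) := by gcongr
      _ = 16 * T ^ θ * (t ^ (-θ) * M * dyad (-β) 0) := by ring
      _ ≤ (C + 16 * T ^ θ) * (t ^ (-θ) * M * dyad (-β) 0) := by gcongr; linarith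
      _ = _ := by ring
  · have h1 := h _ (one_le_two_pow' n) _ (finSupp_blk n u) (fun k hk =>
      ⟨le_freqNorm_of_lpSymbol_ne hn (lpSymbol_ne_of_blk_ne hk),
        freqNorm_le_of_lpSymbol_ne (lpSymbol_ne_of_blk_ne hk)⟩) _ hle t ht0.le x
    have e1 := one_div_one_add_le (X := t * (2 ^ n) ^ 2) (by positivity) hθ0 hθ1
    rw [Real.mul_rpow ht0.le (by positivity)] at e1
    have e2 : (((2 : ℝ) ^ n) ^ 2) ^ (-θ) * dyad (β + α) n ≤ 1 := by
      rw [← pow_mul, ← Real.rpow_natCast, ← Real.rpow_mul (by norm_num), dyad,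
        ← Real.rpow_add (by norm_num)]
      refine Real.rpow_le_one_of_one_le_of_nonpos (by norm_num) ?_
      push_cast
      simp only [θ]
      linarith
    calc _ ≤ C / (1 + t * (2 ^ n) ^ 2) * (M * dyad α n) := h1
      _ = C * (1 / (1 + t * (2 ^ n) ^ 2)) * (M * dyad α n) := by ring
      _ ≤ C * (t ^ (-θ) * (((2 : ℝ) ^ n) ^ 2) ^ (-θ)) * (M * dyad α n) := by gcongr
      _ = C * (t ^ (-θ) * M * dyad (-β) n) * ((((2 : ℝ) ^ n) ^ 2) ^ (-θ) * dyad (β + α) n) := by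
          rw [hd]; ring
      _ ≤ (C + 16 * T ^ θ) * (t ^ (-θ) * M * dyad (-β) n) * 1 := by
          have : 0 ≤ T ^ θ := by positivity
          have := dyad_pos (β + α) n
          gcongr
          linarith
      _ = _ := by ring

lemma besovLE_of_ofReal_mul_le {β : ℝ} {u : TorusDist} {a K : ℝ} (ha : 0 < a) (hK : 0 ≤ K)
    (h : ENNReal.ofReal a * besovNorm β u ≤ ENNReal.ofReal K) : BesovLE β u (K * a⁻¹) := by
  rw [← besovNorm_le_iff (by positivity), ENNReal.ofReal_mul hK, ENNReal.ofReal_inv_of_pos ha,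
    ← div_eq_mul_inv]
  rw [ENNReal.le_div_iff_mul_le (.inl (ENNReal.ofReal_pos.2 ha).ne') (.inl ENNReal.ofReal_ne_top),
    mul_comm]
  exact h

lemma IsAdmissibleDriver.driverNorm_lt_top {Z : Driver} (hZ : IsAdmissibleDriver Z) {α : ℝ}
    (hα : 0 < α) {t : ℝ} (ht : 0 < t) : driverNorm α Z t < ⊤ := by
  obtain ⟨-, -, -, -, h⟩ := hZ α hα
  have h1 : driverNorm α Z t ≤ ⨆ s ∈ Ioc 0 t, driverNorm α Z s :=
    le_iSup₂ (f := fun s (_ : s ∈ Ioc 0 t) => driverNorm α Z s) t ⟨ht, le_rfl⟩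
  exact h1.trans_lt (h t ht)

lemma driver_components {Z : Driver} {α t K : ℝ} (ht : 0 < t) (hK : 0 ≤ K)
    (h : driverNorm α Z t ≤ ENNReal.ofReal K) :
    BesovLE (-α) (Z.Z t) K ∧ BesovLE (-α) (Z.Zsq t) (K * t ^ (-α)) ∧
      BesovLE (-α) (Z.absZsq t) (K * t ^ (-α)) ∧ BesovLE (-α) (Z.absZsqZ t) (K * t ^ (-α)) := by
  have hp : 0 < t ^ α := Real.rpow_pos_of_pos ht _
  simp only [driverNorm, max_le_iff] at h
  rw [Real.rpow_neg ht.le]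
  exact ⟨(besovNorm_le_iff hK).1 h.1, besovLE_of_ofReal_mul_le hp hK h.2.1,
    besovLE_of_ofReal_mul_le hp hK h.2.2.1, besovLE_of_ofReal_mul_le hp hK h.2.2.2⟩

lemma IsAdmissibleDriver.exists_bound {Z : Driver} (hZ : IsAdmissibleDriver Z) {α T : ℝ}
    (hα : 0 < α) (hT : 0 < T) : ∃ K : ℝ, 0 ≤ K ∧ ∀ t ∈ Ioc 0 T,
      driverNorm α Z t ≤ ENNReal.ofReal K := by
  obtain ⟨-, -, -, -, h⟩ := hZ α hα
  refine ⟨(⨆ t ∈ Ioc 0 T, driverNorm α Z t).toReal, ENNReal.toReal_nonneg, fun t ht => ?_⟩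
  rw [ENNReal.ofReal_toReal (h T hT).ne]
  exact le_iSup₂ (f := fun t (_ : t ∈ Ioc 0 T) => driverNorm α Z t) t ht

lemma rpow_neg_le_rpow_neg {s T e η : ℝ} (hs : 0 < s) (hsT : s ≤ T) (he0 : 0 ≤ e) (he : e ≤ η) :
    s ^ (-e) ≤ max 1 T ^ η * s ^ (-η) := by
  have h1 : s ^ (-e) = s ^ (η - e) * s ^ (-η) := by rw [← Real.rpow_add hs]; congr 1; ring
  rw [h1]
  gcongr
  calc s ^ (η - e) ≤ max 1 T ^ (η - e) :=
        Real.rpow_le_rpow hs.le (hsT.trans (le_max_right _ _)) (by linarith)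
    _ ≤ max 1 T ^ η := Real.rpow_le_rpow_of_exponent_le (le_max_left _ _) (by linarith)

/-- The data of a solution that the regularity theory uses: bounds on the forcing term. -/
lemma exists_forcing_bound {ν lam : ℂ} {Z : Driver} (hZ : IsAdmissibleDriver Z)
    {Y : ℝ → TorusDist} {T a γ : ℝ} (hT : 0 < T) (hγ : 0 < γ) (hγ' : γ < 1 / 3)
    {K : ℝ} (hY : ∀ t ∈ Ioc 0 T, BesovLE (2 * a) (Y t) (K * t ^ (-γ))) {α : ℝ} (hα : 0 < α)
    (hαa : α < a) (hα4 : α ≤ 1 / 4) :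
    ∃ P η : ℝ, 0 ≤ P ∧ 0 < η ∧ η < 1 ∧
      ∀ s ∈ Ioc 0 T, BesovLE (-α) (nonlinPsi ν lam (Y s) Z s) (P * s ^ (-η)) := by
  obtain ⟨C, hC, h⟩ := exists_psi_close hα hαa ν lam
  obtain ⟨K', hK', hd⟩ := hZ.exists_bound hα hT
  -- The cubic term is as singular as $s^{-3\gamma}$, integrable because $\gamma<\frac13$. The value
  -- $\frac23$ covers the terms with a driver entry, where the exponent is at most
  -- $\alpha+\gamma<\frac14+\frac13$, and also $s^{-2\gamma}$.
  set η := max (3 * γ) (2 / 3)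
  have hη1 : 3 * γ ≤ η := le_max_left _ _
  have hη2 : 2 / 3 ≤ η := le_max_right _ _
  have hη3 : η < 1 := max_lt (by linarith) (by norm_num)
  set D := max 1 T ^ η
  have hD : 0 < D := Real.rpow_pos_of_pos (lt_max_of_lt_left one_pos) _
  have hK : 0 ≤ K := by
    have h1 := (hY T ⟨hT, le_rfl⟩).nonneg
    exact nonneg_of_mul_nonneg_left h1 (Real.rpow_pos_of_pos hT _)
  refine ⟨C * (K' + K + K ^ 3 + K' * K ^ 2 + K' * K + K' * K + K') * D, η, by positivity,
    by linarith, hη3, fun s hs => ?_⟩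
  have hs0 : 0 < s := hs.1
  obtain ⟨d1, d2, d3, d4⟩ := driver_components hs0 hK' (hd s hs)
  have key := (h _ _ _ _ _ _ _ _ _ _ _ _ _ _ _ 0 le_rfl (hY s hs).close d1.close d2.close d3.close
    d4.close).left
  rw [nonlinPsi_eq]
  refine key.mono ?_
  have e : ∀ e : ℝ, 0 ≤ e → e ≤ η → s ^ (-e) ≤ D * s ^ (-η) := fun e h0 h1 =>
    rpow_neg_le_rpow_neg hs0 hs.2 h0 h1
  have e0 : 1 ≤ D * s ^ (-η) := by simpa using e 0 le_rfl (by linarith)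
  have e1 := e γ hγ.le (by linarith)
  have e2 : (s ^ (-γ)) ^ 3 ≤ D * s ^ (-η) := by
    rw [← Real.rpow_natCast, ← Real.rpow_mul hs0.le]
    have := e (3 * γ) (by positivity) hη1
    convert this using 2
    push_cast
    ring
  have e3 : (s ^ (-γ)) ^ 2 ≤ D * s ^ (-η) := by
    rw [← Real.rpow_natCast, ← Real.rpow_mul hs0.le]
    have := e (2 * γ) (by positivity) (by linarith)
    convert this using 2
    push_cast
    ring
  have e4 : s ^ (-α) * s ^ (-γ) ≤ D * s ^ (-η) := by
    rw [← Real.rpow_add hs0]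
    have := e (α + γ) (by positivity) (by linarith)
    convert this using 2
    ring
  have e5 := e α hα.le (by linarith)
  set X := D * s ^ (-η)
  calc _ = C * (K' * 1 + K * s ^ (-γ) + K ^ 3 * (s ^ (-γ)) ^ 3 + K' * K ^ 2 * (s ^ (-γ)) ^ 2
        + K' * K * (s ^ (-α) * s ^ (-γ)) + K' * K * (s ^ (-α) * s ^ (-γ)) + K' * s ^ (-α)) := by ring
    _ ≤ C * (K' * X + K * X + K ^ 3 * X + K' * K ^ 2 * X + K' * K * X + K' * K * X + K' * X) := by
        gcongr
    _ = _ := by simp only [X]; ring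

lemma norm_semigroup_factor_le {μ : ℝ} (hμ : 0 < μ) {t : ℝ} (ht : 0 ≤ t) (k : Fin 2 → ℤ) :
    ‖Complex.exp (-(t : ℂ) * (1 + (Complex.I + μ) * ((4 * Real.pi ^ 2 * freqNorm k ^ 2 : ℝ) : ℂ)))‖
      ≤ 1 := by
  rw [Complex.norm_exp]
  refine Real.exp_le_one_iff.2 ?_
  have : (-(t : ℂ) * (1 + (Complex.I + μ) * ((4 * Real.pi ^ 2 * freqNorm k ^ 2 : ℝ) : ℂ))).re
      = -(t * (1 + μ * (4 * Real.pi ^ 2 * freqNorm k ^ 2))) := by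
    rw [← Complex.ofReal_neg, Complex.re_ofReal_mul, Complex.add_re, Complex.re_mul_ofReal]
    simp
  rw [this]
  have : 0 ≤ t * (1 + μ * (4 * Real.pi ^ 2 * freqNorm k ^ 2)) := by positivity
  linarith

lemma intervalIntegrable_of_rpow_bound {f : ℝ → ℂ} {t P η : ℝ} (ht : 0 ≤ t) (hη : η < 1)
    (hf : ContinuousOn f (Ioc 0 t)) (hb : ∀ s ∈ Ioc 0 t, ‖f s‖ ≤ P * s ^ (-η)) :
    IntervalIntegrable f volume 0 t := by
  have hi : IntervalIntegrable (fun s : ℝ => P * s ^ (-η)) volume 0 t :=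
    (intervalIntegral.intervalIntegrable_rpow' (by linarith)).const_mul P
  refine hi.mono_fun ?_ ?_
  · rw [uIoc_of_le ht]
    exact hf.aestronglyMeasurable measurableSet_Ioc
  · rw [uIoc_of_le ht]
    filter_upwards [ae_restrict_mem measurableSet_Ioc] with s hs
    exact (hb s hs).trans (le_abs_self _)

/-- On each half of $[0,t]$ only one of the two factors is singular, and the other is bounded by its
value at $t/2$. -/
lemma rpow_mul_rpow_le {s t θ η : ℝ} (hs : 0 < s) (hst : s < t) (hθ : 0 ≤ θ) (hη : 0 ≤ η) :
    (t - s) ^ (-θ) * s ^ (-η) ≤ (t / 2) ^ (-θ) * s ^ (-η) + (t / 2) ^ (-η) * (t - s) ^ (-θ) := by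
  have ht : 0 < t / 2 := by linarith
  have h1 : 0 < (t - s) ^ (-θ) := Real.rpow_pos_of_pos (by linarith) _
  have h2 : 0 < s ^ (-η) := Real.rpow_pos_of_pos hs _
  have h3 : 0 < (t / 2) ^ (-θ) := Real.rpow_pos_of_pos ht _
  have h4 : 0 < (t / 2) ^ (-η) := Real.rpow_pos_of_pos ht _
  rcases le_total s (t / 2) with h | h
  · have : (t - s) ^ (-θ) ≤ (t / 2) ^ (-θ) :=
      Real.rpow_le_rpow_of_nonpos ht (by linarith) (by linarith)
    have := mul_le_mul_of_nonneg_right this h2.le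
    have := mul_pos h4 h1
    linarith
  · have : s ^ (-η) ≤ (t / 2) ^ (-η) := Real.rpow_le_rpow_of_nonpos ht h (by linarith)
    have := mul_le_mul_of_nonneg_left this h1.le
    have := mul_pos h3 h2
    linarith

/-- Block-wise Duhamel estimate for mild solutions. -/
theorem exists_besov_bound_of_mild {μ : ℝ} (hμ : 0 < μ) {T : ℝ} (hT : 0 < T) {Y₀ : TorusDist}
    {α₀ : ℝ} (hα₀ : 0 < α₀) (hα₀' : α₀ < 2 / 3) (hY₀ : besovNorm (-α₀) Y₀ < ⊤)
    {Ψ Y : ℝ → TorusDist} {α P η : ℝ} (hα : 0 < α) (hα4 : α ≤ 1 / 4) (hη0 : 0 < η)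
    (hη : η < 1) (hΨ : ∀ s ∈ Ioc 0 T, BesovLE (-α) (Ψ s) (P * s ^ (-η)))
    (hΨc : ∀ k, ContinuousOn (fun s => Ψ s k) (Ioc 0 T))
    (hmild : ∀ t ∈ Ioc 0 T, ∀ k, Y t k = semigroupA μ t Y₀ k
      + ∫ s in (0 : ℝ)..t, semigroupA μ (t - s) (Ψ s) k) {ε : ℝ} (hε : 0 < ε) :
    ∃ M : ℝ, ∀ t ∈ Icc ε T, BesovLE (5 / 4) (Y t) M := by
  -- The target $\frac54$ exceeds one, as the gradient requires, and is within reach of a single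
  -- step: $\frac54+\alpha_0\le2$ for the initial value, and $\theta=(\frac54+\alpha)/2\le\frac34$
  -- keeps the singularity $(t-s)^{-\theta}$ integrable.
  obtain ⟨C₀, hC₀, h₀⟩ := exists_semigroup_smoothing hμ (α := α₀) (β := 5 / 4) (T := T)
    (by linarith) (by linarith) hT
  obtain ⟨C, hC, h⟩ := exists_semigroup_smoothing hμ (α := α) (β := 5 / 4) (T := T)
    (by linarith) (by linarith) hT
  set θ₀ := (5 / 4 + α₀) / 2
  set θ := (5 / 4 + α) / 2
  have hθ₀ : 0 < θ₀ := by positivity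
  have hθ : 0 < θ := by positivity
  have hθ1 : θ < 1 := by simp only [θ]; linarith
  have hu := besovLE_toReal hY₀
  set M₀ := (besovNorm (-α₀) Y₀).toReal
  have hM₀ := hu.nonneg
  have hP : 0 ≤ P := nonneg_of_mul_nonneg_left (hΨ T ⟨hT, le_rfl⟩).nonneg (Real.rpow_pos_of_pos hT _)
  refine ⟨C₀ * ε ^ (-θ₀) * M₀ + C * P * ((ε / 2) ^ (-θ) * (T ^ (1 - η) / (1 - η))
    + (ε / 2) ^ (-η) * (T ^ (1 - θ) / (1 - θ))), fun t ht => .of_norm_le fun n x => ?_⟩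
  have ht0 : 0 < t := hε.trans_le ht.1
  have htT : t ∈ Ioc 0 T := ⟨ht0, ht.2⟩
  obtain ⟨F, hF, -⟩ := card_freqBox_le (L := 4 / 3 * 2 ^ n) (by positivity)
  have hF' : ∀ w : TorusDist, ∀ k ∉ F, blk n w k = 0 := by
    intro w k hk
    by_contra h0
    exact hk (hF k fun l => (abs_coord_le_freqNorm k l).trans
      (freqNorm_le_of_lpSymbol_ne (lpSymbol_ne_of_blk_ne h0)))
  have hint : ∀ k, IntervalIntegrable (fun s => semigroupA μ (t - s) (Ψ s) k) volume 0 t := by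
    intro k
    obtain ⟨B, hB, hk⟩ := exists_coeff_bound (-α) k
    refine intervalIntegrable_of_rpow_bound (P := B * P) ht0.le hη ?_ fun s hs => ?_
    · simp only [semigroupA]
      refine ContinuousOn.mul (Continuous.continuousOn (by fun_prop))
        ((hΨc k).mono (Ioc_subset_Ioc_right ht.2))
    · simp only [semigroupA, norm_mul]
      have h1 := norm_semigroup_factor_le hμ (sub_nonneg.2 hs.2) k
      have h2 := hk _ _ (hΨ s ⟨hs.1, hs.2.trans ht.2⟩)
      exact ((mul_le_of_le_one_left (norm_nonneg _) h1).trans h2).trans (le_of_eq (by ring))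
  -- The mild equation is known coefficient by coefficient; a block involves only finitely many
  -- coefficients, so it passes under the time integral.
  have hblock : lpBlock n (Y t) x = lpBlock n (semigroupA μ t Y₀) x
      + ∫ s in (0 : ℝ)..t, lpBlock n (semigroupA μ (t - s) (Ψ s)) x := by
    simp only [lpBlock_eq_trig, trig_eq_sum (hF' _)]
    rw [intervalIntegral.integral_finsetSum]
    · rw [← Finset.sum_add_distrib]
      refine Finset.sum_congr rfl fun k _ => ?_
      simp only [blk]
      rw [intervalIntegral.integral_mul_const, intervalIntegral.integral_const_mul, hmild t htT k]
      ring
    · intro k _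
      exact ((hint k).const_mul _).mul_const _
  set d := dyad (-(5 / 4)) n
  have hd : 0 < d := dyad_pos _ _
  have i1 : IntervalIntegrable (fun s : ℝ => (t / 2) ^ (-θ) * s ^ (-η)) volume 0 t :=
    (intervalIntegral.intervalIntegrable_rpow' (by linarith)).const_mul _
  have i2 : IntervalIntegrable (fun s : ℝ => (t / 2) ^ (-η) * (t - s) ^ (-θ)) volume 0 t := by
    have := (intervalIntegral.intervalIntegrable_rpow' (a := t) (b := 0) (r := -θ)
      (by linarith)).comp_sub_left t
    simp only [sub_self, sub_zero] at this
    exact this.const_mul _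
  have hbound : ‖∫ s in (0 : ℝ)..t, lpBlock n (semigroupA μ (t - s) (Ψ s)) x‖ ≤
      ∫ s in (0 : ℝ)..t, C * P * d * ((t / 2) ^ (-θ) * s ^ (-η) + (t / 2) ^ (-η) * (t - s) ^ (-θ)) := by
    refine intervalIntegral.norm_integral_le_of_norm_le ht0.le ?_ ((i1.add i2).const_mul _)
    filter_upwards [compl_mem_ae_iff.2 (measure_singleton t)] with s hst hs
    have hst' : s < t := lt_of_le_of_ne hs.2 hst
    have h1 := (h _ _ (hΨ s ⟨hs.1, hs.2.trans ht.2⟩) (t - s)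
      ⟨by linarith, by linarith [hs.1, ht.2]⟩).norm_le n x
    calc _ ≤ C * (t - s) ^ (-θ) * (P * s ^ (-η)) * d := h1
      _ = C * P * d * ((t - s) ^ (-θ) * s ^ (-η)) := by ring
      _ ≤ _ := by
          have := rpow_mul_rpow_le hs.1 hst' hθ.le hη0.le
          gcongr
  have hval : ∫ s in (0 : ℝ)..t, C * P * d * ((t / 2) ^ (-θ) * s ^ (-η) + (t / 2) ^ (-η) * (t - s) ^ (-θ))
      = C * P * d * ((t / 2) ^ (-θ) * (t ^ (1 - η) / (1 - η)) + (t / 2) ^ (-η) * (t ^ (1 - θ) / (1 - θ))) := by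
    have hr : ∀ e : ℝ, e < 1 → ∫ s in (0 : ℝ)..t, s ^ (-e) = t ^ (1 - e) / (1 - e) := by
      intro e he
      rw [integral_rpow (.inl (by linarith)), Real.zero_rpow (by linarith), sub_zero,
        show -e + 1 = 1 - e by ring]
    rw [intervalIntegral.integral_const_mul, intervalIntegral.integral_add i1 i2,
      intervalIntegral.integral_const_mul, intervalIntegral.integral_const_mul,
      intervalIntegral.integral_comp_sub_left (fun s : ℝ => s ^ (-θ)), sub_self, sub_zero,
      hr η hη, hr θ hθ1]
  rw [hval] at hbound
  have hlin := (h₀ Y₀ M₀ hu t htT).norm_le n x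
  have m1 : t ^ (-θ₀) ≤ ε ^ (-θ₀) := Real.rpow_le_rpow_of_nonpos hε ht.1 (by linarith)
  have m2 : (t / 2) ^ (-θ) ≤ (ε / 2) ^ (-θ) :=
    Real.rpow_le_rpow_of_nonpos (by linarith) (by linarith [ht.1]) (by linarith)
  have m3 : (t / 2) ^ (-η) ≤ (ε / 2) ^ (-η) :=
    Real.rpow_le_rpow_of_nonpos (by linarith) (by linarith [ht.1]) (by linarith)
  have m4 : t ^ (1 - η) ≤ T ^ (1 - η) := Real.rpow_le_rpow ht0.le ht.2 (by linarith)
  have m5 : t ^ (1 - θ) ≤ T ^ (1 - θ) := Real.rpow_le_rpow ht0.le ht.2 (by linarith)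
  have hη' : 0 < 1 - η := by linarith
  have hθ' : 0 < 1 - θ := by linarith
  rw [hblock]
  refine (norm_add_le_of_le hlin hbound).trans ?_
  rw [add_mul]
  refine add_le_add (by gcongr) ?_
  calc _ ≤ C * P * d * ((ε / 2) ^ (-θ) * (T ^ (1 - η) / (1 - η))
        + (ε / 2) ^ (-η) * (T ^ (1 - θ) / (1 - θ))) := by gcongr
    _ = _ := by ring

/-- The symbol of `-A = 1 - (i + μ)Δ`. -/
noncomputable def symA (μ : ℝ) (k : Fin 2 → ℤ) : ℂ :=
  1 + (Complex.I + μ) * ((4 * Real.pi ^ 2 * freqNorm k ^ 2 : ℝ) : ℂ)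

/-- With $e^{-t\lambda}$ pulled out of the Duhamel integral, the integrand no longer depends on $t$
and the fundamental theorem of calculus applies; the singularity at time zero is integrable. Here
`lam` plays the role of the eigenvalue `symA μ k`, not of the parameter of the equation. -/
lemma hasDerivAt_of_mild {lam : ℂ} {T : ℝ} {y₀ : ℂ} {ψ y : ℝ → ℂ} {P η : ℝ} (hη : η < 1)
    (hψ : ContinuousOn ψ (Ioc 0 T)) (hb : ∀ s ∈ Ioc 0 T, ‖ψ s‖ ≤ P * s ^ (-η))
    (hmild : ∀ t ∈ Ioc 0 T, y t = Complex.exp (-(t : ℂ) * lam) * y₀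
      + ∫ s in (0 : ℝ)..t, Complex.exp (-((t - s : ℝ) : ℂ) * lam) * ψ s) {t : ℝ} (ht : t ∈ Ioo 0 T) :
    HasDerivAt y (-lam * y t + ψ t) t := by
  set g : ℝ → ℂ := fun s => Complex.exp ((s : ℂ) * lam) * ψ s with hg
  have hgc : ContinuousOn g (Ioc 0 T) :=
    ContinuousOn.mul (Continuous.continuousOn (by fun_prop)) hψ
  have hmild' : ∀ s ∈ Ioc 0 T, y s = Complex.exp (-(s : ℂ) * lam) * (y₀ + ∫ r in (0 : ℝ)..s, g r) := by
    intro s hs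
    rw [hmild s hs, mul_add, ← intervalIntegral.integral_const_mul]
    congr 1
    refine intervalIntegral.integral_congr fun r _ => ?_
    simp only [hg]
    rw [← mul_assoc, ← Complex.exp_add]
    congr 2
    push_cast
    ring
  have hint : IntervalIntegrable g volume 0 t := by
    have h1 : IntervalIntegrable ψ volume 0 t :=
      intervalIntegrable_of_rpow_bound ht.1.le hη (hψ.mono (Ioc_subset_Ioc_right ht.2.le))
        fun s hs => hb s ⟨hs.1, hs.2.trans ht.2.le⟩
    exact h1.continuousOn_mul (Continuous.continuousOn (by fun_prop))
  have hnhds : Ioo 0 T ∈ 𝓝 t := isOpen_Ioo.mem_nhds ht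
  have hgo : ContinuousOn g (Ioo 0 T) := hgc.mono Ioo_subset_Ioc_self
  have hd : HasDerivAt (fun s => ∫ r in (0 : ℝ)..s, g r) (g t) t :=
    intervalIntegral.integral_hasDerivAt_right hint
      (hgo.stronglyMeasurableAtFilter isOpen_Ioo t ht) (hgo.continuousAt hnhds)
  have he : HasDerivAt (fun s : ℝ => Complex.exp (-(s : ℂ) * lam))
      (Complex.exp (-(t : ℂ) * lam) * (-1 * lam)) t := by
    have : HasDerivAt (fun s : ℝ => -(s : ℂ) * lam) (-1 * lam) t :=
      (Complex.ofRealCLM.hasDerivAt (x := t)).neg.mul_const lam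
    exact this.cexp
  have h := he.mul (hd.const_add y₀)
  have h' : HasDerivAt y _ t := h.congr_of_eventuallyEq
    (by filter_upwards [hnhds] with s hs using hmild' s (Ioo_subset_Ioc_self hs))
  convert h' using 1
  rw [hmild' t (Ioo_subset_Ioc_self ht)]
  simp only [hg]
  have e1 : Complex.exp (-(t : ℂ) * lam) * (Complex.exp ((t : ℂ) * lam) * ψ t) = ψ t := by
    rw [← mul_assoc, ← Complex.exp_add]
    simp
  rw [e1]
  ring

/-- The consequences of the mild equation used in the energy estimate. -/
structure StrongSolution (μ : ℝ) (ν lam : ℂ) (T : ℝ) (Z : Driver) (Y : ℝ → TorusDist) : Prop where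
  bound : ∀ ε : ℝ, 0 < ε → ∃ M : ℝ, ∀ t ∈ Icc ε T, BesovLE (5 / 4) (Y t) M
  cont : BesovContinuousOn (9 / 8) Y (Ioc 0 T)
  contPsi : BesovContinuousOn (-(1 / 4)) (fun s => nonlinPsi ν lam (Y s) Z s) (Ioc 0 T)
  deriv : ∀ k, ∀ t ∈ Ioo 0 T, HasDerivAt (fun s => Y s k)
    (-symA μ k * Y t k + nonlinPsi ν lam (Y t) Z t k) t

/-- Increments in time tend to zero in $\mathcal C^{\beta_1}$ and stay bounded in $\mathcal
C^{\beta_2}$ away from time zero, hence tend to zero in every space strictly between. -/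
lemma besovContinuousOn_of_interpolate {β₁ β₂ β : ℝ} (h1 : β₁ < β) (h2 : β < β₂) {T : ℝ}
    {Y : ℝ → TorusDist} (hb : ∀ ε : ℝ, 0 < ε → ∃ M : ℝ, ∀ t ∈ Icc ε T, BesovLE β₂ (Y t) M)
    (hc : BesovContinuousOn β₁ Y (Ioc 0 T)) : BesovContinuousOn β Y (Ioc 0 T) := by
  rw [besovContinuousOn_iff] at hc ⊢
  intro t ht
  obtain ⟨M, hM⟩ := hb (t / 2) (half_pos ht.1)
  have hMt := hM t ⟨by linarith [ht.1], ht.2⟩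
  refine ⟨(hMt.exponent_mono h2.le).lt_top, fun ε hε => ?_⟩
  set θ := (β - β₁) / (β₂ - β₁)
  have hpos : 0 < β₂ - β₁ := by linarith
  have hθ0 : 0 ≤ θ := div_nonneg (by linarith) hpos.le
  have hθ1 : θ < 1 := (div_lt_one hpos).2 (by linarith)
  have hβ : (1 - θ) * β₁ + θ * β₂ = β := by
    simp only [θ]; field_simp; ring
  have hM0 := hMt.nonneg
  set A := (M + M) ^ θ + 1
  have hA : 0 < A := by positivity
  -- The power is chosen so that interpolation, which raises it to $1-\theta$, returns
  -- $\varepsilon/A$; the additional one in $A$ keeps the denominator positive.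
  have hδ : 0 < (ε / A) ^ (1 - θ)⁻¹ := Real.rpow_pos_of_pos (by positivity) _
  have hnear : ∀ᶠ s in 𝓝[Ioc 0 T] t, s ∈ Icc (t / 2) T := by
    filter_upwards [self_mem_nhdsWithin, mem_nhdsWithin_of_mem_nhds
      (Ioi_mem_nhds (show t / 2 < t by linarith [ht.1]))] with s hs hs'
    exact ⟨le_of_lt hs', hs.2⟩
  filter_upwards [(hc t ht).2 _ hδ, hnear] with s hs hs'
  have h := hs.interpolate hθ0 hθ1.le ((hM s hs').sub hMt)
  rw [hβ, ← Real.rpow_mul (by positivity), inv_mul_cancel₀ (by linarith), Real.rpow_one] at h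
  refine h.mono ?_
  rw [div_mul_eq_mul_div, div_le_iff₀ hA]
  have : (M + M) ^ θ ≤ A := by simp [A]
  gcongr

/-- The weight $t^\gamma$ with $\gamma<\frac13$ makes the forcing integrable at zero, one Duhamel
step reaches $\mathcal C^{5/4}$ on $[\varepsilon,T]$, and interpolation with the assumed continuity
gives continuity in $\mathcal C^{9/8}$. -/
theorem IsSolution.strong {μ : ℝ} (hμ : 0 < μ) {ν lam : ℂ} {α₀ : ℝ} (hα₀ : 0 < α₀)
    (hα₀' : α₀ < 2 / 3) {Y₀ : TorusDist} (hY₀ : besovNorm (-α₀) Y₀ < ⊤) {Z : Driver}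
    (hZ : IsAdmissibleDriver Z) {T : ℝ} (hT : 0 < T) {Y : ℝ → TorusDist}
    (h : IsSolution μ ν lam T Y₀ Z Y) : StrongSolution μ ν lam T Z Y := by
  obtain ⟨⟨α₁', γ, hα₁', hγ, hγ', hcont', hsup'⟩, hmild⟩ := h
  -- Capping at one puts $\alpha_1$ below $\frac98$ for the interpolation and makes
  -- $\alpha=\alpha_1/4\le\frac14$. The driver is controlled for every positive $\alpha$, so this
  -- index can be adapted to the unknown regularity of the solution.
  set α₁ := min α₁' 1
  have hα₁ : 0 < α₁ := lt_min hα₁' one_pos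
  have hα₁1 : α₁ ≤ 1 := min_le_right _ _
  have hcont : BesovContinuousOn α₁ Y (Ioc 0 T) := hcont'.exponent_mono (min_le_left _ _)
  set S := (⨆ t ∈ Ioc 0 T, ENNReal.ofReal (t ^ γ) * besovNorm α₁' (Y t)).toReal
  have hbd : ∀ t ∈ Ioc 0 T, BesovLE α₁ (Y t) ((2 : ℝ) ^ (α₁' - α₁) * S * t ^ (-γ)) := by
    intro t ht
    have h1 : ENNReal.ofReal (t ^ γ) * besovNorm α₁' (Y t) ≤ ENNReal.ofReal S := by
      rw [ENNReal.ofReal_toReal hsup'.ne]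
      exact le_iSup₂ (f := fun t (_ : t ∈ Ioc 0 T) => ENNReal.ofReal (t ^ γ) * besovNorm α₁' (Y t)) t ht
    have h2 := (besovLE_of_ofReal_mul_le (Real.rpow_pos_of_pos ht.1 _) ENNReal.toReal_nonneg h1
      ).exponent_mono (min_le_left α₁' 1)
    refine h2.mono (le_of_eq ?_)
    rw [Real.rpow_neg ht.1.le, mul_assoc]
  set a := α₁ / 2
  have ha2 : 2 * a = α₁ := by simp only [a]; ring
  set α := α₁ / 4
  have hα : 0 < α := by positivity
  have hαa : α < a := by simp only [a, α]; linarith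
  have hα4 : α ≤ 1 / 4 := by simp only [α]; linarith
  obtain ⟨P, η, hP, hη0, hη1, hΨ⟩ := exists_forcing_bound (ν := ν) (lam := lam) hZ (a := a) hT hγ hγ'
    (by rw [ha2]; exact hbd) hα hαa hα4
  have hΨc : BesovContinuousOn (-α) (fun s => nonlinPsi ν lam (Y s) Z s) (Ioc 0 T) :=
    BesovContinuousOn.nonlinPsi hα hαa ν lam hZ (by rw [ha2]; exact hcont)
  have hb : ∀ ε : ℝ, 0 < ε → ∃ M : ℝ, ∀ t ∈ Icc ε T, BesovLE (5 / 4) (Y t) M := fun ε hε =>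
    exists_besov_bound_of_mild hμ hT hα₀ hα₀' hY₀ hα hα4 hη0 hη1 hΨ
      (fun k => hΨc.continuousOn_coeff k) hmild hε
  have hc : BesovContinuousOn (9 / 8) Y (Ioc 0 T) :=
    besovContinuousOn_of_interpolate (by linarith) (by norm_num) hb hcont
  refine ⟨hb, hc, hΨc.exponent_mono (by linarith), fun k t ht => ?_⟩
  obtain ⟨B, hB, hk⟩ := exists_coeff_bound (-α) k
  refine hasDerivAt_of_mild (y₀ := Y₀ k) (T := T) (P := B * P) hη1 (hΨc.continuousOn_coeff k)
    (fun s hs => ?_) (fun s hs => hmild s hs k) ht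
  exact (hk _ _ (hΨ s hs)).trans (le_of_eq (by ring))

/-! Calculus on the torus. -/

/-- The point `s` on the `l`-th coordinate axis. -/
noncomputable def axisPt (l : Fin 2) (s : ℝ) : Torus2 := Pi.single l (s : UnitAddCircle)

lemma axisPt_zero (l : Fin 2) : axisPt l 0 = 0 := by simp [axisPt]

lemma axisPt_add (l : Fin 2) (s r : ℝ) : axisPt l (s + r) = axisPt l s + axisPt l r := by
  rw [axisPt, AddCircle.coe_add, Pi.single_add]
  rfl

/-- `h'` is the partial derivative of `h` in the direction `l`. -/
def HasPD (l : Fin 2) (h h' : Torus2 → ℂ) : Prop :=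
  ∀ x, HasDerivAt (fun s : ℝ => h (x + axisPt l s)) (h' x) 0

lemma HasPD.hasDerivAt {l : Fin 2} {h h' : Torus2 → ℂ} (hh : HasPD l h h') (x : Torus2) (s : ℝ) :
    HasDerivAt (fun s : ℝ => h (x + axisPt l s)) (h' (x + axisPt l s)) s := by
  have h0 : HasDerivAt (fun r : ℝ => h (x + axisPt l s + axisPt l r)) (h' (x + axisPt l s))
      (s - s) := by
    rw [sub_self]
    exact hh _
  refine (h0.comp_sub_const s s).congr_of_eventuallyEq (.of_forall fun r => ?_)
  simp only
  rw [add_assoc, ← axisPt_add, add_sub_cancel]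

lemma HasPD.mul {l : Fin 2} {f f' g g' : Torus2 → ℂ} (hf : HasPD l f f') (hg : HasPD l g g') :
    HasPD l (fun x => f x * g x) (fun x => f' x * g x + f x * g' x) := fun x => by
  have := (hf x).fun_mul (hg x)
  simpa only [axisPt_zero, add_zero] using this

lemma HasPD.conj {l : Fin 2} {f f' : Torus2 → ℂ} (hf : HasPD l f f') :
    HasPD l (fun x => (starRingEnd ℂ) (f x)) (fun x => (starRingEnd ℂ) (f' x)) := fun x =>
  (hf x).star_conj

/-- The derivative is the pointwise limit of difference quotients with steps $1/n$, each of them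
continuous. Continuity of the derivative itself is not needed. -/
lemma measurable_of_hasPD {l : Fin 2} {h h' : Torus2 → ℂ} (hh : HasPD l h h') (hc : Continuous h) :
    Measurable h' := by
  have hlim : Tendsto (fun n : ℕ => (n : ℝ)⁻¹) atTop (𝓝[≠] 0) :=
    tendsto_nhdsWithin_iff.2 ⟨tendsto_inv_atTop_nhds_zero_nat, by
      filter_upwards [eventually_gt_atTop 0] with n hn
      simp [hn.ne']⟩
  have hm : ∀ n : ℕ, Measurable fun x => ((n : ℝ)⁻¹)⁻¹ • (h (x + axisPt l (n : ℝ)⁻¹) - h x) :=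
    fun n => Continuous.measurable (by fun_prop)
  refine measurable_of_tendsto_metrizable hm (tendsto_pi_nhds.2 fun x => ?_)
  refine ((hasDerivAt_iff_tendsto_slope.1 (hh x)).comp hlim).congr fun n => ?_
  simp [slope_def_module, axisPt_zero]

/-- The integral of a bounded partial derivative vanishes. -/
lemma integral_eq_zero_of_hasPD {l : Fin 2} {h h' : Torus2 → ℂ} (hh : HasPD l h h')
    (hc : Continuous h) {K : ℝ} (hK : ∀ x, ‖h' x‖ ≤ K) : ∫ x, h' x ∂torusMeasure = 0 := by
  -- The integral of a translate of `h` does not depend on the translation. The constant bound `K`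
  -- allows differentiation under the integral sign, so the integral of the derivative is zero.
  have h1 := (hasDerivAt_integral_of_dominated_loc_of_deriv_le (μ := torusMeasure) (x₀ := (0 : ℝ))
    (F := fun s x => h (x + axisPt l s))
    (F' := fun s x => h' (x + axisPt l s)) (bound := fun _ => K) (s := univ)
    univ_mem (.of_forall fun s => Continuous.aestronglyMeasurable (by fun_prop))
    (integrable_torus (by fun_prop))
    (by simpa [axisPt_zero] using (measurable_of_hasPD hh hc).aestronglyMeasurable)
    (.of_forall fun x s _ => hK _) (integrable_const _)
    (.of_forall fun x s _ => hh.hasDerivAt x s)).2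
  have h2 : (fun s : ℝ => ∫ x, h (x + axisPt l s) ∂torusMeasure)
      = fun _ => ∫ x, h x ∂torusMeasure := funext fun s => integral_add_right_eq_self h _
  rw [h2] at h1
  have h3 := h1.unique (hasDerivAt_const (0 : ℝ) _)
  simpa [axisPt_zero] using h3

lemma integrable_of_hasPD {l : Fin 2} {h h' : Torus2 → ℂ} (hh : HasPD l h h')
    (hc : Continuous h) {K : ℝ} (hK : ∀ x, ‖h' x‖ ≤ K) : Integrable h' torusMeasure :=
  (integrable_const K).mono' (measurable_of_hasPD hh hc).aestronglyMeasurable (.of_forall hK)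

lemma exists_norm_le_of_continuous {E : Type*} [NormedAddCommGroup E] {f : Torus2 → E}
    (hf : Continuous f) : ∃ K : ℝ, 0 ≤ K ∧ ∀ x, ‖f x‖ ≤ K := by
  obtain ⟨K, hK⟩ := isCompact_univ.exists_bound_of_continuousOn hf.continuousOn
  exact ⟨max K 0, le_max_right _ _, fun x => (hK x trivial).trans (le_max_left _ _)⟩

/-- Integration by parts. -/
lemma integral_mul_eq_neg {l : Fin 2} {f f' g g' : Torus2 → ℂ} (hf : HasPD l f f')
    (hg : HasPD l g g') (hfc : Continuous f) (hgc : Continuous g) (hf'c : Continuous f') {K : ℝ}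
    (hK : ∀ x, ‖g' x‖ ≤ K) :
    ∫ x, f' x * g x ∂torusMeasure = -∫ x, f x * g' x ∂torusMeasure := by
  obtain ⟨A, hA0, hA⟩ := exists_norm_le_of_continuous hfc
  obtain ⟨A', hA0', hA'⟩ := exists_norm_le_of_continuous (hf'c.fun_mul hgc)
  have hb : ∀ x, ‖f x * g' x‖ ≤ A * K := fun x => by
    rw [norm_mul]
    exact mul_le_mul (hA x) (hK x) (norm_nonneg _) hA0
  have h := integral_eq_zero_of_hasPD (hf.mul hg) (hfc.fun_mul hgc) (K := A' + A * K) fun x =>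
    norm_add_le_of_le (hA' x) (hb x)
  rw [integral_add (integrable_torus (hf'c.fun_mul hgc))] at h
  · exact eq_neg_of_add_eq_zero_left h
  · exact (integrable_const (A * K)).mono' (hfc.measurable.mul (measurable_of_hasPD hg hgc)
      ).aestronglyMeasurable (.of_forall hb)

lemma mFourier_add_axisPt (k : Fin 2 → ℤ) (x : Torus2) (l : Fin 2) (s : ℝ) :
    mFourier k (x + axisPt l s)
      = mFourier k x * Complex.exp (2 * Real.pi * Complex.I * (k l : ℂ) * s) := by
  simp only [mFourier, ContinuousMap.coe_mk]
  have h1 : ∀ i, fourier (k i) ((x + axisPt l s) i)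
      = fourier (k i) (x i) * fourier (k i) (axisPt l s i) := by
    intro i
    rw [fourier_apply, fourier_apply, fourier_apply, Pi.add_apply, smul_add, AddCircle.toCircle_add,
      Circle.coe_mul]
  rw [Finset.prod_congr rfl fun i _ => h1 i, Finset.prod_mul_distrib]
  congr 1
  rw [Finset.prod_eq_single l]
  · rw [axisPt, Pi.single_eq_same, fourier_coe_apply]
    congr 1
    push_cast
    ring
  · intro i _ hi
    rw [axisPt, Pi.single_eq_of_ne hi]
    simp
  · simp

lemma FinSupp.partialDist {c : TorusDist} (hc : FinSupp c) (l : Fin 2) : FinSupp (partialDist l c) :=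
  hc.mono fun k hk => by simp [_root_.partialDist, hk]

lemma hasPD_trig {c : TorusDist} (hc : FinSupp c) (l : Fin 2) :
    HasPD l (trig c) (trig (partialDist l c)) := by
  obtain ⟨F, hF⟩ := hc.exists_finset
  have hF' : ∀ k ∉ F, partialDist l c k = 0 := fun k hk => by simp [partialDist, hF k hk]
  intro x
  have e : (fun s : ℝ => trig c (x + axisPt l s)) = fun s : ℝ => ∑ k ∈ F,
      c k * (mFourier k x * Complex.exp (2 * Real.pi * Complex.I * (k l : ℂ) * s)) := funext fun s => by
    rw [trig_eq_sum hF]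
    exact Finset.sum_congr rfl fun k _ => by rw [mFourier_add_axisPt]
  rw [e, trig_eq_sum hF']
  refine HasDerivAt.fun_sum fun k _ => ?_
  have h1 : HasDerivAt (fun s : ℝ => Complex.exp (2 * Real.pi * Complex.I * (k l : ℂ) * s))
      (2 * Real.pi * Complex.I * (k l : ℂ)) 0 := by
    have h2 : HasDerivAt (fun s : ℝ => 2 * Real.pi * Complex.I * (k l : ℂ) * (s : ℂ))
        (2 * Real.pi * Complex.I * (k l : ℂ) * 1) 0 :=
      (Complex.ofRealCLM.hasDerivAt (x := (0 : ℝ))).const_mul _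
    simpa using h2.cexp
  refine ((h1.const_mul (mFourier k x)).const_mul (c k)).congr_deriv ?_
  simp only [partialDist]
  ring

/-! Pairing of a distribution of small negative regularity with a function. -/

lemma le_sqrt_mul_of_le {x a b : ℝ} (hx : 0 ≤ x) (ha : x ≤ a) (hb : x ≤ b) :
    x ≤ Real.sqrt (a * b) :=
  Real.le_sqrt_of_sq_le (by rw [sq]; exact mul_le_mul ha hb hx (hx.trans ha))

/-- Each block pairs with $f$ in two ways: directly, at cost $2^{\alpha n}\|f\|_{L^1}$, or after
writing the block as a divergence and integrating by parts, at cost $2^{(\alpha-1)n}\|\nabla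
f\|_{L^1}$. The geometric mean $2^{(\alpha-1/2)n}\sqrt{AB}$ is summable because $\alpha<\frac12$.
The lowest block is not a divergence and accounts for the separate term $A$. The constant does not
depend on the truncation level. -/
theorem exists_pairing_bound {α : ℝ} (hα : 0 < α) (hα' : α < 1 / 2) : ∃ C : ℝ, 0 < C ∧
    ∀ (u : TorusDist) (M : ℝ), BesovLE (-α) u M → ∀ (N : ℕ) (f : Torus2 → ℂ)
      (f' : Fin 2 → Torus2 → ℂ) (K : ℝ), Continuous f → (∀ l, HasPD l f (f' l)) →
      (∀ l x, ‖f' l x‖ ≤ K) → ∀ A B : ℝ, ∫ x, ‖f x‖ ∂torusMeasure ≤ A →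
      ∑ l, ∫ x, ‖f' l x‖ ∂torusMeasure ≤ B →
      ‖∫ x, trig (lowPass N u) x * f x ∂torusMeasure‖ ≤ C * M * (A + Real.sqrt (A * B)) := by
  obtain ⟨C, hC, h⟩ := exists_inverse_gradient
  set δ := 1 / 2 - α
  have hδ : 0 < δ := by simp only [δ]; linarith
  refine ⟨1 + Real.sqrt C * dyadSum δ, by have := dyadSum_pos hδ; positivity, ?_⟩
  intro u M hu N f f' K hf hf' hK A B hA hB
  have hM := hu.nonneg
  have hA0 : 0 ≤ A := (integral_nonneg fun _ => norm_nonneg _).trans hA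
  have hB0 : 0 ≤ B :=
    (Finset.sum_nonneg fun l _ => integral_nonneg fun _ => norm_nonneg _).trans hB
  have hblk : ∀ n, Continuous (lpBlock n u) := fun n => continuous_trig (finSupp_blk n u)
  have hle := fun n x => hu.norm_le n x
  simp only [neg_neg] at hle
  have b1 : ∀ n, ‖∫ x, lpBlock n u x * f x ∂torusMeasure‖ ≤ M * dyad α n * A := by
    intro n
    refine (norm_integral_le_of_norm_le ((integrable_torus hf.norm).const_mul (M * dyad α n))
      (.of_forall fun x => ?_)).trans ?_
    · rw [norm_mul]
      exact mul_le_mul_of_nonneg_right (hle n x) (norm_nonneg _)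
    · rw [integral_const_mul]
      exact mul_le_mul_of_nonneg_left hA (mul_nonneg hM (dyad_pos _ _).le)
  have b2 : ∀ n, 1 ≤ n → ‖∫ x, lpBlock n u x * f x ∂torusMeasure‖ ≤
      C / 2 ^ n * (M * dyad α n) * B := by
    intro n hn
    obtain ⟨d, hd1, hd2, hd3⟩ := h (2 ^ n) (one_le_two_pow' n) (blk n u) (finSupp_blk n u)
      (fun k hk => ⟨le_freqNorm_of_lpSymbol_ne hn (lpSymbol_ne_of_blk_ne hk),
        freqNorm_le_of_lpSymbol_ne (lpSymbol_ne_of_blk_ne hk)⟩) _ (hle n)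
    have e : ∀ x, lpBlock n u x = ∑ l, trig (partialDist l (d l)) x := by
      intro x
      rw [lpBlock_eq_trig, hd3, ← trig_sum _ fun l _ => (hd1 l).partialDist l]
      congr 1
    have hcd : ∀ l, Continuous (trig (partialDist l (d l))) := fun l =>
      continuous_trig ((hd1 l).partialDist l)
    simp only [e, Finset.sum_mul]
    rw [integral_finsetSum _ fun l _ => integrable_torus ((hcd l).fun_mul hf)]
    refine (norm_sum_le_of_le _ fun l _ => ?_).trans ((Finset.mul_sum _ _ _).symm.trans_le
      (mul_le_mul_of_nonneg_left hB (by have := dyad_pos α n; positivity)))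
    rw [integral_mul_eq_neg (hasPD_trig (hd1 l) l) (hf' l) (continuous_trig (hd1 l)) hf (hcd l) (hK l),
      norm_neg, ← integral_const_mul]
    refine norm_integral_le_of_norm_le ((integrable_of_hasPD (hf' l) hf (hK l)).norm.const_mul _)
      (.of_forall fun x => ?_)
    rw [norm_mul]
    exact mul_le_mul_of_nonneg_right (hd2 l x) (norm_nonneg _)
  have b3 : ∀ n, 1 ≤ n → ‖∫ x, lpBlock n u x * f x ∂torusMeasure‖ ≤
      M * Real.sqrt (A * B) * Real.sqrt C * dyad (-δ) n := by
    intro n hn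
    have hdn := dyad_pos α n
    have hD := dyad_pos (-(1 / 2)) n
    -- Because of the shift $j=n-1$ the squared weight is $2\cdot2^{-n}$; writing the gain as a
    -- square lets it leave the square root.
    have hinv : C / 2 ^ n ≤ C * (dyad (-(1 / 2)) n) ^ 2 := by
      have : (dyad (-(1 / 2)) n) ^ 2 = dyad (-1) n := by
        rw [sq, ← dyad_add]; norm_num
      rw [this, div_eq_mul_inv]
      gcongr
      have h1 := dyad_mul_neg 1 n
      rw [dyad_one] at h1
      rw [inv_le_iff_one_le_mul₀ (by positivity)]
      nlinarith [dyad_pos (-1) n, one_le_two_pow' n]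
    have := le_sqrt_mul_of_le (norm_nonneg _) (b1 n) ((b2 n hn).trans
      (show _ ≤ C * (dyad (-(1 / 2)) n) ^ 2 * (M * dyad α n) * B by gcongr))
    refine this.trans (le_of_eq ?_)
    have e : M * dyad α n * A * (C * dyad (-(1 / 2)) n ^ 2 * (M * dyad α n) * B)
        = (M * dyad α n * dyad (-(1 / 2)) n) ^ 2 * (A * B * C) := by ring
    rw [e, Real.sqrt_mul (sq_nonneg _), Real.sqrt_sq (by positivity), Real.sqrt_mul (by positivity),
      mul_assoc M, ← dyad_add, show α + -(1 / 2) = -δ by simp only [δ]; ring]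
    ring
  simp only [trig_lowPass, Finset.sum_mul]
  rw [integral_finsetSum _ fun n _ => integrable_torus ((hblk n).fun_mul hf), Finset.sum_range_succ']
  have e0 : dyad α 0 ≤ 1 := by
    rw [dyad_eq, pow_zero, mul_one]
    exact Real.rpow_le_one_of_one_le_of_nonpos (by norm_num) (by linarith)
  set S := Real.sqrt (A * B)
  have hS : 0 ≤ S := Real.sqrt_nonneg _
  have hsum : ∑ n ∈ Finset.range N, dyad (-δ) (n + 1) ≤ dyadSum δ := by
    rw [← tsum_dyad_neg hδ]
    have h1 := (summable_dyad_neg hδ).sum_le_tsum (Finset.range (N + 1)) fun n _ => (dyad_pos _ _).le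
    rw [Finset.sum_range_succ'] at h1
    linarith [dyad_pos (-δ) 0]
  have hDS := dyadSum_pos hδ
  calc _ ≤ ∑ n ∈ Finset.range N, M * S * Real.sqrt C * dyad (-δ) (n + 1) + M * dyad α 0 * A :=
        norm_add_le_of_le (norm_sum_le_of_le _ fun n _ => b3 (n + 1) (by omega)) (b1 0)
    _ ≤ M * S * Real.sqrt C * dyadSum δ + M * 1 * A := by
        rw [← Finset.mul_sum]
        gcongr
    _ ≤ _ := by
        have h1 : 0 ≤ M * (Real.sqrt C * dyadSum δ) * A := by positivity
        have h2 : 0 ≤ M * S := by positivity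
        nlinarith

/-! The duality map of `L^p`. -/

/-- `|z|^{p-2} z̄`. -/
noncomputable def dualMap (p : ℝ) (z : ℂ) : ℂ := ((‖z‖ ^ (p - 2) : ℝ) : ℂ) * (starRingEnd ℂ) z

/-- The derivative of `dualMap p` at `z` in the direction `v`. -/
noncomputable def dualMapDeriv (p : ℝ) (z v : ℂ) : ℂ :=
  ((‖z‖ ^ (p - 2) : ℝ) : ℂ) * (starRingEnd ℂ) v
    + (((p - 2) * ‖z‖ ^ (p - 4) * ((starRingEnd ℂ) z * v).re : ℝ) : ℂ) * (starRingEnd ℂ) z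

lemma norm_dualMap {p : ℝ} (hp : 2 ≤ p) (z : ℂ) : ‖dualMap p z‖ = ‖z‖ ^ (p - 1) := by
  rw [dualMap, norm_mul, RCLike.norm_conj, Complex.norm_real, Real.norm_of_nonneg (by positivity),
    ← Real.rpow_add_one' (norm_nonneg z) (by linarith)]
  congr 1
  ring

lemma continuous_dualMap {p : ℝ} (hp : 2 ≤ p) : Continuous (dualMap p) :=
  (Complex.continuous_ofReal.comp (continuous_norm.rpow_const fun _ => .inr (by linarith))).mul
    Complex.continuous_conj

/-- Away from zeros of $u$ this is the product rule. At a zero the power $|u|^{p-2}$ may fail to be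
differentiable, but the factor $\overline u$ vanishes there, so the difference quotient is
$|u|^{p-2}$ times that of $\overline u$ and continuity of the power suffices. -/
lemma HasDerivAt.dualMap {p : ℝ} (hp : 2 ≤ p) {u : ℝ → ℂ} {v : ℂ} {s : ℝ} (hu : HasDerivAt u v s) :
    HasDerivAt (fun r => dualMap p (u r)) (dualMapDeriv p (u s) v) s := by
  by_cases h0 : u s = 0
  · have hcont : ContinuousAt (fun r => ((‖u r‖ ^ (p - 2) : ℝ) : ℂ)) s :=
      Complex.continuous_ofReal.continuousAt.comp
        (hu.continuousAt.norm.rpow_const (.inr (by linarith)))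
    have hc : HasDerivAt (fun r => (starRingEnd ℂ) (u r)) ((starRingEnd ℂ) v) s := hu.star_conj
    rw [hasDerivAt_iff_tendsto_slope] at hc ⊢
    have h1 := (hcont.tendsto.mono_left nhdsWithin_le_nhds).mul hc
    simp only [dualMapDeriv, h0, map_zero, mul_zero, add_zero] at h1 ⊢
    refine h1.congr fun r => ?_
    simp only [slope_def_module, _root_.dualMap, h0, map_zero, mul_zero, sub_zero, Complex.real_smul]
    ring
  · have hn : ‖u s‖ ^ 2 ≠ 0 := by simpa using h0
    have hpos : 0 < ‖u s‖ := norm_pos_iff.2 h0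
    have h1 := (hu.norm_sq.rpow_const (p := (p - 2) / 2) (.inl hn))
    have h2 : HasDerivAt (fun r => ‖u r‖ ^ (p - 2))
        ((p - 2) * ‖u s‖ ^ (p - 4) * ((starRingEnd ℂ) (u s) * v).re) s := by
      have e : ∀ (a q : ℝ), 0 ≤ a → (a ^ 2) ^ (q / 2) = a ^ q := fun a q ha => by
        rw [← Real.rpow_natCast, ← Real.rpow_mul ha]
        congr 1
        push_cast
        ring
      have e1 : (fun r => ‖u r‖ ^ (p - 2)) = fun r => (‖u r‖ ^ 2) ^ ((p - 2) / 2) :=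
        funext fun r => (e _ _ (norm_nonneg _)).symm
      rw [e1]
      refine h1.congr_deriv ?_
      rw [show (p - 2) / 2 - 1 = (p - 4) / 2 by ring, e _ _ (norm_nonneg _), Complex.inner]
      ring_nf
    refine (h2.ofReal_comp.fun_mul hu.star_conj).congr_deriv ?_
    simp only [dualMapDeriv]
    rw [add_comm]
    rfl

lemma rpow_sub_four_mul {p : ℝ} {z : ℂ} (hz : z ≠ 0) :
    ‖z‖ ^ (p - 2) = ‖z‖ ^ (p - 4) * ‖z‖ ^ 2 := by
  rw [← Real.rpow_natCast, ← Real.rpow_add (norm_pos_iff.2 hz)]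
  congr 1
  push_cast
  ring

lemma norm_dualMapDeriv_le {p : ℝ} (hp : 2 ≤ p) (z v : ℂ) :
    ‖dualMapDeriv p z v‖ ≤ (p - 1) * ‖z‖ ^ (p - 2) * ‖v‖ := by
  have h1 : ‖((‖z‖ ^ (p - 2) : ℝ) : ℂ) * (starRingEnd ℂ) v‖ = ‖z‖ ^ (p - 2) * ‖v‖ := by
    rw [norm_mul, RCLike.norm_conj, Complex.norm_real, Real.norm_of_nonneg (by positivity)]
  have h2 : ‖(((p - 2) * ‖z‖ ^ (p - 4) * ((starRingEnd ℂ) z * v).re : ℝ) : ℂ) * (starRingEnd ℂ) z‖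
      ≤ (p - 2) * ‖z‖ ^ (p - 2) * ‖v‖ := by
    by_cases hz : z = 0
    · subst hz
      simp only [map_zero, mul_zero, norm_zero]
      have : 0 ≤ p - 2 := by linarith
      positivity
    · have hp2 : 0 ≤ p - 2 := by linarith
      have h3 : |((starRingEnd ℂ) z * v).re| ≤ ‖z‖ * ‖v‖ :=
        (Complex.abs_re_le_norm _).trans (by rw [norm_mul, RCLike.norm_conj])
      rw [norm_mul, RCLike.norm_conj, Complex.norm_real, Real.norm_eq_abs, abs_mul,
        abs_of_nonneg (by positivity : 0 ≤ (p - 2) * ‖z‖ ^ (p - 4)), rpow_sub_four_mul hz]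
      calc _ ≤ (p - 2) * ‖z‖ ^ (p - 4) * (‖z‖ * ‖v‖) * ‖z‖ := by gcongr
        _ = _ := by ring
  refine (norm_add_le_of_le h1.le h2).trans (le_of_eq ?_)
  ring

/-- Ellipticity of the quadratic form that the Laplacian produces. -/
lemma le_re_mul_dualMapDeriv {μ p c : ℝ} (hcμ : c ≤ μ)
    (hq : ∀ a b : ℝ, c * (a ^ 2 + b ^ 2) ≤ μ * (p - 1) * a ^ 2 - (p - 2) * a * b + μ * b ^ 2)
    (z v : ℂ) :
    c * (‖v‖ ^ 2 * ‖z‖ ^ (p - 2)) ≤ ((Complex.I + μ) * (v * dualMapDeriv p z v)).re := by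
  have hvv : v * (starRingEnd ℂ) v = ((‖v‖ ^ 2 : ℝ) : ℂ) := by
    rw [Complex.mul_conj, Complex.normSq_eq_norm_sq]
  by_cases hz : z = 0
  · subst hz
    simp only [dualMapDeriv, map_zero, mul_zero, add_zero]
    rw [mul_left_comm v, hvv]
    have : ((Complex.I + μ) * (((‖(0 : ℂ)‖ ^ (p - 2) : ℝ) : ℂ) * ((‖v‖ ^ 2 : ℝ) : ℂ))).re
        = μ * (‖v‖ ^ 2 * ‖(0 : ℂ)‖ ^ (p - 2)) := by
      rw [← Complex.ofReal_mul, Complex.re_mul_ofReal, Complex.add_re, Complex.I_re, Complex.ofReal_re,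
        zero_add]
      ring
    rw [this]
    gcongr
  -- The real and imaginary parts of $\bar zv$ are, up to the factor $|z|$, the radial and angular
  -- components of $v$. Only the radial one feels the derivative of $|z|^{p-2}$, which leads to the
  -- form in `hq`.
  · set w := (starRingEnd ℂ) z * v with hw
    have e1 : v * dualMapDeriv p z v = ((‖z‖ ^ (p - 4) : ℝ) : ℂ) *
        (((‖w‖ ^ 2 : ℝ) : ℂ) + (((p - 2) * w.re : ℝ) : ℂ) * w) := by
      have hww : ‖w‖ ^ 2 = ‖z‖ ^ 2 * ‖v‖ ^ 2 := by rw [hw, norm_mul, RCLike.norm_conj, mul_pow]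
      rw [hww, dualMapDeriv, mul_add, mul_left_comm v, hvv, rpow_sub_four_mul hz, ← hw]
      push_cast
      rw [hw]
      ring
    have e2 : ‖v‖ ^ 2 * ‖z‖ ^ (p - 2) = ‖z‖ ^ (p - 4) * (w.re ^ 2 + w.im ^ 2) := by
      have hww : w.re ^ 2 + w.im ^ 2 = ‖z‖ ^ 2 * ‖v‖ ^ 2 := by
        rw [← mul_pow, ← RCLike.norm_conj z, ← norm_mul, ← hw, ← Complex.normSq_eq_norm_sq,
          Complex.normSq_apply]
        ring
      rw [hww, rpow_sub_four_mul hz]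
      ring
    have e3 : ((Complex.I + μ) * (v * dualMapDeriv p z v)).re = ‖z‖ ^ (p - 4) *
        (μ * (p - 1) * w.re ^ 2 - (p - 2) * w.re * w.im + μ * w.im ^ 2) := by
      have hww : ‖w‖ ^ 2 = w.re ^ 2 + w.im ^ 2 := by
        rw [← Complex.normSq_eq_norm_sq, Complex.normSq_apply]
        ring
      rw [e1, mul_left_comm, Complex.re_ofReal_mul, hww]
      congr 1
      simp only [Complex.mul_re, Complex.mul_im, Complex.add_re, Complex.add_im, Complex.I_re,
        Complex.I_im, Complex.ofReal_re, Complex.ofReal_im]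
      ring
    rw [e2, e3]
    have := hq w.re w.im
    calc _ = ‖z‖ ^ (p - 4) * (c * (w.re ^ 2 + w.im ^ 2)) := by ring
      _ ≤ _ := by gcongr

/-- The form is positive definite iff $(p-2)^2<4\mu^2(p-1)$. The roots in $p$ of the corresponding
equation are $2(1+\mu^2\pm\mu\sqrt{1+\mu^2})$; the smaller is below $2$ and the larger is $p(\mu)$.
-/
lemma exists_ellipticity {μ p : ℝ} (hμ : 0 < μ) (hp : 2 ≤ p)
    (hp' : p < 2 * (1 + μ ^ 2 + μ * Real.sqrt (1 + μ ^ 2))) : ∃ c : ℝ, 0 < c ∧ c ≤ μ ∧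
    ∀ a b : ℝ, c * (a ^ 2 + b ^ 2) ≤ μ * (p - 1) * a ^ 2 - (p - 2) * a * b + μ * b ^ 2 := by
  set r := Real.sqrt (1 + μ ^ 2)
  have hr : r ^ 2 = 1 + μ ^ 2 := Real.sq_sqrt (by positivity)
  have hr0 : 0 < r := Real.sqrt_pos.2 (by positivity)
  have hrμ : μ < r := by nlinarith
  have hD : 0 < 4 * μ ^ 2 * (p - 1) - (p - 2) ^ 2 := by
    have h1 : 0 < 2 * (1 + μ ^ 2 + μ * r) - p := by linarith
    have h2 : 0 < p - 2 * (1 + μ ^ 2 - μ * r) := by nlinarith [mul_pos hμ (sub_pos.2 hrμ)]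
    have h3 := mul_pos h1 h2
    have h4 : (2 * (1 + μ ^ 2 + μ * r) - p) * (p - 2 * (1 + μ ^ 2 - μ * r))
        = 4 * μ ^ 2 * (p - 1) - (p - 2) ^ 2 + 4 * μ ^ 2 * (r ^ 2 - (1 + μ ^ 2)) := by ring
    rw [h4, hr, sub_self, mul_zero, add_zero] at h3
    exact h3
  set D := 4 * μ ^ 2 * (p - 1) - (p - 2) ^ 2
  have hp0 : 0 < p := by linarith
  -- The first entry keeps $\mu-c$ positive. The second keeps the discriminant condition after
  -- subtracting $c(a^2+b^2)$, since $4(\mu(p-1)-c)(\mu-c)=D+(p-2)^2-4\mu pc+4c^2$.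
  set c := min (μ / 2) (D / (4 * μ * p))
  have hc0 : 0 < c := lt_min (by positivity) (by positivity)
  have hc1 : c ≤ μ / 2 := min_le_left _ _
  have hc2 : c * (4 * μ * p) ≤ D := (le_div_iff₀ (by positivity)).1 (min_le_right _ _)
  refine ⟨c, hc0, by linarith, fun a b => ?_⟩
  have hb : 0 < μ - c := by linarith
  have hdisc : (p - 2) ^ 2 ≤ 4 * ((μ * (p - 1) - c) * (μ - c)) := by
    have : 4 * ((μ * (p - 1) - c) * (μ - c)) = D + (p - 2) ^ 2 - c * (4 * μ * p) + 4 * c ^ 2 := by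
      simp only [D]; ring
    rw [this]
    nlinarith [sq_nonneg c]
  have key : 0 ≤ 4 * (μ - c) * ((μ * (p - 1) - c) * a ^ 2 - (p - 2) * a * b + (μ - c) * b ^ 2) := by
    have h1 := mul_le_mul_of_nonneg_right hdisc (sq_nonneg a)
    nlinarith [sq_nonneg (2 * (μ - c) * b - (p - 2) * a)]
  have := nonneg_of_mul_nonneg_right key (by positivity)
  linarith

/-- `f` behaves like a power `y^r`: growth and derivative bounds. -/
structure PowerLike (y : Torus2 → ℂ) (dy : Fin 2 → Torus2 → ℂ) (r K : ℝ) (f : Torus2 → ℂ)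
    (f' : Fin 2 → Torus2 → ℂ) : Prop where
  cont : Continuous f
  deriv : ∀ l, HasPD l f (f' l)
  norm_le : ∀ x, ‖f x‖ ≤ ‖y x‖ ^ r
  norm_deriv_le : ∀ l x, ‖f' l x‖ ≤ K * (‖y x‖ ^ (r - 1) * ‖dy l x‖)

lemma PowerLike.dualMap {y : Torus2 → ℂ} {dy : Fin 2 → Torus2 → ℂ} {p : ℝ} (hp : 2 ≤ p)
    (hy : Continuous y) (hdy : ∀ l, HasPD l y (dy l)) :
    PowerLike y dy (p - 1) (p - 1) (fun x => dualMap p (y x))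
      (fun l x => dualMapDeriv p (y x) (dy l x)) where
  cont := (continuous_dualMap hp).comp hy
  deriv l x := by simpa only [axisPt_zero, add_zero] using (hdy l x).dualMap hp
  norm_le x := (norm_dualMap hp _).le
  norm_deriv_le l x := by
    rw [show p - 1 - 1 = p - 2 by ring, ← mul_assoc]
    exact norm_dualMapDeriv_le hp _ _

/-- To be used with $g=y$ or $g=\overline y$: starting from the duality map, one or two such factors
produce all the test functions against which the driver is paired. -/
lemma PowerLike.mul {y : Torus2 → ℂ} {dy : Fin 2 → Torus2 → ℂ} {r K : ℝ} {f : Torus2 → ℂ}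
    {f' : Fin 2 → Torus2 → ℂ} (h : PowerLike y dy r K f f') (hr : 1 ≤ r) {g : Torus2 → ℂ}
    {g' : Fin 2 → Torus2 → ℂ} (hg : Continuous g) (hg' : ∀ l, HasPD l g (g' l))
    (hgy : ∀ x, ‖g x‖ = ‖y x‖) (hgy' : ∀ l x, ‖g' l x‖ = ‖dy l x‖) :
    PowerLike y dy (r + 1) (K + 1) (fun x => f x * g x)
      (fun l x => f' l x * g x + f x * g' l x) where
  cont := h.cont.mul hg
  deriv l := (h.deriv l).mul (hg' l)
  norm_le x := by
    rw [norm_mul, hgy, Real.rpow_add_one' (norm_nonneg _) (by linarith)]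
    exact mul_le_mul_of_nonneg_right (h.norm_le x) (norm_nonneg _)
  norm_deriv_le l x := by
    have e : ‖y x‖ ^ r = ‖y x‖ ^ (r - 1) * ‖y x‖ := by
      rw [← Real.rpow_add_one' (norm_nonneg _) (by linarith), sub_add_cancel]
    rw [add_sub_cancel_right]
    refine (norm_add_le _ _).trans ?_
    rw [norm_mul, norm_mul, hgy, hgy']
    have h1 := mul_le_mul_of_nonneg_right (h.norm_deriv_le l x) (norm_nonneg (y x))
    have h2 := mul_le_mul_of_nonneg_right (h.norm_le x) (norm_nonneg (dy l x))
    rw [e] at h2 ⊢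
    linarith

/-! The energy estimate for trigonometric polynomials. -/

/-- `‖trig c‖_{L^q}^q`. -/
noncomputable def trigPow (q : ℝ) (c : TorusDist) : ℝ := ∫ x, ‖trig c x‖ ^ q ∂torusMeasure

/-- `‖ |∇ trig c|² |trig c|^{p-2} ‖_{L¹}`. -/
noncomputable def trigGrad (p : ℝ) (c : TorusDist) : ℝ :=
  ∫ x, (∑ l : Fin 2, ‖trig (partialDist l c) x‖ ^ 2) * ‖trig c x‖ ^ (p - 2) ∂torusMeasure

lemma trigPow_nonneg (q : ℝ) (c : TorusDist) : 0 ≤ trigPow q c := integral_nonneg fun _ => by positivity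

lemma trigGrad_nonneg (p : ℝ) (c : TorusDist) : 0 ≤ trigGrad p c := integral_nonneg fun _ => by positivity

lemma continuous_norm_trig_rpow {c : TorusDist} (hc : FinSupp c) {q : ℝ} (hq : 0 ≤ q) :
    Continuous fun x => ‖trig c x‖ ^ q := (continuous_trig hc).norm.rpow_const fun _ => .inr hq

lemma continuous_gradDensity {c : TorusDist} (hc : FinSupp c) {p : ℝ} (hp : 2 ≤ p) :
    Continuous fun x => (∑ l : Fin 2, ‖trig (partialDist l c) x‖ ^ 2) * ‖trig c x‖ ^ (p - 2) :=
  (continuous_finsetSum _ fun l _ => (continuous_trig (hc.partialDist l)).norm.pow 2).mul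
    (continuous_norm_trig_rpow hc (by linarith))

/-- The contribution of the elliptic part. -/
theorem re_integral_laplacian_le {μ p c₁ : ℝ} (hp : 2 ≤ p) (hcμ : c₁ ≤ μ)
    (hq : ∀ a b : ℝ, c₁ * (a ^ 2 + b ^ 2) ≤ μ * (p - 1) * a ^ 2 - (p - 2) * a * b + μ * b ^ 2)
    {c : TorusDist} (hc : FinSupp c) :
    ((Complex.I + μ) * ∑ l : Fin 2, ∫ x, trig (partialDist l (partialDist l c)) x
      * dualMap p (trig c x) ∂torusMeasure).re ≤ -(c₁ * trigGrad p c) := by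
  have hy := continuous_trig hc
  have hd := fun l => continuous_trig (hc.partialDist l)
  obtain ⟨A, hA0, hA⟩ := exists_norm_le_of_continuous hy
  have P := PowerLike.dualMap hp hy (hasPD_trig hc)
  have hp2 : 0 ≤ p - 2 := by linarith
  have hbd : ∀ l, ∃ K, ∀ x, ‖dualMapDeriv p (trig c x) (trig (partialDist l c) x)‖ ≤ K := by
    intro l
    obtain ⟨B, hB0, hB⟩ := exists_norm_le_of_continuous (hd l)
    refine ⟨(p - 1) * A ^ (p - 2) * B, fun x => (norm_dualMapDeriv_le hp _ _).trans ?_⟩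
    have : 0 ≤ p - 1 := by linarith
    have := hA x
    have := hB x
    gcongr
  have hI : ∀ l, Integrable (fun x => trig (partialDist l c) x
      * dualMapDeriv p (trig c x) (trig (partialDist l c) x)) torusMeasure := by
    intro l
    obtain ⟨K, hK⟩ := hbd l
    obtain ⟨B, hB0, hB⟩ := exists_norm_le_of_continuous (hd l)
    refine (integrable_const (B * K)).mono' ((hd l).measurable.mul
      (measurable_of_hasPD (P.deriv l) P.cont)).aestronglyMeasurable (.of_forall fun x => ?_)
    rw [norm_mul]
    exact mul_le_mul (hB x) (hK x) (norm_nonneg _) hB0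
  -- In each direction one integration by parts moves a derivative onto the duality map; the
  -- pointwise ellipticity then bounds the integrand from below.
  have hl : ∀ l, c₁ * ∫ x, ‖trig (partialDist l c) x‖ ^ 2 * ‖trig c x‖ ^ (p - 2) ∂torusMeasure ≤
      -((Complex.I + μ) * ∫ x, trig (partialDist l (partialDist l c)) x
        * dualMap p (trig c x) ∂torusMeasure).re := by
    intro l
    obtain ⟨K, hK⟩ := hbd l
    rw [integral_mul_eq_neg (hasPD_trig (hc.partialDist l) l) (P.deriv l) (hd l) P.cont
      (continuous_trig ((hc.partialDist l).partialDist l)) hK, mul_neg, Complex.neg_re, neg_neg,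
      ← integral_const_mul, ← integral_const_mul]
    have := Complex.reCLM.integral_comp_comm ((hI l).const_mul (Complex.I + μ))
    simp only [Complex.reCLM_apply] at this
    rw [← this]
    refine integral_mono (integrable_torus ?_) ?_ fun x => ?_
    · exact (((hd l).norm.pow 2).mul (continuous_norm_trig_rpow hc hp2)).const_mul _
    · exact ((hI l).const_mul _).re
    · exact le_re_mul_dualMapDeriv hcμ hq _ _
  have hG : trigGrad p c = ∑ l, ∫ x, ‖trig (partialDist l c) x‖ ^ 2 * ‖trig c x‖ ^ (p - 2) ∂torusMeasure := by
    rw [trigGrad, ← integral_finsetSum]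
    · simp only [Finset.sum_mul]
    · exact fun l _ => integrable_torus (((hd l).norm.pow 2).mul (continuous_norm_trig_rpow hc hp2))
  rw [hG, Finset.mul_sum, Finset.mul_sum, Complex.re_sum, ← Finset.sum_neg_distrib]
  exact Finset.sum_le_sum fun l _ => le_neg_of_le_neg (hl l)

/-! ### Young-type inequalities and absorption of the driver. -/

lemma rpow_le_one_add_rpow {a e e' : ℝ} (ha : 0 ≤ a) (he : 0 ≤ e) (hee : e ≤ e') :
    a ^ e ≤ 1 + a ^ e' := by
  have h0 : 0 ≤ a ^ e' := Real.rpow_nonneg ha _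
  rcases le_total a 1 with h | h
  · linarith [Real.rpow_le_one ha h he]
  · linarith [Real.rpow_le_rpow_of_exponent_le h hee]

/-- Either $X^2\le\eta a$, and the first term on the right suffices, or $a\le X^2/\eta$, and the
left side is a multiple of $X^2(X^2)^{p+1}$. This is the origin of the exponent $2(p+2)$. -/
lemma sq_mul_rpow_le {X a p η : ℝ} (hX : 1 ≤ X) (ha : 0 ≤ a) (hp : 2 ≤ p) (hη : 0 < η) :
    X ^ 2 * a ^ (p + 1) ≤ η * a ^ (p + 2) + η ^ (-(p + 1)) * X ^ (2 * (p + 2)) := by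
  have hX0 : 0 < X := by linarith
  have e1 : a ^ (p + 2) = a * a ^ (p + 1) := by
    rw [mul_comm, ← Real.rpow_add_one' ha (by linarith)]; congr 1; ring
  have h1 : 0 ≤ a ^ (p + 1) := Real.rpow_nonneg ha _
  rcases le_total (X ^ 2) (η * a) with h | h
  · have h2 : 0 ≤ η ^ (-(p + 1)) * X ^ (2 * (p + 2)) := by positivity
    have h3 := mul_le_mul_of_nonneg_right h h1
    rw [e1]
    linarith
  · have h2 : a ≤ η⁻¹ * X ^ 2 := by rw [inv_mul_eq_div, le_div_iff₀ hη]; linarith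
    have h3 : a ^ (p + 1) ≤ η ^ (-(p + 1)) * (X ^ 2) ^ (p + 1) := by
      rw [Real.rpow_neg hη.le, ← Real.inv_rpow hη.le, ← Real.mul_rpow (by positivity) (by positivity)]
      exact Real.rpow_le_rpow ha h2 (by linarith)
    have h4 : X ^ 2 * (X ^ 2) ^ (p + 1) = X ^ (2 * (p + 2)) := by
      rw [mul_comm, ← Real.rpow_add_one (by positivity), ← Real.rpow_natCast,
        ← Real.rpow_mul hX0.le]
      congr 1
      push_cast
      ring
    have h5 : 0 ≤ η * a ^ (p + 2) := by positivity
    calc _ ≤ X ^ 2 * (η ^ (-(p + 1)) * (X ^ 2) ^ (p + 1)) := by gcongr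
      _ = η ^ (-(p + 1)) * X ^ (2 * (p + 2)) := by rw [← h4]; ring
      _ ≤ _ := by linarith

lemma sqrt_mul_le_add {a b η : ℝ} (ha : 0 ≤ a) (hb : 0 ≤ b) (hη : 0 < η) :
    Real.sqrt (a * b) ≤ a / (4 * η) + η * b := by
  refine Real.sqrt_le_iff.2 ⟨by positivity, ?_⟩
  have h : (a / (4 * η) + η * b) ^ 2 - a * b = (a / (4 * η) - η * b) ^ 2 := by
    field_simp
    ring
  nlinarith [sq_nonneg (a / (4 * η) - η * b)]

/-- Young's inequality in the form used to absorb the driver. -/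
lemma exists_young {p K δ : ℝ} (hp : 2 ≤ p) (hK : 0 ≤ K) (hδ : 0 < δ) : ∃ C : ℝ, 0 < C ∧
    ∀ X V G J : ℝ, 1 ≤ X → 0 ≤ V → 0 ≤ G → 0 ≤ J →
      (∀ η, 0 < η → X ^ 2 * J ≤ η * V + η ^ (-(p + 1)) * X ^ (2 * (p + 2))) →
      X * ((1 + J) + Real.sqrt ((1 + J) * (K * (1 + V + G)))) ≤
        δ * (V + G) + C * X ^ (2 * (p + 2)) := by
  -- Splitting the square root with weight $\delta/2$ on $1+V+G$ leaves the factor $K/(4(\delta/2))$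
  -- on $X^2(1+J)$; the added one accounts for the term $X(1+J)$.
  set L := 1 + K / (4 * (δ / 2))
  have hL : 0 < L := by positivity
  refine ⟨δ / 2 + L * (1 + (δ / 2 / L) ^ (-(p + 1))), by positivity, fun X V G J hX hV hG hJ h => ?_⟩
  have hX0 : 0 < X := by linarith
  have h1 := h (δ / 2 / L) (by positivity)
  set W := X ^ (2 * (p + 2))
  have hXW : X ^ 2 ≤ W := by
    rw [← Real.rpow_natCast]
    exact Real.rpow_le_rpow_of_exponent_le hX (by push_cast; linarith)
  have hW : 1 ≤ W := (one_le_pow₀ hX).trans hXW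
  have h2 : X * Real.sqrt ((1 + J) * (K * (1 + V + G))) ≤
      X ^ 2 * (1 + J) * (K / (4 * (δ / 2))) + δ / 2 * (1 + V + G) := by
    have e : X * Real.sqrt ((1 + J) * (K * (1 + V + G)))
        = Real.sqrt ((X ^ 2 * (1 + J) * K) * (1 + V + G)) := by
      rw [show X ^ 2 * (1 + J) * K * (1 + V + G) = X ^ 2 * ((1 + J) * (K * (1 + V + G))) by ring,
        Real.sqrt_mul (sq_nonneg X), Real.sqrt_sq hX0.le]
    rw [e]
    refine (sqrt_mul_le_add (by positivity) (by positivity) (half_pos hδ)).trans (le_of_eq ?_)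
    ring
  have h3 : X * (1 + J) ≤ X ^ 2 * (1 + J) := by
    have : X ≤ X ^ 2 := by nlinarith
    gcongr
  have h4 : L * (X ^ 2 * J) ≤ δ / 2 * V + L * ((δ / 2 / L) ^ (-(p + 1)) * W) := by
    refine (mul_le_mul_of_nonneg_left h1 hL.le).trans (le_of_eq ?_)
    rw [mul_add, ← mul_assoc L, mul_div_cancel₀ _ hL.ne']
  have h5 : L * X ^ 2 ≤ L * W := by gcongr
  have h6 : δ / 2 * 1 ≤ δ / 2 * W := by gcongr
  have h7 : L * (X ^ 2 * (1 + J)) = X ^ 2 * (1 + J) + X ^ 2 * (1 + J) * (K / (4 * (δ / 2))) := by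
    simp only [L]; ring
  have hGd : 0 ≤ δ / 2 * G := by positivity
  calc _ = X * (1 + J) + X * Real.sqrt ((1 + J) * (K * (1 + V + G))) := by ring
    _ ≤ L * (X ^ 2 * (1 + J)) + δ / 2 * (1 + V + G) := by linarith
    _ = L * X ^ 2 + L * (X ^ 2 * J) + δ / 2 * 1 + δ / 2 * V + δ / 2 * G := by ring
    _ ≤ δ / 2 * W + L * W + L * ((δ / 2 / L) ^ (-(p + 1)) * W) + δ * V + δ / 2 * G := by linarith
    _ ≤ _ := by
      have : δ / 2 * G ≤ δ * G := by gcongr; linarith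
      linarith

/-- Split $a^{r-1}v=(a^{(p-2)/2}v)\,a^{r-p/2}$ and complete the square. The second factor squared
has exponent $2r-p$, which lies in $[0,p+2]$ exactly thanks to the restrictions on $r$. -/
lemma rpow_mul_le_density {a v r p : ℝ} (ha : 0 ≤ a) (hp : 2 ≤ p) (hr : p - 1 ≤ r) (hr' : r ≤ p + 1) :
    a ^ (r - 1) * v ≤ 1 / 2 * (v ^ 2 * a ^ (p - 2)) + 1 / 2 * (1 + a ^ (p + 2)) := by
  have e1 : a ^ (r - 1) = a ^ ((p - 2) / 2) * a ^ (r - p / 2) := by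
    rw [← Real.rpow_add_of_nonneg ha (by linarith) (by linarith)]; congr 1; ring
  have e2 : a ^ (p - 2) = (a ^ ((p - 2) / 2)) ^ 2 := by
    rw [← Real.rpow_natCast, ← Real.rpow_mul ha]; congr 1; push_cast; ring
  have e3 : (a ^ (r - p / 2)) ^ 2 ≤ 1 + a ^ (p + 2) := by
    rw [← Real.rpow_natCast, ← Real.rpow_mul ha]
    exact rpow_le_one_add_rpow ha (by push_cast; linarith) (by push_cast; linarith)
  rw [e1, e2]
  nlinarith [sq_nonneg (a ^ ((p - 2) / 2) * v - a ^ (r - p / 2))]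

lemma PowerLike.mono {y : Torus2 → ℂ} {dy : Fin 2 → Torus2 → ℂ} {r K K' : ℝ} {f : Torus2 → ℂ}
    {f' : Fin 2 → Torus2 → ℂ} (h : PowerLike y dy r K f f') (hK : K ≤ K') :
    PowerLike y dy r K' f f' :=
  ⟨h.cont, h.deriv, h.norm_le, fun l x => (h.norm_deriv_le l x).trans (by gcongr)⟩

lemma PowerLike.exists_deriv_bound {c : TorusDist} (hc : FinSupp c) {r K : ℝ} (hr : 1 ≤ r)
    (hK : 0 ≤ K) {f : Torus2 → ℂ} {f' : Fin 2 → Torus2 → ℂ}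
    (h : PowerLike (trig c) (fun l => trig (partialDist l c)) r K f f') :
    ∃ B, ∀ l x, ‖f' l x‖ ≤ B := by
  obtain ⟨A, hA0, hA⟩ := exists_norm_le_of_continuous (continuous_trig hc)
  have h1 := fun l => exists_norm_le_of_continuous (continuous_trig (hc.partialDist l))
  choose B hB0 hB using h1
  refine ⟨∑ l, K * (A ^ (r - 1) * B l), fun l x => (h.norm_deriv_le l x).trans ?_⟩
  refine le_trans ?_ (Finset.single_le_sum (f := fun l => K * (A ^ (r - 1) * B l))
    (fun l _ => by have := hB0 l; positivity) (Finset.mem_univ l))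
  have := hA x
  have := hB l x
  have : 0 ≤ r - 1 := by linarith
  gcongr

lemma PowerLike.integral_bounds {c : TorusDist} (hc : FinSupp c) {p r K : ℝ} (hp : 2 ≤ p)
    (hr : p - 1 ≤ r) (hr' : r ≤ p + 1) (hK : 0 ≤ K) {f : Torus2 → ℂ} {f' : Fin 2 → Torus2 → ℂ}
    (h : PowerLike (trig c) (fun l => trig (partialDist l c)) r K f f') :
    ∫ x, ‖f x‖ ∂torusMeasure ≤ 1 + trigPow (p + 1) c ∧
      ∑ l, ∫ x, ‖f' l x‖ ∂torusMeasure ≤ K * (1 + trigPow (p + 2) c + trigGrad p c) := by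
  have i1 := integrable_torus (continuous_norm_trig_rpow hc (show 0 ≤ p + 1 by linarith))
  have i2 := integrable_torus (continuous_norm_trig_rpow hc (show 0 ≤ p + 2 by linarith))
  have i3 : ∀ l, Integrable (fun x => ‖trig (partialDist l c) x‖ ^ 2 * ‖trig c x‖ ^ (p - 2))
      torusMeasure := fun l =>
    integrable_torus (((continuous_trig (hc.partialDist l)).norm.pow 2).mul
      (continuous_norm_trig_rpow hc (by linarith)))
  have i4 : Integrable (fun x => 1 + ‖trig c x‖ ^ (p + 2)) torusMeasure :=
    (integrable_const _).add i2
  obtain ⟨B, hB⟩ := h.exists_deriv_bound hc (by linarith) hK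
  constructor
  · have : (1 : ℝ) + trigPow (p + 1) c = ∫ x, (1 + ‖trig c x‖ ^ (p + 1)) ∂torusMeasure := by
      rw [integral_add (integrable_const _) i1]; simp [trigPow]
    rw [this]
    exact integral_mono (integrable_torus h.cont.norm) ((integrable_const _).add i1) fun x =>
      (h.norm_le x).trans (rpow_le_one_add_rpow (norm_nonneg _) (by linarith) hr')
  · have hG : trigGrad p c = ∑ l, ∫ x, ‖trig (partialDist l c) x‖ ^ 2 * ‖trig c x‖ ^ (p - 2)
        ∂torusMeasure := by
      rw [trigGrad, ← integral_finsetSum _ fun l _ => i3 l]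
      simp only [Finset.sum_mul]
    have hl : ∀ l, ∫ x, ‖f' l x‖ ∂torusMeasure ≤ K * (1 / 2 * ∫ x, ‖trig (partialDist l c) x‖ ^ 2
        * ‖trig c x‖ ^ (p - 2) ∂torusMeasure + 1 / 2 * (1 + trigPow (p + 2) c)) := by
      intro l
      have e : K * (1 / 2 * ∫ x, ‖trig (partialDist l c) x‖ ^ 2 * ‖trig c x‖ ^ (p - 2) ∂torusMeasure
          + 1 / 2 * (1 + trigPow (p + 2) c)) = ∫ x, K * (1 / 2 * (‖trig (partialDist l c) x‖ ^ 2
          * ‖trig c x‖ ^ (p - 2)) + 1 / 2 * (1 + ‖trig c x‖ ^ (p + 2))) ∂torusMeasure := by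
        rw [integral_const_mul, integral_add ((i3 l).const_mul _) (i4.const_mul _), integral_const_mul,
          integral_const_mul, integral_add (integrable_const _) i2]
        simp [trigPow]
      rw [e]
      refine integral_mono (integrable_of_hasPD (h.deriv l) h.cont (hB l)).norm
        ((((i3 l).const_mul _).add (i4.const_mul _)).const_mul K) fun x => ?_
      exact (h.norm_deriv_le l x).trans (mul_le_mul_of_nonneg_left
        (rpow_mul_le_density (norm_nonneg _) hp hr hr') hK)
    refine (Finset.sum_le_sum fun l _ => hl l).trans ?_
    rw [← Finset.mul_sum, Finset.sum_add_distrib, ← Finset.mul_sum, ← hG]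
    simp only [Finset.sum_const, Finset.card_univ, Fintype.card_fin, nsmul_eq_mul]
    have := trigGrad_nonneg p c
    refine mul_le_mul_of_nonneg_left ?_ hK
    push_cast
    linarith

/-- A driver term paired with a power of the solution is absorbed by the good terms. -/
theorem exists_absorb {α p K δ : ℝ} (hα : 0 < α) (hα' : α < 1 / 2) (hp : 2 ≤ p) (hK : 0 ≤ K)
    (hδ : 0 < δ) : ∃ C : ℝ, 0 < C ∧ ∀ (c : TorusDist), FinSupp c → ∀ X : ℝ, 1 ≤ X →
      trigPow p c ≤ δ * (trigPow (p + 2) c + trigGrad p c) + C * X ^ (2 * (p + 2)) ∧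
      ∀ (r : ℝ) (f : Torus2 → ℂ) (f' : Fin 2 → Torus2 → ℂ), p - 1 ≤ r → r ≤ p + 1 →
        PowerLike (trig c) (fun l => trig (partialDist l c)) r K f f' →
        ∀ (u : TorusDist), BesovLE (-α) u X → ∀ N : ℕ,
          ‖∫ x, trig (lowPass N u) x * f x ∂torusMeasure‖ ≤
            δ * (trigPow (p + 2) c + trigGrad p c) + C * X ^ (2 * (p + 2)) := by
  obtain ⟨C₁, hC₁, h₁⟩ := exists_pairing_bound hα hα'
  -- Dividing by $1+C_1$ anticipates the pairing constant; the additional one lets the same bound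
  -- also serve for $\|Y\|_{L^p}^p$, which involves no pairing.
  obtain ⟨C₂, hC₂, h₂⟩ := exists_young hp hK (δ := δ / (1 + C₁)) (by positivity)
  refine ⟨(1 + C₁) * C₂, by positivity, fun c hc X hX => ?_⟩
  have i1 := integrable_torus (continuous_norm_trig_rpow hc (show 0 ≤ p + 1 by linarith))
  have i2 := integrable_torus (continuous_norm_trig_rpow hc (show 0 ≤ p + 2 by linarith))
  have hY : ∀ η, 0 < η → X ^ 2 * trigPow (p + 1) c ≤
      η * trigPow (p + 2) c + η ^ (-(p + 1)) * X ^ (2 * (p + 2)) := by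
    intro η hη
    have e : η * trigPow (p + 2) c + η ^ (-(p + 1)) * X ^ (2 * (p + 2))
        = ∫ x, (η * ‖trig c x‖ ^ (p + 2) + η ^ (-(p + 1)) * X ^ (2 * (p + 2))) ∂torusMeasure := by
      rw [integral_add (i2.const_mul _) (integrable_const _), integral_const_mul]
      simp [trigPow]
    rw [e, trigPow, ← integral_const_mul]
    exact integral_mono (i1.const_mul _) ((i2.const_mul _).add (integrable_const _)) fun x =>
      sq_mul_rpow_le hX (norm_nonneg _) hp hη
  have key := h₂ X _ _ _ hX (trigPow_nonneg (p + 2) c) (trigGrad_nonneg p c)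
    (trigPow_nonneg (p + 1) c) hY
  set V := trigPow (p + 2) c
  set G := trigGrad p c
  set J := trigPow (p + 1) c
  have hJ : 0 ≤ J := trigPow_nonneg _ _
  set R := (1 + J) + Real.sqrt ((1 + J) * (K * (1 + V + G)))
  have hR : 0 ≤ R := by positivity
  have hfin : (1 + C₁) * (X * R) ≤ δ * (V + G) + (1 + C₁) * C₂ * X ^ (2 * (p + 2)) := by
    refine (mul_le_mul_of_nonneg_left key (by positivity)).trans (le_of_eq ?_)
    rw [mul_add, ← mul_assoc, mul_div_cancel₀ _ (by positivity), ← mul_assoc]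
  have hXR : 0 ≤ X * R := by positivity
  refine ⟨?_, fun r f f' hr hr' hf u hu N => ?_⟩
  · refine le_trans ?_ hfin
    have h1 : trigPow p c ≤ 1 + J := by
      have : (1 : ℝ) + J = ∫ x, (1 + ‖trig c x‖ ^ (p + 1)) ∂torusMeasure := by
        rw [integral_add (integrable_const _) i1]; simp [J, trigPow]
      rw [this]
      exact integral_mono (integrable_torus (continuous_norm_trig_rpow hc (by linarith)))
        ((integrable_const _).add i1) fun x =>
          rpow_le_one_add_rpow (norm_nonneg _) (by linarith) (by linarith)
    have h2 : 1 + J ≤ R := le_add_of_nonneg_right (Real.sqrt_nonneg _)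
    have h3 : R ≤ X * R := le_mul_of_one_le_left hR hX
    nlinarith
  · refine le_trans ?_ hfin
    obtain ⟨B, hB⟩ := hf.exists_deriv_bound hc (by linarith) hK
    obtain ⟨b1, b2⟩ := hf.integral_bounds hc hp hr hr' hK
    refine (h₁ u X hu N f f' B hf.cont hf.deriv hB _ _ b1 b2).trans ?_
    rw [mul_assoc]
    gcongr
    linarith

lemma FinSupp.conjDist {c : TorusDist} (hc : FinSupp c) : FinSupp (conjDist c) :=
  Set.Finite.subset (Set.Finite.image (fun k => -k) hc) fun k hk => ⟨-k, fun h => hk (by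
    simp [_root_.conjDist, h]), neg_neg k⟩

lemma finSupp_psi {ν lam : ℂ} {y z q s w : TorusDist} (hy : FinSupp y) (hz : FinSupp z)
    (hq : FinSupp q) (hs : FinSupp s) (hw : FinSupp w) : FinSupp (psi ν lam y z q s w) := by
  have hyc := hy.conjDist
  have h1 := hy.mulDist hyc
  exact ((hz.add hy).smul _).sub ((((((h1.mulDist hy).add ((hz.mulDist h1).smul _)).add
    (hz.conjDist.mulDist (hy.mulDist hy))).add ((hs.mulDist hy).smul _)).add (hq.mulDist hyc)).add
    hw |>.smul _)

lemma trig_psi {ν lam : ℂ} {y z q s w : TorusDist} (hy : FinSupp y) (hz : FinSupp z)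
    (hq : FinSupp q) (hs : FinSupp s) (hw : FinSupp w) (x : Torus2) :
    trig (psi ν lam y z q s w) x = (1 + lam) * (trig z x + trig y x)
      - ν * (trig y x * (starRingEnd ℂ) (trig y x) * trig y x
        + 2 * (trig z x * (trig y x * (starRingEnd ℂ) (trig y x)))
        + trig (conjDist z) x * (trig y x * trig y x) + 2 * (trig s x * trig y x)
        + trig q x * (starRingEnd ℂ) (trig y x) + trig w x) := by
  have hyc := hy.conjDist
  have h1 := hy.mulDist hyc
  have g1 := h1.mulDist hy
  have g2 := (hz.mulDist h1).smul 2
  have g3 := hz.conjDist.mulDist (hy.mulDist hy)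
  have g4 := (hs.mulDist hy).smul 2
  have g5 := hq.mulDist hyc
  have k2 := g1.add g2
  have k3 := k2.add g3
  have k4 := k3.add g4
  have k5 := k4.add g5
  rw [psi, trig_sub ((hz.add hy).smul _) ((k5.add hw).smul _), trig_smul, trig_smul, trig_add hz hy,
    trig_add k5 hw, trig_add k4 g5, trig_add k3 g4, trig_add k2 g3, trig_add g1 g2,
    trig_smul, trig_smul, trig_mulDist h1 hy, trig_mulDist hy hyc, trig_mulDist hz h1,
    trig_mulDist hy hyc, trig_mulDist hz.conjDist (hy.mulDist hy), trig_mulDist hy hy,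
    trig_mulDist hs hy, trig_mulDist hq hyc, trig_conjDist y]

lemma dualMap_mul_self {p : ℝ} (hp : 2 ≤ p) (z : ℂ) : dualMap p z * z = ((‖z‖ ^ p : ℝ) : ℂ) := by
  have h : ‖z‖ ^ p = ‖z‖ ^ (p - 2) * ‖z‖ ^ (2 : ℕ) := by
    rw [← Real.rpow_natCast, ← Real.rpow_add_of_nonneg (norm_nonneg _) (by linarith) (by norm_num)]
    congr 1
    push_cast
    ring
  rw [dualMap, mul_assoc, mul_comm _ z, Complex.mul_conj, Complex.normSq_eq_norm_sq, h]
  push_cast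
  ring

/-- The contribution of the nonlinearity. -/
theorem exists_forcing_estimate {α p δ : ℝ} (hα : 0 < α) (hα' : α < 1 / 2) (hp : 2 ≤ p)
    (hδ : 0 < δ) (ν lam : ℂ) : ∃ C : ℝ, 0 < C ∧ ∀ (c : TorusDist), FinSupp c → ∀ X : ℝ, 1 ≤ X →
      ∀ z q s w : TorusDist, BesovLE (-α) z X → BesovLE (-α) q X → BesovLE (-α) s X →
        BesovLE (-α) w X → ∀ N : ℕ,
        (∫ x, trig (psi ν lam c (lowPass N z) (lowPass N q) (lowPass N s) (lowPass N w)) x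
          * dualMap p (trig c x) ∂torusMeasure).re ≤
          -(ν.re * trigPow (p + 2) c) + δ * (trigPow (p + 2) c + trigGrad p c)
            + C * X ^ (2 * (p + 2)) := by
  -- The coefficients of the error terms add up: $1+\lambda$ occurs twice, with $Z$ and with
  -- $|Y|^p$, and the five driver terms multiplied by $\nu$ have total weight $2+1+2+1+1=7$. The
  -- final one keeps $L$ positive.
  set L := 2 * ‖1 + lam‖ + 7 * ‖ν‖ + 1
  have hL : 0 < L := by positivity
  obtain ⟨C, hC, h⟩ := exists_absorb hα hα' hp (K := p + 1) (δ := δ / L) (by linarith) (by positivity)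
  refine ⟨L * C, by positivity, fun c hc X hX z q s w hz hq hs hw N => ?_⟩
  obtain ⟨hp0, hf⟩ := h c hc X hX
  set E := δ / L * (trigPow (p + 2) c + trigGrad p c) + C * X ^ (2 * (p + 2))
  have hE : 0 ≤ E := by
    have := trigPow_nonneg (p + 2) c
    have := trigGrad_nonneg p c
    positivity
  have hy := continuous_trig hc
  have hpd := hasPD_trig hc
  have hyc : Continuous fun x => (starRingEnd ℂ) (trig c x) := Complex.continuous_conj.comp hy
  have hpdc := fun l => (hpd l).conj
  -- The test functions have degree $p-1$ (against $Z$ and $|Z|^2Z$), $p$ (against $|Z|^2$ and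
  -- $Z^2$) and $p+1$ (against $Z$ and $\overline Z$). Their derivative constants are at most $p+1$,
  -- the value of `K` passed to `exists_absorb`.
  have P0 := PowerLike.dualMap hp hy hpd
  have P1 := P0.mul (by linarith) hy hpd (fun _ => rfl) (fun _ _ => rfl)
  have P1c := P0.mul (by linarith) hyc hpdc (fun _ => RCLike.norm_conj _) (fun _ _ => RCLike.norm_conj _)
  have P2 := P1.mul (by linarith) hyc hpdc (fun _ => RCLike.norm_conj _) (fun _ _ => RCLike.norm_conj _)
  have P2y := P1.mul (by linarith) hy hpd (fun _ => rfl) (fun _ _ => rfl)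
  have e1 := hf _ _ _ (by linarith) (by linarith) (P0.mono (by linarith)) z hz N
  have e2 := hf _ _ _ (by linarith) (by linarith) (P2.mono (by linarith)) z hz N
  have e3 := hf _ _ _ (by linarith) (by linarith) (P2y.mono (by linarith)) _ hz.conj N
  have e4 := hf _ _ _ (by linarith) (by linarith) (P1.mono (by linarith)) s hs N
  have e5 := hf _ _ _ (by linarith) (by linarith) (P1c.mono (by linarith)) q hq N
  have e6 := hf _ _ _ (by linarith) (by linarith) (P0.mono (by linarith)) w hw N
  have fz := finSupp_lowPass N z
  have fq := finSupp_lowPass N q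
  have fs := finSupp_lowPass N s
  have fw := finSupp_lowPass N w
  have fzc := finSupp_lowPass N (conjDist z)
  have i1 := integrable_torus ((continuous_trig fz).fun_mul P0.cont)
  have i2 := integrable_torus ((continuous_trig fz).fun_mul P2.cont)
  have i3 := integrable_torus ((continuous_trig fzc).fun_mul P2y.cont)
  have i4 := integrable_torus ((continuous_trig fs).fun_mul P1.cont)
  have i5 := integrable_torus ((continuous_trig fq).fun_mul P1c.cont)
  have i6 := integrable_torus ((continuous_trig fw).fun_mul P0.cont)
  have i7 : Integrable (fun x => ((‖trig c x‖ ^ p : ℝ) : ℂ)) torusMeasure :=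
    (integrable_torus (continuous_norm_trig_rpow hc (by linarith))).ofReal
  have i8 : Integrable (fun x => ((‖trig c x‖ ^ (p + 2) : ℝ) : ℂ)) torusMeasure :=
    (integrable_torus (continuous_norm_trig_rpow hc (by linarith))).ofReal
  have hpt : ∀ x, trig (psi ν lam c (lowPass N z) (lowPass N q) (lowPass N s) (lowPass N w)) x
      * dualMap p (trig c x) = (1 + lam) * (trig (lowPass N z) x * dualMap p (trig c x))
        + (1 + lam) * ((‖trig c x‖ ^ p : ℝ) : ℂ) + -ν * ((‖trig c x‖ ^ (p + 2) : ℝ) : ℂ)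
        + -(2 * ν) * (trig (lowPass N z) x * (dualMap p (trig c x) * trig c x * (starRingEnd ℂ) (trig c x)))
        + -ν * (trig (lowPass N (conjDist z)) x * (dualMap p (trig c x) * trig c x * trig c x))
        + -(2 * ν) * (trig (lowPass N s) x * (dualMap p (trig c x) * trig c x))
        + -ν * (trig (lowPass N q) x * (dualMap p (trig c x) * (starRingEnd ℂ) (trig c x)))
        + -ν * (trig (lowPass N w) x * dualMap p (trig c x)) := by
    intro x
    have hV : ((‖trig c x‖ ^ (p + 2) : ℝ) : ℂ)
        = dualMap p (trig c x) * trig c x * (trig c x * (starRingEnd ℂ) (trig c x)) := by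
      rw [dualMap_mul_self hp, Complex.mul_conj, Complex.normSq_eq_norm_sq, ← Complex.ofReal_mul]
      congr 1
      rw [← Real.rpow_natCast, ← Real.rpow_add_of_nonneg (norm_nonneg _) (by linarith) (by norm_num)]
      rfl
    rw [trig_psi hc fz fq fs fw, ← lowPass_conjDist, hV, ← dualMap_mul_self hp]
    ring
  simp only [hpt]
  have j1 := (i1.const_mul (1 + lam)).fun_add (i7.const_mul (1 + lam))
  have j2 := j1.fun_add (i8.const_mul (-ν))
  have j3 := j2.fun_add (i2.const_mul (-(2 * ν)))
  have j4 := j3.fun_add (i3.const_mul (-ν))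
  have j5 := j4.fun_add (i4.const_mul (-(2 * ν)))
  have j6 := j5.fun_add (i5.const_mul (-ν))
  rw [integral_add j6 (i6.const_mul _), integral_add j5 (i5.const_mul _),
    integral_add j4 (i4.const_mul _), integral_add j3 (i3.const_mul _),
    integral_add j2 (i2.const_mul _), integral_add j1 (i8.const_mul _),
    integral_add (i1.const_mul _) (i7.const_mul _)]
  simp only [integral_const_mul, integral_complex_ofReal]
  have hre : ∀ (a I : ℂ), ‖I‖ ≤ E → |(a * I).re| ≤ ‖a‖ * E := fun a I hI =>
    (Complex.abs_re_le_norm _).trans (by rw [norm_mul]; gcongr)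
  have r1 := (abs_le.1 (hre (1 + lam) _ e1)).2
  have r2 := (abs_le.1 (hre (-(2 * ν)) _ e2)).2
  have r3 := (abs_le.1 (hre (-ν) _ e3)).2
  have r4 := (abs_le.1 (hre (-(2 * ν)) _ e4)).2
  have r5 := (abs_le.1 (hre (-ν) _ e5)).2
  have r6 := (abs_le.1 (hre (-ν) _ e6)).2
  have r7 := (abs_le.1 (hre (1 + lam) ((trigPow p c : ℝ) : ℂ) (by
    rw [Complex.norm_real, Real.norm_of_nonneg (trigPow_nonneg _ _)]; exact hp0))).2
  have hν2 : ‖-(2 * ν)‖ = 2 * ‖ν‖ := by simp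
  rw [hν2] at r2 r4
  rw [norm_neg] at r3 r5 r6
  have r8 : (-ν * ((trigPow (p + 2) c : ℝ) : ℂ)).re = -(ν.re * trigPow (p + 2) c) := by
    rw [Complex.re_mul_ofReal, Complex.neg_re, neg_mul]
  have hLE : L * E = δ * (trigPow (p + 2) c + trigGrad p c) + L * C * X ^ (2 * (p + 2)) := by
    simp only [E]
    rw [mul_add, ← mul_assoc, mul_div_cancel₀ _ hL.ne', ← mul_assoc]
  have hLE' : L * E = 2 * (‖1 + lam‖ * E) + 7 * (‖ν‖ * E) + E := by simp only [L]; ring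
  simp only [trigPow] at r7 r8 hLE ⊢
  simp only [Complex.add_re]
  linarith

/-! ### Differentiation of the $L^p$ norm in time. -/

lemma hasDerivAt_norm_rpow_comp {p : ℝ} (hp : 2 ≤ p) {u : ℝ → ℂ} {v : ℂ} {s : ℝ}
    (hu : HasDerivAt u v s) : HasDerivAt (fun r => ‖u r‖ ^ p) (p * (v * dualMap p (u s)).re) s := by
  refine ((hasFDerivAt_norm_rpow (u s) (by linarith : 1 < p)).comp_hasDerivAt s hu).congr_deriv ?_
  have : v * dualMap p (u s) = ((‖u s‖ ^ (p - 2) : ℝ) : ℂ) * (v * (starRingEnd ℂ) (u s)) := by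
    rw [dualMap]; ring
  rw [this, Complex.re_ofReal_mul]
  simp only [smul_apply, innerSL_apply_apply, Complex.inner, smul_eq_mul]
  ring_nf

/-- Differentiation of the `L^p` norm along a curve of trigonometric polynomials. -/
lemma hasDerivAt_trigPow {p : ℝ} (hp : 2 ≤ p) {c g : ℝ → TorusDist} {F : Finset (Fin 2 → ℤ)} {a b K L : ℝ}
    (hcF : ∀ s, ∀ k ∉ F, c s k = 0) (hgF : ∀ s, ∀ k ∉ F, g s k = 0)
    (hd : ∀ s ∈ Ioo a b, ∀ k, HasDerivAt (fun r => c r k) (g s k) s)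
    (hK : ∀ s ∈ Ioo a b, ∀ x, ‖trig (c s) x‖ ≤ K) (hL : ∀ s ∈ Ioo a b, ∀ x, ‖trig (g s) x‖ ≤ L)
    {s : ℝ} (hs : s ∈ Ioo a b) :
    HasDerivAt (fun r => trigPow p (c r))
      (p * (∫ x, trig (g s) x * dualMap p (trig (c s) x) ∂torusMeasure).re) s := by
  have hc := fun r => FinSupp.of_finset F (hcF r)
  have hg := fun r => FinSupp.of_finset F (hgF r)
  have hcont : ∀ r, Continuous fun x => trig (g r) x * dualMap p (trig (c r) x) := fun r =>
    (continuous_trig (hg r)).mul ((continuous_dualMap hp).comp (continuous_trig (hc r)))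
  have hpt : ∀ r ∈ Ioo a b, ∀ x, HasDerivAt (fun r => ‖trig (c r) x‖ ^ p)
      (p * (trig (g r) x * dualMap p (trig (c r) x)).re) r := by
    intro r hr x
    refine hasDerivAt_norm_rpow_comp hp ?_
    have e : (fun r => trig (c r) x) = fun r => ∑ k ∈ F, c r k * mFourier k x :=
      funext fun r => trig_eq_sum (hcF r) x
    rw [e, trig_eq_sum (hgF r)]
    exact HasDerivAt.fun_sum fun k _ => (hd r hr k).mul_const _
  have hK0 : 0 ≤ K := (norm_nonneg _).trans (hK s hs 0)
  have hL0 : 0 ≤ L := (norm_nonneg _).trans (hL s hs 0)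
  have key := (hasDerivAt_integral_of_dominated_loc_of_deriv_le (μ := torusMeasure) (x₀ := s)
    (F := fun r x => ‖trig (c r) x‖ ^ p)
    (F' := fun r x => p * (trig (g r) x * dualMap p (trig (c r) x)).re)
    (bound := fun _ => p * (L * K ^ (p - 1))) (s := Ioo a b)
    (isOpen_Ioo.mem_nhds hs)
    (.of_forall fun r => (continuous_norm_trig_rpow (hc r) (by linarith)).aestronglyMeasurable)
    (integrable_torus (continuous_norm_trig_rpow (hc s) (by linarith)))
    (((Complex.continuous_re.comp (hcont s)).const_mul p).aestronglyMeasurable)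
    (.of_forall fun x r hr => ?_) (integrable_const _)
    (.of_forall fun x r hr => hpt r hr x)).2
  · refine key.congr_deriv ?_
    rw [integral_const_mul]
    congr 1
    exact Complex.reCLM.integral_comp_comm (integrable_torus (hcont s))
  · rw [norm_mul, Real.norm_of_nonneg (by linarith : 0 ≤ p), Real.norm_eq_abs]
    have h1 := hK r hr x
    have h2 := hL r hr x
    have hp1 : 0 ≤ p - 1 := by linarith
    refine mul_le_mul_of_nonneg_left ((Complex.abs_re_le_norm _).trans ?_) (by linarith)
    rw [norm_mul, norm_dualMap hp]
    gcongr

/-! Truncation of the nonlinearity. -/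

lemma lowPass_partialDist (N : ℕ) (l : Fin 2) (u : TorusDist) :
    lowPass N (partialDist l u) = partialDist l (lowPass N u) := by
  ext k; simp only [lowPass, partialDist]; ring

/-- Lets the pairing bound, which is stated for truncations, be applied to any trigonometric
polynomial. -/
lemma FinSupp.exists_lowPass_eq {c : TorusDist} (hc : FinSupp c) : ∃ N, lowPass N c = c := by
  obtain ⟨F, hF⟩ := hc.exists_finset
  have h := fun k => exists_lpCutoff_eq_one k
  choose n hn using h
  refine ⟨F.sup n, funext fun k => ?_⟩
  by_cases hk : k ∈ F
  · rw [lowPass, hn k _ (Finset.le_sup hk)]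
    simp
  · simp [lowPass, hF k hk]

lemma exists_lowPass_close {σ : ℝ} (hσ : 0 < σ) : ∃ C : ℝ, 0 < C ∧ ∀ (β : ℝ) (u : TorusDist) (M : ℝ),
    BesovLE β u M → ∀ N, BesovClose (β - σ) (lowPass N u) u (C * M) (dyad (-σ) N) := by
  obtain ⟨C, hC, h⟩ := exists_lowPass_besov
  have h2 : (1 : ℝ) ≤ 2 ^ σ := Real.one_le_rpow (by norm_num) hσ.le
  refine ⟨2 ^ σ * C, by positivity, fun β u M hu N => ?_⟩
  obtain ⟨h1, h3⟩ := h β u M hu N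
  have hM := hu.nonneg
  have hd := dyad_pos (-σ) N
  have e : β - (β - σ) = σ := by ring
  have hle : β - σ ≤ β := by linarith
  have a1 := h1.exponent_mono hle
  have a2 := hu.exponent_mono hle
  have a3 := h3 _ hle
  rw [e] at a1 a2 a3
  refine ⟨a1.mono (by rw [mul_assoc]), a2.mono ?_, a3.mono ?_⟩
  · rw [mul_assoc]
    exact mul_le_mul_of_nonneg_left (le_mul_of_one_le_left hM hC) (by positivity)
  · calc C * dyad (-σ) N * M = 1 * (C * M * dyad (-σ) N) := by ring
      _ ≤ 2 ^ σ * (C * M * dyad (-σ) N) := by gcongr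
      _ = _ := by ring

/-- The nonlinearity of the truncated data. -/
noncomputable def truncPsi (ν lam : ℂ) (N : ℕ) (y : TorusDist) (Z : Driver) (s : ℝ) : TorusDist :=
  psi ν lam (lowPass N y) (lowPass N (Z.Z s)) (lowPass N (Z.Zsq s)) (lowPass N (Z.absZsq s))
    (lowPass N (Z.absZsqZ s))

lemma finSupp_truncPsi (ν lam : ℂ) (N : ℕ) (y : TorusDist) (Z : Driver) (s : ℝ) :
    FinSupp (truncPsi ν lam N y Z s) :=
  finSupp_psi (finSupp_lowPass _ _) (finSupp_lowPass _ _) (finSupp_lowPass _ _) (finSupp_lowPass _ _)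
    (finSupp_lowPass _ _)

/-- Both terms are compared with the untruncated nonlinearity: truncation converges with a rate once
$\frac1{12}$ of a derivative is given up, and the truncated data enter through the Lipschitz
estimate at lower regularity. The indices fit: $-\frac14-\frac1{12}=-\frac13$ and
$\frac54-\frac1{12}=2\cdot\frac7{12}$ with $\frac7{12}>\frac13$. -/
lemma exists_truncation_error {ν lam : ℂ} {Z : Driver} (hZ : IsAdmissibleDriver Z) {Y : ℝ → TorusDist}
    {t₀ T M : ℝ} (ht₀ : 0 < t₀) (htT : t₀ ≤ T) (hM : ∀ t ∈ Icc t₀ T, BesovLE (5 / 4) (Y t) M) :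
    ∃ R : ℝ, 0 ≤ R ∧ ∀ s ∈ Icc t₀ T, ∀ N, BesovLE (-(1 / 3))
      (lowPass N (nonlinPsi ν lam (Y s) Z s) - truncPsi ν lam N (Y s) Z s) (R * dyad (-(1 / 12)) N) := by
  obtain ⟨C₁, hC₁, h₁⟩ := exists_psi_close (α := 1 / 4) (a := 5 / 8) (by norm_num) (by norm_num) ν lam
  obtain ⟨C₂, hC₂, h₂⟩ := exists_psi_close (α := 1 / 3) (a := 7 / 12) (by norm_num) (by norm_num) ν lam
  obtain ⟨C₃, hC₃, h₃⟩ := exists_lowPass_close (σ := 1 / 12) (by norm_num)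
  obtain ⟨K, hK, hd⟩ := hZ.exists_bound (α := 1 / 4) (by norm_num) (ht₀.trans_le htT)
  set K' := K + K * t₀ ^ (-(1 / 4) : ℝ)
  have hM0 : 0 ≤ M := (hM t₀ ⟨le_rfl, htT⟩).nonneg
  have hK0 : 0 ≤ K' := by positivity
  have hdr : ∀ s ∈ Icc t₀ T, BesovLE (-(1 / 4)) (Z.Z s) K' ∧ BesovLE (-(1 / 4)) (Z.Zsq s) K' ∧
      BesovLE (-(1 / 4)) (Z.absZsq s) K' ∧ BesovLE (-(1 / 4)) (Z.absZsqZ s) K' := by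
    intro s hs
    have hs0 : 0 < s := ht₀.trans_le hs.1
    obtain ⟨d1, d2, d3, d4⟩ := driver_components hs0 hK (hd s ⟨hs0, hs.2⟩)
    have hle : K * s ^ (-(1 / 4) : ℝ) ≤ K' := by
      have : s ^ (-(1 / 4) : ℝ) ≤ t₀ ^ (-(1 / 4) : ℝ) :=
        Real.rpow_le_rpow_of_nonpos ht₀ hs.1 (by norm_num)
      have := mul_le_mul_of_nonneg_left this hK
      simp only [K']
      linarith
    exact ⟨d1.mono (le_add_of_nonneg_right (by positivity)), d2.mono hle, d3.mono hle, d4.mono hle⟩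
  set P := C₁ * (K' + M + M ^ 3 + K' * M ^ 2 + K' * M + K' * M + K')
  set Q := C₂ * (C₃ * K' + C₃ * M + (C₃ * M) ^ 3 + C₃ * K' * (C₃ * M) ^ 2 + C₃ * K' * (C₃ * M)
    + C₃ * K' * (C₃ * M) + C₃ * K')
  refine ⟨C₃ * P + Q, by positivity, fun s hs N => ?_⟩
  obtain ⟨d1, d2, d3, d4⟩ := hdr s hs
  have hy := hM s hs
  have a1 : BesovLE (-(1 / 4)) (nonlinPsi ν lam (Y s) Z s) P := by
    rw [nonlinPsi_eq]
    have hy' : BesovLE (2 * (5 / 8)) (Y s) M := by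
      rw [show (2 : ℝ) * (5 / 8) = 5 / 4 by norm_num]
      exact hy
    exact (h₁ _ _ _ _ _ _ _ _ _ _ _ _ _ _ _ 0 le_rfl hy'.close d1.close d2.close d3.close
      d4.close).left
  have e1 : (-(1 / 4) : ℝ) - 1 / 12 = -(1 / 3) := by norm_num
  have e2 : (5 / 4 : ℝ) - 1 / 12 = 2 * (7 / 12) := by norm_num
  have a2 := (h₃ _ _ _ a1 N).diff
  have b0 := h₃ _ _ _ hy N
  have b1 := h₃ _ _ _ d1 N
  have b2 := h₃ _ _ _ d2 N
  have b3 := h₃ _ _ _ d3 N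
  have b4 := h₃ _ _ _ d4 N
  rw [e1] at a2 b1 b2 b3 b4
  rw [e2] at b0
  have a3 := (h₂ _ _ _ _ _ _ _ _ _ _ _ _ _ _ _ _ (dyad_pos _ N).le b0 b1 b2 b3 b4).diff
  have := a2.sub a3
  rw [← nonlinPsi_eq] at this
  have e : lowPass N (nonlinPsi ν lam (Y s) Z s) - nonlinPsi ν lam (Y s) Z s -
      (psi ν lam (lowPass N (Y s)) (lowPass N (Z.Z s)) (lowPass N (Z.Zsq s)) (lowPass N (Z.absZsq s))
        (lowPass N (Z.absZsqZ s)) - nonlinPsi ν lam (Y s) Z s)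
      = lowPass N (nonlinPsi ν lam (Y s) Z s) - truncPsi ν lam N (Y s) Z s := by
    rw [truncPsi]; abel
  rw [e] at this
  exact this.mono (le_of_eq (by ring))

/-- Uniform bounds for the truncations and their gradients. -/
lemma exists_uniform_bound {Y : ℝ → TorusDist} {S : Set ℝ} {M : ℝ}
    (hM : ∀ t ∈ S, BesovLE (5 / 4) (Y t) M) : ∃ K : ℝ, 0 ≤ K ∧ ∀ s ∈ S, ∀ x,
      (∀ N, ‖trig (lowPass N (Y s)) x‖ ≤ K ∧ ∀ l, ‖trig (partialDist l (lowPass N (Y s))) x‖ ≤ K) ∧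
      ‖distFun (Y s) x‖ ≤ K ∧ ∀ l, ‖distFun (partialDist l (Y s)) x‖ ≤ K := by
  obtain ⟨C, hC, h⟩ := exists_partial_besov
  refine ⟨max 0 (max (dyadSum (5 / 4) * M) (dyadSum (5 / 4 - 1) * (C * M))), le_max_left _ _,
    fun s hs x => ?_⟩
  have hb := hM s hs
  have hp := h _ _ _ hb
  have l1 : dyadSum (5 / 4) * M ≤ max 0 (max (dyadSum (5 / 4) * M) (dyadSum (5 / 4 - 1) * (C * M))) :=
    (le_max_left _ _).trans (le_max_right _ _)
  have l2 : dyadSum (5 / 4 - 1) * (C * M) ≤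
      max 0 (max (dyadSum (5 / 4) * M) (dyadSum (5 / 4 - 1) * (C * M))) :=
    (le_max_right _ _).trans (le_max_right _ _)
  refine ⟨fun N => ⟨(hb.norm_trig_lowPass_le (by norm_num) N x).trans l1, fun l => ?_⟩,
    (hb.norm_distFun_le (by norm_num) x).trans l1, fun l =>
    ((hp l).norm_distFun_le (by norm_num) x).trans l2⟩
  rw [← lowPass_partialDist]
  exact ((hp l).norm_trig_lowPass_le (by norm_num) N x).trans l2

/-- A uniform bound on the polynomial and its gradient bounds the duality map and its gradient, so a
small error in $\mathcal C^{-1/3}$ has a small pairing. The index $\frac13$ is admissible because it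
is below $\frac12$. -/
lemma exists_error_pairing {p K : ℝ} (hp : 2 ≤ p) (hK : 0 ≤ K) : ∃ C : ℝ, 0 ≤ C ∧
    ∀ c d : TorusDist, FinSupp c → FinSupp d → (∀ x, ‖trig c x‖ ≤ K) →
      (∀ x l, ‖trig (partialDist l c) x‖ ≤ K) → ∀ R : ℝ, BesovLE (-(1 / 3)) d R →
      ‖∫ x, trig d x * dualMap p (trig c x) ∂torusMeasure‖ ≤ C * R := by
  obtain ⟨C, hC, h⟩ := exists_pairing_bound (α := 1 / 3) (by norm_num) (by norm_num)
  have hp1 : 0 ≤ p - 1 := by linarith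
  have hp2 : 0 ≤ p - 2 := by linarith
  set A := K ^ (p - 1)
  set B := (p - 1) * K ^ (p - 2) * K
  have hA : 0 ≤ A := by positivity
  have hB : 0 ≤ B := by positivity
  refine ⟨C * (A + Real.sqrt (A * (2 * B))), by positivity, fun c d hc hd hcK hcK' R hR => ?_⟩
  obtain ⟨N, hN⟩ := hd.exists_lowPass_eq
  have P := PowerLike.dualMap hp (continuous_trig hc) (hasPD_trig hc)
  have hb : ∀ l x, ‖dualMapDeriv p (trig c x) (trig (partialDist l c) x)‖ ≤ B := by
    intro l x
    refine (norm_dualMapDeriv_le hp _ _).trans ?_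
    have := hcK x
    have := hcK' x l
    simp only [B]
    gcongr
  have := h d R hR N _ _ B P.cont P.deriv hb A (2 * B) ?_ ?_
  · rw [hN] at this
    exact this.trans (le_of_eq (by ring))
  · have : A = ∫ _x, A ∂torusMeasure := by simp
    rw [this]
    refine integral_mono (integrable_torus P.cont.norm) (integrable_const _) fun x => ?_
    refine (norm_dualMap hp _).le.trans ?_
    have := hcK x
    simp only [A]
    gcongr
  · have : 2 * B = ∑ _l : Fin 2, ∫ _x, B ∂torusMeasure := by simp
    rw [this]
    exact Finset.sum_le_sum fun l _ => integral_mono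
      (integrable_of_hasPD (P.deriv l) P.cont (hb l)).norm (integrable_const _) (hb l)

/-- The linear part commutes with truncation. `Ψ'` is added and subtracted so that the energy
estimate can act on the nonlinearity of the truncated data, leaving a commutator error. -/
lemma lowPass_generator (μ : ℝ) (N : ℕ) (y Ψ Ψ' : TorusDist) :
    lowPass N (fun k => -symA μ k * y k + Ψ k) =
      (Complex.I + μ) • (fun k => ∑ l : Fin 2, partialDist l (partialDist l (lowPass N y)) k)
        - lowPass N y + Ψ' + (lowPass N Ψ - Ψ') := by
  ext k
  have hk : ((freqNorm k ^ 2 : ℝ) : ℂ) = (k 0 : ℂ) ^ 2 + (k 1 : ℂ) ^ 2 := by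
    rw [freqNorm, Real.sq_sqrt (Finset.sum_nonneg fun l _ => sq_nonneg _)]
    simp
  have hI : Complex.I ^ 2 = -1 := Complex.I_sq
  have e : ∀ l : Fin 2, partialDist l (partialDist l (lowPass N y)) k
      = -(4 * Real.pi ^ 2 * (k l : ℂ) ^ 2 * lowPass N y k) := fun l => by
    simp only [partialDist]
    linear_combination (4 * Real.pi ^ 2 * (k l : ℂ) ^ 2 * lowPass N y k) * hI
  simp only [Pi.add_apply, Pi.sub_apply, Pi.smul_apply, smul_eq_mul, Fin.sum_univ_two, e]
  simp only [lowPass, symA, Complex.ofReal_mul, hk]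
  push_cast
  ring

/-- The energy dissipation inequality for the truncated equation at a fixed time. -/
lemma re_integral_rhs_le {μ p c₁ δ C X : ℝ} (hp : 2 ≤ p) (hcμ : c₁ ≤ μ)
    (hq : ∀ a b : ℝ, c₁ * (a ^ 2 + b ^ 2) ≤ μ * (p - 1) * a ^ 2 - (p - 2) * a * b + μ * b ^ 2)
    {ν : ℂ} (hδ₁ : 2 * δ ≤ c₁) (hδ₂ : 2 * δ ≤ ν.re) (N : ℕ) (y Ψ Ψ' : TorusDist) (hΨ' : FinSupp Ψ')
    (hf : (∫ x, trig Ψ' x * dualMap p (trig (lowPass N y) x) ∂torusMeasure).re ≤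
      -(ν.re * trigPow (p + 2) (lowPass N y))
        + δ * (trigPow (p + 2) (lowPass N y) + trigGrad p (lowPass N y)) + C * X ^ (2 * (p + 2))) :
    (∫ x, trig (lowPass N fun k => -symA μ k * y k + Ψ k) x * dualMap p (trig (lowPass N y) x)
        ∂torusMeasure).re ≤
      -(δ * (trigPow (p + 2) (lowPass N y) + trigGrad p (lowPass N y))) + C * X ^ (2 * (p + 2))
        + ‖∫ x, trig (lowPass N Ψ - Ψ') x * dualMap p (trig (lowPass N y) x) ∂torusMeasure‖ := by
  have hc := finSupp_lowPass N y
  set c := lowPass N y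
  have hcc := continuous_trig hc
  have hΦ : Continuous fun x => dualMap p (trig c x) := (continuous_dualMap hp).comp hcc
  have hdd := fun l => (hc.partialDist l).partialDist l
  have hS : FinSupp fun k => ∑ l : Fin 2, partialDist l (partialDist l c) k := .sum _ fun l _ => hdd l
  have hE : FinSupp (lowPass N Ψ - Ψ') := (finSupp_lowPass N Ψ).sub hΨ'
  have hpt : ∀ x, trig (lowPass N fun k => -symA μ k * y k + Ψ k) x * dualMap p (trig c x)
      = (Complex.I + μ) * (∑ l : Fin 2, trig (partialDist l (partialDist l c)) x * dualMap p (trig c x))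
        + -((‖trig c x‖ ^ p : ℝ) : ℂ) + trig Ψ' x * dualMap p (trig c x)
        + trig (lowPass N Ψ - Ψ') x * dualMap p (trig c x) := by
    intro x
    rw [lowPass_generator μ N y Ψ Ψ', trig_add (((hS.smul _).sub hc).add hΨ') hE,
      trig_add ((hS.smul _).sub hc) hΨ', trig_sub (hS.smul _) hc, trig_smul,
      trig_sum _ fun l _ => hdd l, ← dualMap_mul_self hp, ← Finset.sum_mul]
    ring
  have i1 : ∀ l : Fin 2, Integrable (fun x => trig (partialDist l (partialDist l c)) x
      * dualMap p (trig c x)) torusMeasure := fun l =>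
    integrable_torus ((continuous_trig (hdd l)).fun_mul hΦ)
  have i2 : Integrable (fun x => -((‖trig c x‖ ^ p : ℝ) : ℂ)) torusMeasure :=
    (integrable_torus (continuous_norm_trig_rpow hc (by linarith))).ofReal.neg
  have i3 := integrable_torus ((continuous_trig hΨ').fun_mul hΦ)
  have i4 := integrable_torus ((continuous_trig hE).fun_mul hΦ)
  have i5 := ((integrable_finsetSum Finset.univ fun l _ => i1 l).const_mul (Complex.I + μ))
  have i6 := i5.fun_add i2
  have i7 := i6.fun_add i3
  simp only [hpt]
  rw [integral_add i7 i4, integral_add i6 i3, integral_add i5 i2, integral_const_mul,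
    integral_finsetSum _ fun l _ => i1 l, integral_neg, integral_complex_ofReal]
  have h1 := re_integral_laplacian_le hp hcμ hq hc
  -- The zeroth-order part $-1$ of $A$ contributes $-\|Y\|_{L^p}^p\le0$, which is dropped.
  have h2 : (-((∫ x, ‖trig c x‖ ^ p ∂torusMeasure : ℝ) : ℂ)).re ≤ 0 := by
    have := trigPow_nonneg p c
    simpa [trigPow] using this
  have h3 := Complex.re_le_norm (∫ x, trig (lowPass N Ψ - Ψ') x * dualMap p (trig c x) ∂torusMeasure)
  have hV := trigPow_nonneg (p + 2) c
  have hG := trigGrad_nonneg p c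
  -- Dissipation is available with constants at least $2\delta$; one $\delta$ absorbs the forcing
  -- and the other remains.
  have h4 := mul_le_mul_of_nonneg_right hδ₁ hG
  have h5 := mul_le_mul_of_nonneg_right hδ₂ hV
  simp only [Complex.add_re]
  linarith

/-! Continuity in time of the integrals. -/

lemma continuousOn_integral_density {y : ℝ → Torus2 → ℂ} {dy : ℝ → Fin 2 → Torus2 → ℂ} {S : Set ℝ}
    {K p q : ℝ} (hp : 2 ≤ p) (hq : 0 ≤ q) (hyc : ∀ s ∈ S, Continuous (y s))
    (hdc : ∀ s ∈ S, ∀ l, Continuous (dy s l)) (hyK : ∀ s ∈ S, ∀ x, ‖y s x‖ ≤ K)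
    (hdK : ∀ s ∈ S, ∀ x l, ‖dy s l x‖ ≤ K) (hys : ∀ x, ContinuousOn (fun s => y s x) S)
    (hds : ∀ l x, ContinuousOn (fun s => dy s l x) S) :
    ContinuousOn (fun s => ∫ x, ‖y s x‖ ^ q ∂torusMeasure) S ∧
    ContinuousOn (fun s => ∫ x, (∑ l, ‖dy s l x‖ ^ 2) * ‖y s x‖ ^ (p - 2) ∂torusMeasure) S := by
  have hp2 : 0 ≤ p - 2 := by linarith
  constructor
  · refine continuousOn_of_dominated (bound := fun _ => K ^ q)
      (fun s hs => ((hyc s hs).norm.rpow_const fun _ => .inr hq).aestronglyMeasurable)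
      (fun s hs => .of_forall fun x => ?_) (integrable_const _)
      (.of_forall fun x => (hys x).norm.rpow_const fun _ _ => .inr hq)
    rw [Real.norm_of_nonneg (by positivity)]
    exact Real.rpow_le_rpow (norm_nonneg _) (hyK s hs x) hq
  · refine continuousOn_of_dominated (bound := fun _ => (∑ _l : Fin 2, K ^ 2) * K ^ (p - 2))
      (fun s hs => ?_) (fun s hs => .of_forall fun x => ?_) (integrable_const _)
      (.of_forall fun x => ?_)
    · exact ((continuous_finsetSum _ fun l _ => (hdc s hs l).norm.pow 2).mul
        ((hyc s hs).norm.rpow_const fun _ => .inr hp2)).aestronglyMeasurable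
    · rw [Real.norm_of_nonneg (by positivity)]
      have := hyK s hs x
      have := hdK s hs x
      gcongr with l
      exact this l
    · exact (continuousOn_finsetSum _ fun l _ => (hds l x).norm.pow 2).mul
        ((hys x).norm.rpow_const fun _ _ => .inr hp2)

/-- The spectrum of a truncation is contained in the support of the cut-off, so one finite set
serves for all times; on it the evolution is a finite system of differential equations. -/
lemma exists_lowPass_finset (N : ℕ) : ∃ F : Finset (Fin 2 → ℤ), ∀ u : TorusDist, ∀ k ∉ F,
    lowPass N u k = 0 := by
  obtain ⟨F, hF⟩ := (finSupp_lowPass N fun _ => 1).exists_finset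
  refine ⟨F, fun u k hk => ?_⟩
  have := hF k hk
  simp only [lowPass, mul_one] at this
  simp [lowPass, this]

lemma continuousOn_trig_lowPass {U : ℝ → TorusDist} {S : Set ℝ}
    (hU : ∀ k, ContinuousOn (fun s => U s k) S) (N : ℕ) (x : Torus2) :
    ContinuousOn (fun s => trig (lowPass N (U s)) x) S := by
  obtain ⟨F, hF⟩ := exists_lowPass_finset N
  have e : (fun s => trig (lowPass N (U s)) x) = fun s => ∑ k ∈ F, lowPass N (U s) k * mFourier k x :=
    funext fun s => trig_eq_sum (hF (U s)) x
  rw [e]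
  exact continuousOn_finsetSum _ fun k _ => (continuousOn_const.mul (hU k)).mul continuousOn_const

lemma exists_norm_trig_lowPass_le {U : ℝ → TorusDist} {a b : ℝ}
    (hU : ∀ k, ContinuousOn (fun s => U s k) (Icc a b)) (N : ℕ) :
    ∃ L, ∀ s ∈ Icc a b, ∀ x, ‖trig (lowPass N (U s)) x‖ ≤ L := by
  obtain ⟨F, hF⟩ := exists_lowPass_finset N
  have hc : ContinuousOn (fun s => ∑ k ∈ F, ‖lowPass N (U s) k‖) (Icc a b) :=
    continuousOn_finsetSum _ fun k _ => (continuousOn_const.mul (hU k)).norm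
  obtain ⟨L, hL⟩ := isCompact_Icc.exists_bound_of_continuousOn hc
  refine ⟨L, fun s hs x => ?_⟩
  rw [trig_eq_sum (hF (U s))]
  refine (norm_sum_le _ _).trans (le_trans (Finset.sum_le_sum fun k _ => ?_)
    ((le_abs_self _).trans (hL s hs)))
  rw [norm_mul, norm_mFourier_apply, mul_one]

/-! ### The size of the driver and its continuity in time. -/

/-- The size of the driver at time `s`. -/
noncomputable def driverSize (α : ℝ) (Z : Driver) (s : ℝ) : ℝ :=
  1 + max (s ^ (-α) * (driverNorm α Z s).toReal) (besovNorm (-α) (Z.Z s)).toReal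

lemma one_le_driverSize (α : ℝ) (Z : Driver) (s : ℝ) : 1 ≤ driverSize α Z s :=
  le_add_of_nonneg_right (le_max_of_le_right ENNReal.toReal_nonneg)

lemma BesovContinuousOn.continuousOn_norm {β : ℝ} {U : ℝ → TorusDist} {S : Set ℝ}
    (h : BesovContinuousOn β U S) : ContinuousOn (fun s => (besovNorm β (U s)).toReal) S := by
  rw [besovContinuousOn_iff] at h
  intro t ht
  refine Metric.tendsto_nhds.2 fun ε hε => ?_
  filter_upwards [(h t ht).2 (ε / 2) (half_pos hε), self_mem_nhdsWithin] with s hs hsS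
  have h1 := (besovLE_toReal (h t ht).1).add hs
  have h2 := (besovLE_toReal (h s hsS).1).sub hs
  rw [add_sub_cancel] at h1
  rw [sub_sub_cancel] at h2
  rw [Real.dist_eq, abs_lt]
  constructor <;> linarith [h1.toReal_le, h2.toReal_le]

lemma IsAdmissibleDriver.continuousOn_driverSize {Z : Driver} (hZ : IsAdmissibleDriver Z) {α : ℝ}
    (hα : 0 < α) : ContinuousOn (driverSize α Z) (Ioi 0) := by
  obtain ⟨z1, z2, z3, z4, -⟩ := hZ α hα
  have hsub : Ioi (0 : ℝ) ⊆ Ici 0 := fun s hs => (mem_Ioi.1 hs).le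
  have c1 := (z1.mono hsub).continuousOn_norm
  have hpow : ∀ e : ℝ, ContinuousOn (fun s : ℝ => s ^ e) (Ioi 0) := fun e s hs =>
    (Real.continuousAt_rpow_const s e (.inl (ne_of_gt hs))).continuousWithinAt
  have e : ∀ s ∈ Ioi (0 : ℝ), (driverNorm α Z s).toReal = max (besovNorm (-α) (Z.Z s)).toReal
      (max (s ^ α * (besovNorm (-α) (Z.Zsq s)).toReal)
        (max (s ^ α * (besovNorm (-α) (Z.absZsq s)).toReal)
          (s ^ α * (besovNorm (-α) (Z.absZsqZ s)).toReal))) := by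
    intro s hs
    have hp : 0 ≤ s ^ α := Real.rpow_nonneg (le_of_lt hs) _
    have f : ∀ u, besovNorm (-α) u < ⊤ → ENNReal.ofReal (s ^ α) * besovNorm (-α) u ≠ ⊤ := fun u hu =>
      ENNReal.mul_ne_top ENNReal.ofReal_ne_top hu.ne
    have f2 := f _ (z2 s hs).1
    have f3 := f _ (z3 s hs).1
    have f4 := f _ (z4 s hs).1
    have g4 := (max_lt f3.lt_top f4.lt_top).ne
    rw [driverNorm, ENNReal.toReal_max (z1 s (hsub hs)).1.ne (max_lt f2.lt_top g4.lt_top).ne,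
      ENNReal.toReal_max f2 g4, ENNReal.toReal_max f3 f4, ENNReal.toReal_mul, ENNReal.toReal_mul,
      ENNReal.toReal_mul, ENNReal.toReal_ofReal hp]
  have c2 : ContinuousOn (fun s => (driverNorm α Z s).toReal) (Ioi 0) :=
    ContinuousOn.congr (c1.sup (((hpow α).mul z2.continuousOn_norm).sup
      (((hpow α).mul z3.continuousOn_norm).sup ((hpow α).mul z4.continuousOn_norm)))) e
  exact continuousOn_const.add (((hpow (-α)).mul c2).sup c1)

/-- The factor $s^{-\alpha}$ undoes the weight $s^\alpha$ on the last three entries. The first entry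
carries no weight, which is why its bare norm appears in the maximum. -/
lemma IsAdmissibleDriver.besovLE_driverSize {Z : Driver} (hZ : IsAdmissibleDriver Z) {α : ℝ}
    (hα : 0 < α) {s : ℝ} (hs : 0 < s) : BesovLE (-α) (Z.Z s) (driverSize α Z s) ∧
      BesovLE (-α) (Z.Zsq s) (driverSize α Z s) ∧ BesovLE (-α) (Z.absZsq s) (driverSize α Z s) ∧
      BesovLE (-α) (Z.absZsqZ s) (driverSize α Z s) := by
  have hfin := hZ.driverNorm_lt_top hα hs
  obtain ⟨d1, d2, d3, d4⟩ := driver_components hs ENNReal.toReal_nonneg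
    (ENNReal.ofReal_toReal hfin.ne).ge
  have h1 : (besovNorm (-α) (Z.Z s)).toReal ≤ driverSize α Z s := by
    have := le_max_right (s ^ (-α) * (driverNorm α Z s).toReal) (besovNorm (-α) (Z.Z s)).toReal
    rw [driverSize]; linarith
  have h2 : (driverNorm α Z s).toReal * s ^ (-α) ≤ driverSize α Z s := by
    have := le_max_left (s ^ (-α) * (driverNorm α Z s).toReal) (besovNorm (-α) (Z.Z s)).toReal
    rw [driverSize]; linarith
  exact ⟨(besovLE_toReal d1.lt_top).mono h1, d2.mono h2, d3.mono h2, d4.mono h2⟩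

/-! The truncated energy inequality and its limit. -/

/-- The hypothesis `hf` is the conclusion of `exists_forcing_estimate`. The error constant $R$
depends on the solution and the time interval but not on $N$, so the commutator disappears as
$N\to\infty$. -/
lemma StrongSolution.truncated_energy_le {μ : ℝ} {ν lam : ℂ} {T : ℝ} {Z : Driver} {Y : ℝ → TorusDist}
    (h : StrongSolution μ ν lam T Z Y) (hZ : IsAdmissibleDriver Z) {p c₁ δ C α : ℝ} (hp : 2 ≤ p)
    (hα : 0 < α) (hcμ : c₁ ≤ μ)
    (hq : ∀ a b : ℝ, c₁ * (a ^ 2 + b ^ 2) ≤ μ * (p - 1) * a ^ 2 - (p - 2) * a * b + μ * b ^ 2)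
    (hδ₁ : 2 * δ ≤ c₁) (hδ₂ : 2 * δ ≤ ν.re)
    (hf : ∀ (c : TorusDist), FinSupp c → ∀ X : ℝ, 1 ≤ X →
      ∀ z q s w : TorusDist, BesovLE (-α) z X → BesovLE (-α) q X → BesovLE (-α) s X →
        BesovLE (-α) w X → ∀ N : ℕ,
        (∫ x, trig (psi ν lam c (lowPass N z) (lowPass N q) (lowPass N s) (lowPass N w)) x
          * dualMap p (trig c x) ∂torusMeasure).re ≤
          -(ν.re * trigPow (p + 2) c) + δ * (trigPow (p + 2) c + trigGrad p c)
            + C * X ^ (2 * (p + 2)))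
    {t₀ t : ℝ} (ht₀ : 0 < t₀) (ht : t₀ ≤ t) (htT : t ≤ T) : ∃ R : ℝ, ∀ N : ℕ,
    ContinuousOn (fun s => trigPow (p + 2) (lowPass N (Y s))) (Icc t₀ t) ∧
    ContinuousOn (fun s => trigGrad p (lowPass N (Y s))) (Icc t₀ t) ∧
    trigPow p (lowPass N (Y t)) - trigPow p (lowPass N (Y t₀)) ≤
      ∫ s in t₀..t, (-(p * δ * trigPow (p + 2) (lowPass N (Y s)) + p * δ * trigGrad p (lowPass N (Y s)))
        + p * C * driverSize α Z s ^ (2 * (p + 2)) + R * dyad (-(1 / 12)) N) := by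
  obtain ⟨M, hM⟩ := h.bound t₀ ht₀
  have hsub : Icc t₀ t ⊆ Icc t₀ T := Icc_subset_Icc_right htT
  have hsub' : Icc t₀ t ⊆ Ioc 0 T := fun s hs => ⟨ht₀.trans_le hs.1, hs.2.trans htT⟩
  obtain ⟨R, hR, herr⟩ := exists_truncation_error (ν := ν) (lam := lam) hZ ht₀ (ht.trans htT) hM
  obtain ⟨K, hK, hbd⟩ := exists_uniform_bound hM
  obtain ⟨C', hC', hpair⟩ := exists_error_pairing hp hK
  have hYc : ∀ k, ContinuousOn (fun s => Y s k) (Icc t₀ t) := fun k =>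
    (h.cont.continuousOn_coeff k).mono hsub'
  have hΨc : ∀ k, ContinuousOn (fun s => nonlinPsi ν lam (Y s) Z s k) (Icc t₀ t) := fun k =>
    (h.contPsi.continuousOn_coeff k).mono hsub'
  have hdYc : ∀ l k, ContinuousOn (fun s => partialDist l (Y s) k) (Icc t₀ t) := fun l k =>
    continuousOn_const.mul (hYc k)
  have hdens : ∀ (N : ℕ) (q : ℝ), 0 ≤ q → ContinuousOn (fun s => trigPow q (lowPass N (Y s))) (Icc t₀ t) ∧
      ContinuousOn (fun s => trigGrad p (lowPass N (Y s))) (Icc t₀ t) := fun N q hq0 =>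
    continuousOn_integral_density (y := fun s => trig (lowPass N (Y s)))
      (dy := fun s l => trig (partialDist l (lowPass N (Y s)))) hp hq0
      (fun s _ => continuous_trig (finSupp_lowPass N _))
      (fun s _ l => continuous_trig ((finSupp_lowPass N _).partialDist l))
      (fun s hs x => ((hbd s (hsub hs) x).1 N).1) (fun s hs x => ((hbd s (hsub hs) x).1 N).2)
      (fun x => continuousOn_trig_lowPass hYc N x) fun l x => by
        simp only [← lowPass_partialDist]
        exact continuousOn_trig_lowPass (hdYc l) N x
  refine ⟨p * (C' * R), fun N => ⟨(hdens N _ (by linarith)).1, (hdens N 0 le_rfl).2, ?_⟩⟩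
  set g : ℝ → TorusDist := fun s k => -symA μ k * Y s k + nonlinPsi ν lam (Y s) Z s k
  have hgc : ∀ k, ContinuousOn (fun s => g s k) (Icc t₀ t) := fun k =>
    (continuousOn_const.mul (hYc k)).add (hΨc k)
  obtain ⟨L, hL⟩ := exists_norm_trig_lowPass_le hgc N
  obtain ⟨F, hF⟩ := exists_lowPass_finset N
  have hderiv : ∀ s ∈ Ioo t₀ t, HasDerivAt (fun r => trigPow p (lowPass N (Y r)))
      (p * (∫ x, trig (lowPass N (g s)) x * dualMap p (trig (lowPass N (Y s)) x) ∂torusMeasure).re) s :=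
    fun s hs => hasDerivAt_trigPow hp (c := fun r => lowPass N (Y r)) (g := fun r => lowPass N (g r))
      (fun r => hF (Y r)) (fun r => hF (g r))
      (fun r hr k => (h.deriv k r ⟨ht₀.trans hr.1, hr.2.trans_le htT⟩).const_mul _)
      (fun r hr x => ((hbd r (hsub (Ioo_subset_Icc_self hr)) x).1 N).1)
      (fun r hr x => hL r (Ioo_subset_Icc_self hr) x) hs
  -- The derivative is needed only in the open interval, together with continuity up to the end
  -- points; this includes the case $t=T$, where the equation is not differentiated.
  refine intervalIntegral.sub_le_integral_of_hasDeriv_right_of_le ht (hdens N p (by linarith)).1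
    (fun s hs => (hderiv s hs).hasDerivWithinAt) ?_ fun s hs => ?_
  · have hX : ContinuousOn (fun s => driverSize α Z s ^ (2 * (p + 2))) (Icc t₀ t) :=
      ((hZ.continuousOn_driverSize hα).mono fun s hs => ht₀.trans_le hs.1).rpow_const
        fun s _ => .inl (by linarith [one_le_driverSize α Z s])
    exact (((((hdens N _ (by linarith)).1.const_mul (p * δ)).add ((hdens N 0 le_rfl).2.const_mul (p * δ))).neg.add
      (hX.const_mul (p * C))).add continuousOn_const).integrableOn_Icc
  · have hs' := Ioo_subset_Icc_self hs
    have hs0 : 0 < s := ht₀.trans hs.1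
    obtain ⟨d1, d2, d3, d4⟩ := hZ.besovLE_driverSize hα hs0
    have hforce := hf _ (finSupp_lowPass N (Y s)) _ (one_le_driverSize α Z s) _ _ _ _ d1 d2 d3 d4 N
    have key := re_integral_rhs_le hp hcμ hq hδ₁ hδ₂ N (Y s) (nonlinPsi ν lam (Y s) Z s)
      (truncPsi ν lam N (Y s) Z s) (finSupp_truncPsi _ _ _ _ _ _) hforce
    have hE := hpair _ _ (finSupp_lowPass N (Y s))
      ((finSupp_lowPass N (nonlinPsi ν lam (Y s) Z s)).sub (finSupp_truncPsi ν lam N (Y s) Z s))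
      (fun x => ((hbd s (hsub hs') x).1 N).1) (fun x => ((hbd s (hsub hs') x).1 N).2) _
      (herr s (hsub hs') N)
    have := mul_le_mul_of_nonneg_left (key.trans (add_le_add_right hE _)) (by linarith : 0 ≤ p)
    refine this.trans (le_of_eq ?_)
    ring

lemma BesovLE.tendsto_energy {u : TorusDist} {M : ℝ} (hu : BesovLE (5 / 4) u M) {p q : ℝ}
    (hp : 2 ≤ p) (hq : 0 ≤ q) :
    Tendsto (fun N => trigPow q (lowPass N u)) atTop (𝓝 (lqNormPow q u)) ∧
    Tendsto (fun N => trigGrad p (lowPass N u)) atTop (𝓝 (gradEnergy p u)) := by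
  obtain ⟨K, hK, hbd⟩ := exists_uniform_bound (Y := fun _ => u) (S := univ) (M := M) fun _ _ => hu
  obtain ⟨C, hC, hpar⟩ := exists_partial_besov
  have hb := fun x => hbd 0 trivial x
  have hp2 : 0 ≤ p - 2 := by linarith
  have hlim : ∀ x, Tendsto (fun N => trig (lowPass N u) x) atTop (𝓝 (distFun u x)) :=
    fun x => hu.tendsto_trig_lowPass (by norm_num) x
  have hlim' : ∀ l x, Tendsto (fun N => trig (partialDist l (lowPass N u)) x) atTop
      (𝓝 (distFun (partialDist l u) x)) := fun l x => by
    simp only [← lowPass_partialDist]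
    exact (hpar _ _ _ hu l).tendsto_trig_lowPass (by norm_num) x
  constructor
  · refine tendsto_integral_of_dominated_convergence (fun _ => K ^ q)
      (fun N => (continuous_norm_trig_rpow (finSupp_lowPass N u) hq).aestronglyMeasurable)
      (integrable_const _) (fun N => .of_forall fun x => ?_)
      (.of_forall fun x => (hlim x).norm.rpow_const (.inr hq))
    rw [Real.norm_of_nonneg (by positivity)]
    exact Real.rpow_le_rpow (norm_nonneg _) ((hb x).1 N).1 hq
  · refine tendsto_integral_of_dominated_convergence (fun _ => (∑ _l : Fin 2, K ^ 2) * K ^ (p - 2))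
      (fun N => (continuous_gradDensity (finSupp_lowPass N u) hp).aestronglyMeasurable)
      (integrable_const _) (fun N => .of_forall fun x => ?_) (.of_forall fun x => ?_)
    · rw [Real.norm_of_nonneg (by positivity)]
      have h1 := ((hb x).1 N).1
      have h2 := ((hb x).1 N).2
      gcongr with l
      exact h2 l
    · exact (tendsto_finsetSum _ fun l _ => (hlim' l x).norm.pow 2).mul
        ((hlim x).norm.rpow_const (.inr hp2))

lemma BesovContinuousOn.continuousOn_distFun {β : ℝ} (hβ : 0 < β) {U : ℝ → TorusDist} {S : Set ℝ}
    (h : BesovContinuousOn β U S) (x : Torus2) : ContinuousOn (fun s => distFun (U s) x) S := by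
  rw [besovContinuousOn_iff] at h
  intro t ht
  have hD := dyadSum_pos hβ
  refine Metric.tendsto_nhds.2 fun ε hε => ?_
  filter_upwards [(h t ht).2 (ε / (2 * dyadSum β)) (by positivity), self_mem_nhdsWithin] with s hs hsS
  rw [dist_eq_norm, ← distFun_sub hβ (besovLE_toReal (h s hsS).1) (besovLE_toReal (h t ht).1)]
  refine (hs.norm_distFun_le hβ x).trans_lt ?_
  have : dyadSum β * (ε / (2 * dyadSum β)) = ε / 2 := by field_simp
  linarith

lemma BesovContinuousOn.partialDist {β : ℝ} {U : ℝ → TorusDist} {S : Set ℝ}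
    (h : BesovContinuousOn β U S) (l : Fin 2) :
    BesovContinuousOn (β - 1) (fun s => partialDist l (U s)) S := by
  rw [besovContinuousOn_iff] at h ⊢
  obtain ⟨C, hC, hpar⟩ := exists_partial_besov
  refine fun t ht => ⟨(hpar _ _ _ (besovLE_toReal (h t ht).1) l).lt_top, fun ε hε => ?_⟩
  filter_upwards [(h t ht).2 (ε / C) (by positivity)] with s hs
  have := hpar _ _ _ hs l
  rw [mul_div_cancel₀ _ hC.ne'] at this
  convert this using 1
  ext k
  simp only [_root_.partialDist, Pi.sub_apply]
  ring

lemma StrongSolution.continuousOn_energy {μ : ℝ} {ν lam : ℂ} {T : ℝ} {Z : Driver} {Y : ℝ → TorusDist}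
    (h : StrongSolution μ ν lam T Z Y) {p q : ℝ} (hp : 2 ≤ p) (hq : 0 ≤ q) {t₀ t : ℝ} (ht₀ : 0 < t₀)
    (htT : t ≤ T) : ContinuousOn (fun s => lqNormPow q (Y s)) (Icc t₀ t) ∧
      ContinuousOn (fun s => gradEnergy p (Y s)) (Icc t₀ t) := by
  obtain ⟨M, hM⟩ := h.bound t₀ ht₀
  obtain ⟨C, hC, hpar⟩ := exists_partial_besov
  have hsub : Icc t₀ t ⊆ Icc t₀ T := Icc_subset_Icc_right htT
  have hsub' : Icc t₀ t ⊆ Ioc 0 T := fun s hs => ⟨ht₀.trans_le hs.1, hs.2.trans htT⟩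
  obtain ⟨K, hK, hbd⟩ := exists_uniform_bound hM
  exact continuousOn_integral_density (y := fun s => distFun (Y s))
    (dy := fun s l => distFun (partialDist l (Y s))) hp hq
    (fun s hs => (hM s (hsub hs)).continuous_distFun (by norm_num))
    (fun s hs l => (hpar _ _ _ (hM s (hsub hs)) l).continuous_distFun (by norm_num))
    (fun s hs x => (hbd s (hsub hs) x).2.1) (fun s hs x => (hbd s (hsub hs) x).2.2)
    (fun x => (h.cont.continuousOn_distFun (by norm_num) x).mono hsub')
    fun l x => ((h.cont.partialDist l).continuousOn_distFun (by norm_num) x).mono hsub'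

/-- The $\mathcal C^{5/4}$ bound on $[t_0,T]$ bounds the truncations and their gradients uniformly
in $N$, so dominated convergence applies to the space integrals at each time and then to the time
integral. -/
theorem StrongSolution.energy_le {μ : ℝ} {ν lam : ℂ} {T : ℝ} {Z : Driver} {Y : ℝ → TorusDist}
    (h : StrongSolution μ ν lam T Z Y) (hZ : IsAdmissibleDriver Z) {p c C α : ℝ} (hp : 2 ≤ p)
    (hα : 0 < α) {t₀ t R : ℝ} (ht₀ : 0 < t₀) (ht : t₀ ≤ t) (htT : t ≤ T)
    (hN : ∀ N : ℕ, ContinuousOn (fun s => trigPow (p + 2) (lowPass N (Y s))) (Icc t₀ t) ∧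
      ContinuousOn (fun s => trigGrad p (lowPass N (Y s))) (Icc t₀ t) ∧
      trigPow p (lowPass N (Y t)) - trigPow p (lowPass N (Y t₀)) ≤
        ∫ s in t₀..t, (-(c * trigPow (p + 2) (lowPass N (Y s)) + c * trigGrad p (lowPass N (Y s)))
          + C * driverSize α Z s ^ (2 * (p + 2)) + R * dyad (-(1 / 12)) N)) :
    lqNormPow p (Y t) - lqNormPow p (Y t₀) ≤
      ∫ s in t₀..t, (-(c * lqNormPow (p + 2) (Y s) + c * gradEnergy p (Y s))
        + C * driverSize α Z s ^ (2 * (p + 2))) := by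
  obtain ⟨M, hM⟩ := h.bound t₀ ht₀
  have hsub : Icc t₀ t ⊆ Icc t₀ T := Icc_subset_Icc_right htT
  obtain ⟨K, hK, hbd⟩ := exists_uniform_bound hM
  have hX : ContinuousOn (fun s => driverSize α Z s ^ (2 * (p + 2))) (Icc t₀ t) :=
    ((hZ.continuousOn_driverSize hα).mono fun s hs => ht₀.trans_le hs.1).rpow_const
      fun s _ => .inl (by linarith [one_le_driverSize α Z s])
  obtain ⟨B, hB⟩ := isCompact_Icc.exists_bound_of_continuousOn hX
  have hp2 : 0 ≤ p - 2 := by linarith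
  have hd1 : ∀ N, dyad (-(1 / 12)) N ≤ dyad (-(1 / 12)) 0 := fun N => by
    refine Real.rpow_le_rpow_of_exponent_le one_le_two ?_
    have : (0 : ℝ) ≤ N := N.cast_nonneg
    push_cast
    linarith
  have e := fun s (hs : s ∈ Icc t₀ t) => (hM s (hsub hs)).tendsto_energy hp (q := p + 2) (by linarith)
  have lim : Tendsto (fun N : ℕ => ∫ s in t₀..t, (-(c * trigPow (p + 2) (lowPass N (Y s))
        + c * trigGrad p (lowPass N (Y s))) + C * driverSize α Z s ^ (2 * (p + 2))
        + R * dyad (-(1 / 12)) N)) atTop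
      (𝓝 (∫ s in t₀..t, (-(c * lqNormPow (p + 2) (Y s) + c * gradEnergy p (Y s))
        + C * driverSize α Z s ^ (2 * (p + 2)) + R * 0))) := by
    refine intervalIntegral.tendsto_integral_filter_of_dominated_convergence
      (fun _ => (|c| * K ^ (p + 2) + |c| * ((∑ _l : Fin 2, K ^ 2) * K ^ (p - 2))) + |C| * B
        + |R| * dyad (-(1 / 12)) 0)
      (.of_forall fun N => ?_) (.of_forall fun N => .of_forall fun s hs => ?_)
      intervalIntegrable_const (.of_forall fun s hs => ?_)
    · rw [uIoc_of_le ht]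
      exact ContinuousOn.aestronglyMeasurable ((((((hN N).1.const_mul c).add ((hN N).2.1.const_mul c)).neg.add
        (hX.const_mul C)).add continuousOn_const).mono Ioc_subset_Icc_self) measurableSet_Ioc
    · rw [uIoc_of_le ht] at hs
      have hs' := Ioc_subset_Icc_self hs
      have hb := fun x => (hbd s (hsub hs') x).1 N
      have b1 : trigPow (p + 2) (lowPass N (Y s)) ≤ K ^ (p + 2) := by
        refine (integral_mono_of_nonneg (.of_forall fun x => by positivity) (integrable_const (K ^ (p + 2)))
          (.of_forall fun x => Real.rpow_le_rpow (norm_nonneg _) (hb x).1 (by linarith))).trans ?_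
        simp
      have b2 : trigGrad p (lowPass N (Y s)) ≤ (∑ _l : Fin 2, K ^ 2) * K ^ (p - 2) := by
        refine (integral_mono_of_nonneg (.of_forall fun x => by positivity)
          (integrable_const ((∑ _l : Fin 2, K ^ 2) * K ^ (p - 2))) (.of_forall fun x => ?_)).trans ?_
        · have h1 := (hb x).1
          have h2 := (hb x).2
          dsimp only
          gcongr with l
          exact h2 l
        · simp
      refine norm_add_le_of_le (norm_add_le_of_le ?_ ?_) ?_
      · rw [norm_neg]
        refine norm_add_le_of_le ?_ ?_
        · rw [norm_mul, Real.norm_eq_abs, Real.norm_of_nonneg (trigPow_nonneg _ _)]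
          gcongr
        · rw [norm_mul, Real.norm_eq_abs, Real.norm_of_nonneg (trigGrad_nonneg _ _)]
          gcongr
      · rw [norm_mul, Real.norm_eq_abs]
        exact mul_le_mul_of_nonneg_left (hB s hs') (abs_nonneg _)
      · rw [norm_mul, Real.norm_eq_abs, Real.norm_of_nonneg (dyad_pos _ _).le]
        exact mul_le_mul_of_nonneg_left (hd1 N) (abs_nonneg _)
    · rw [uIoc_of_le ht] at hs
      obtain ⟨l1, l2⟩ := e s (Ioc_subset_Icc_self hs)
      exact (((l1.const_mul c).add (l2.const_mul c)).neg.add_const _).add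
        ((tendsto_dyad_neg (by norm_num)).const_mul R)
  simp only [mul_zero, add_zero] at lim
  have lt1 := ((hM t (hsub ⟨ht, le_rfl⟩)).tendsto_energy hp (q := p) (by linarith)).1
  have lt0 := ((hM t₀ (hsub ⟨le_rfl, ht⟩)).tendsto_energy hp (q := p) (by linarith)).1
  exact le_of_tendsto_of_tendsto' (lt1.sub lt0) lim fun N => (hN N).2.2

/-! ### Choice of the constants and conclusion. -/

theorem mainTheorem4 (μ : ℝ) (hμ : 0 < μ) (ν lam : ℂ) (hν : 0 < ν.re)
    (p : ℝ) (hp : 2 ≤ p) (hp' : p < 2 * (1 + μ ^ 2 + μ * Real.sqrt (1 + μ ^ 2))) :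
    ∃ b c : ℝ, 1 ≤ b ∧ 0 < c ∧ ∀ α : ℝ, 0 < α → α < 1 / 2 → ∃ C : ℝ, 0 < C ∧
      ∀ (α₀ : ℝ) (_ : 0 < α₀) (_ : α₀ < 2 / 3)
        (Y₀ : TorusDist) (_ : besovNorm (-α₀) Y₀ < ⊤)
        (Z : Driver) (_ : IsAdmissibleDriver Z)
        (T : ℝ) (_ : 0 < T) (Y : ℝ → TorusDist) (_ : IsSolution μ ν lam T Y₀ Z Y),
        (∃ β : ℝ, 1 < β ∧ BesovContinuousOn β Y (Ioc 0 T)) ∧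
        ∀ t₀ t : ℝ, 0 < t₀ → t₀ ≤ t → t ≤ T →
          IntervalIntegrable (fun s => lqNormPow (p + 2) (Y s)) volume t₀ t ∧
          IntervalIntegrable (fun s => gradEnergy p (Y s)) volume t₀ t ∧
          IntervalIntegrable
            (fun s => (1 + max (s ^ (-α) * (driverNorm α Z s).toReal)
              (besovNorm (-α) (Z.Z s)).toReal) ^ b) volume t₀ t ∧
          lqNormPow p (Y t) - lqNormPow p (Y t₀)
              + c * (∫ s in t₀..t, lqNormPow (p + 2) (Y s))
              + c * (∫ s in t₀..t, gradEnergy p (Y s))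
            ≤ C * ∫ s in t₀..t,
                (1 + max (s ^ (-α) * (driverNorm α Z s).toReal)
                  (besovNorm (-α) (Z.Z s)).toReal) ^ b := by
  obtain ⟨c₁, hc₁, hcμ, hq⟩ := exists_ellipticity hμ hp hp'
  -- Half of the smaller dissipation constant, from the elliptic part and from the cubic term, is
  -- reserved for absorbing the forcing.
  set δ := min c₁ ν.re / 2
  have hm : 0 < min c₁ ν.re := lt_min hc₁ hν
  have hδ : 0 < δ := half_pos hm
  have hδ₁ : 2 * δ ≤ c₁ := by simp only [δ]; linarith [min_le_left c₁ ν.re]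
  have hδ₂ : 2 * δ ≤ ν.re := by simp only [δ]; linarith [min_le_right c₁ ν.re]
  have hp0 : 0 < p := by linarith
  -- The exponent comes from Young's inequality, and the factor $p$ from differentiating $|Y|^p$.
  -- Neither involves $\alpha$; only $C$ does.
  refine ⟨2 * (p + 2), p * δ, by linarith, by positivity, fun α hα hα' => ?_⟩
  obtain ⟨C, hC, hf⟩ := exists_forcing_estimate hα hα' hp hδ ν lam
  refine ⟨p * C, by positivity, fun α₀ hα₀ hα₀' Y₀ hY₀ Z hZ T hT Y hY => ?_⟩
  have h := hY.strong hμ hα₀ hα₀' hY₀ hZ hT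
  refine ⟨⟨9 / 8, by norm_num, h.cont⟩, fun t₀ t ht₀ ht htT => ?_⟩
  obtain ⟨R, hN⟩ := h.truncated_energy_le hZ hp hα hcμ hq hδ₁ hδ₂ hf ht₀ ht htT
  have hE := h.energy_le hZ hp hα ht₀ ht htT hN
  obtain ⟨k1, k2⟩ := h.continuousOn_energy hp (q := p + 2) (by linarith) ht₀ htT
  have hX : ContinuousOn (fun s => driverSize α Z s ^ (2 * (p + 2))) (Icc t₀ t) :=
    ((hZ.continuousOn_driverSize hα).mono fun s hs => ht₀.trans_le hs.1).rpow_const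
      fun s _ => .inl (by linarith [one_le_driverSize α Z s])
  have j1 := k1.intervalIntegrable_of_Icc (μ := volume) ht
  have j2 := k2.intervalIntegrable_of_Icc (μ := volume) ht
  have j3 := hX.intervalIntegrable_of_Icc (μ := volume) ht
  refine ⟨j1, j2, j3, ?_⟩
  have j4 : IntervalIntegrable
      (fun s => -(p * δ * lqNormPow (p + 2) (Y s) + p * δ * gradEnergy p (Y s))) volume t₀ t :=
    ((j1.const_mul (p * δ)).add (j2.const_mul (p * δ))).neg
  rw [intervalIntegral.integral_add j4 (j3.const_mul _), intervalIntegral.integral_neg,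
    intervalIntegral.integral_add (j1.const_mul _) (j2.const_mul _),
    intervalIntegral.integral_const_mul, intervalIntegral.integral_const_mul,
    intervalIntegral.integral_const_mul] at hE
  simp only [driverSize] at hE
  linarith
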